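/- **Theorem (witnessing Boolean matrix multiplication).** Let $A,B$ be Boolean matrices of dimensions $d_1\times d_3$ and $d_3\times d_2$, with $d_1,d_2,d_3\ge 1$. A matrix $W$ of dimensions $d_1\times d_2$ with entries in $[d_3]\cup\{\emptyset\}$, $[d_3]=\{1,\dots,d_3\}$, is a *correct witness matrix* if for all $i,j$: whenever $W_{ij}=k\in[d_3]$ one has $A_{ik}=B_{kj}=1$, and whenever $W_{ij}=\emptyset$ there is no $k$ with $A_{ik}=B_{kj}=1$. Put $$\psi_1=d_1+d_2+d_3,\qquad \psi_2=d_1d_2+d_1d_3+d_2d_3,\qquad \psi_3=d_1d_2d_3 .$$ *Pseudo-product.* For integers $b\ge1$, $s\ge0$ let $m=2^sb$ and identify $[m]$ with $\{0,1\}^s\times[b]$, writing $x=(x',x'')$. The pseudo-product of $m\times m$ matrices over a commutative ring is $(X\otimes Y)_{xy}=\sum_{z:\,x'\vee y'\vee z'=\vec 1}X_{xz}Y_{zy}$. It is computed by $s$ levels of the broken Strassen recursion (each level uses 14 additions/subtractions and 6 recursive multiplications of $2\times2$ block matrices, and omits only the term $X_{11}Y_{11}$ of the first block), followed by ordinary multiplication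 of $b\times b$ matrices. *Procedure 1$(s)$ (estimate of the Boolean product).* Draw independent uniformly random functions $f_i:[m]\to[d_i]$ $(i=1,2,3)$ and a uniformly random $m\times m$ binary matrix $D$. Over $GF(2)$ compute $\bar C=\bar A\otimes\bar B$, where $\bar A_{xz}=A_{f_1(x)f_3(z)}$ and $\bar B_{zy}=B_{f_3(z)f_2(y)}D_{zy}$. Return $\tilde C_{ij}=\bigvee_{x\in f_1^{-1}(i),\,y\in f_2^{-1}(j)}\bar C_{xy}$. *Procedure 2$(s)$ (one witness trial).* Draw independent uniformly random functions $f_i:[m]\to[d_i]$ $(i=1,2,3)$. Over the integers compute $\bar C=\bar A\otimes\bar B$, where $\bar A_{xz}=A_{f_1(x)f_3(z)}$ and $\bar B_{zy}=f_3(z)\,B_{f_3(z)f_2(y)}$. For each pair $x,y\in[m]$, with $i=f_1(x)$, $j=f_2(y)$, $k=\bar C_{xy}$: if $k\in[d_3]$ and $A_{ik}B_{kj}=1$, set $W_{ij}\leftarrow k$. *Procedure 3 (the algorithm).* Fix constants $b\in\{1,2,\dots\}$ and $c>0$. Let $s_{\max}=\lceil\log_7(b^{-3}\psi_3\log\psi_3)\rceil$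 and $s_0=\lceil\log_7((2+3c)\,b^{-3}\psi_3\log\psi_3)\rceil$, where $\log$ is the natural logarithm and a negative value is replaced by $0$. 1. Compute $\tilde C$ by Procedure 1$(s_0)$, and set all $W_{ij}\leftarrow\emptyset$. 2. For $s=0,\dots,s_{\max}$: run $20\cdot4^{s_{\max}-s}$ independent trials of Procedure 2$(s)$, each writing the entries that it finds into $W$. 3. Choose a uniformly random permutation $\pi$ of $[d_3]$. For each pair $i,j$ with $\tilde C_{ij}=1$ and $W_{ij}=\emptyset$, search $k=1,2,\dots,d_3$ in order, and at the first $k$ with $A_{i\pi(k)}B_{\pi(k)j}=1$ set $W_{ij}\leftarrow\pi(k)$ and stop the search for $i,j$. The running time is the number of unit-cost operations (integer and $GF(2)$ arithmetic, comparisons, array accesses, draws of a uniform element of a range, control of loop iterations). **Claim.** For all constants $b$ and $c$ there is a constant $K$, depending only on $b$ and $c$, such that for all $d_1,d_2,d_3\ge1$ with $$\psi_1\le\psi_3^{0.345}\quad\text{and}\quad\psi_2\le\psi_3^{0.681}$$ and all $A,B$ as above, the matrix $W$ that Procedure 3 returns is a correct witness matrix with probability at least $1-K\psi_3^{-c}$,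 and the expected running time of Procedure 3 is at most $$K\,(\psi_3\log\psi_3)^{\frac{\log 6}{\log 7}} .$$ -/

import Mathlib

open scoped ENNReal

/-! # Randomized computations with a step count

The cost model is the unit-cost (integer) RAM: one arithmetic operation, one comparison, one
access to an array entry, one draw of a uniform integer from a range, and the control of one loop
iteration take one step each. Every such operation of an algorithm below is wrapped in `op`, `draw`
or `charge`. -/

/-- A randomized computation: the joint law of its result and of the number of steps it takes. -/
def Comp (α : Type) : Type := PMF (α × ℕ)

namespace Comp

noncomputable section

/-- Sequential composition; the numbers of steps add up. -/
instance : Monad Comp where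
  pure a := (PMF.pure (a, 0) : PMF _)
  bind p f := PMF.bind p fun r => PMF.map (fun q => (q.1, r.2 + q.2)) (f r.1)

/-- `n` steps without a result. -/
def charge (n : ℕ) : Comp Unit := (PMF.pure ((), n) : PMF _)

/-- One elementary deterministic operation (an array access, an arithmetic operation, a test or a
conversion of a single value) with result `a`: one step. -/
def op {α : Type} (a : α) : Comp α := (PMF.pure (a, 1) : PMF _)

/-- A fresh uniformly random element of `{0, …, n - 1}`: one step. -/
def draw (n : ℕ) [NeZero n] : Comp (Fin n) :=
  PMF.map (fun a => (a, 1)) (PMF.uniformOfFintype (Fin n))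

/-- `for i in l do s ← body s i`, with one step of control for each iteration. -/
def forEach {ι σ : Type} : List ι → σ → (σ → ι → Comp σ) → Comp σ
  | [], s, _ => pure s
  | i :: l, s, body => do
      charge 1
      let s' ← body s i
      forEach l s' body

/-- Fill an array of length `n`: the entries are computed one after the other, and each of them
takes one further step to be stored. -/
def tabulateFin {α : Type} : (n : ℕ) → (Fin n → Comp α) → Comp (Fin n → α)
  | 0, _ => pure Fin.elim0
  | n + 1, g => do
      let a ← g 0
      charge 1
      let h ← tabulateFin n fun i => g i.succ
      pure (Fin.cons a h)

/-- Fill an array with a finite index set, in some fixed order of the indices. -/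
def tabulate {ι α : Type} [Fintype ι] (g : ι → Comp α) : Comp (ι → α) := do
  let h ← tabulateFin (Fintype.card ι) fun i => g ((Fintype.equivFin ι).symm i)
  pure fun i => h (Fintype.equivFin ι i)

/-- Fill a matrix. -/
def tabulate₂ {ι κ α : Type} [Fintype ι] [Fintype κ] (g : ι → κ → Comp α) :
    Comp (Matrix ι κ α) := do
  let h ← tabulate fun p : ι × κ => g p.1 p.2
  pure fun i j => h (i, j)

/-- The probability that the result lies in `S`. -/
def prob {α : Type} (p : Comp α) (S : Set α) : ℝ≥0∞ :=
  PMF.toOuterMeasure p {r | r.1 ∈ S}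

/-- The expected number of steps. -/
def expectedCost {α : Type} (p : Comp α) : ℝ≥0∞ :=
  ∑' r : α × ℕ, (show PMF (α × ℕ) from p) r * (r.2 : ℝ≥0∞)

end

end Comp

namespace BoolMM

noncomputable section

open Comp

/-! # Broken Strassen multiplication

The index set `[m]`, `m = 2 ^ s * b`, is `{0,1}^s × [b]`. -/

abbrev Idx (s b : ℕ) : Type := (Fin s → Bool) × Fin b

/-- The index with leading bit `c` and remaining part `x`. -/
def Idx.push {s b : ℕ} (c : Bool) (x : Idx s b) : Idx (s + 1) b := (Fin.cons c x.1, x.2)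

/-- The index without its leading bit. -/
def Idx.rest {s b : ℕ} (x : Idx (s + 1) b) : Idx s b := (Fin.tail x.1, x.2)

abbrev SqMat (s b : ℕ) (R : Type) : Type := Matrix (Idx s b) (Idx s b) R

section Ring

variable {R : Type} [CommRing R] {s b : ℕ}

/-- Entrywise sum. -/
def addMat (X Y : SqMat s b R) : Comp (SqMat s b R) :=
  tabulate₂ fun x y => do
    let u ← op (X x y)
    let v ← op (Y x y)
    op (u + v)

/-- Entrywise difference. -/
def subMat (X Y : SqMat s b R) : Comp (SqMat s b R) :=
  tabulate₂ fun x y => do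
    let u ← op (X x y)
    let v ← op (Y x y)
    op (u - v)

/-- Copy the block whose row indices start with `p` and whose column indices start with `q`. -/
def block (X : SqMat (s + 1) b R) (p q : Bool) : Comp (SqMat s b R) :=
  tabulate₂ fun x y => op (X (x.push p) (y.push q))

/-- Assemble a matrix from its four blocks. -/
def assemble (X₁₁ X₁₂ X₂₁ X₂₂ : SqMat s b R) : Comp (SqMat (s + 1) b R) :=
  tabulate₂ fun x y => do
    let p ← op (x.1 0)
    let q ← op (y.1 0)
    match p, q with
    | false, false => op (X₁₁ x.rest y.rest)
    | false, true => op (X₁₂ x.rest y.rest)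
    | true, false => op (X₂₁ x.rest y.rest)
    | true, true => op (X₂₂ x.rest y.rest)

/-- Ordinary multiplication of matrices by three nested loops. -/
def naiveMul (X Y : SqMat s b R) : Comp (SqMat s b R) :=
  tabulate₂ fun x y =>
    forEach (Finset.univ : Finset (Idx s b)).toList 0 fun acc z => do
      let u ← op (X x z)
      let v ← op (Y z y)
      let w ← op (u * v)
      op (acc + w)

/-- The pseudo-product: `s` levels of the broken Strassen step (14 additions and 6 multiplications
of blocks, computing the block product without the term `X₁₁ Y₁₁` of the first block), then
ordinary multiplication of `b × b` matrices. -/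
def pseudoMul : (s : ℕ) → SqMat s b R → SqMat s b R → Comp (SqMat s b R)
  | 0, X, Y => naiveMul X Y
  | s + 1, X, Y => do
      let X₁₁ ← block X false false
      let X₁₂ ← block X false true
      let X₂₁ ← block X true false
      let X₂₂ ← block X true true
      let Y₁₁ ← block Y false false
      let Y₁₂ ← block Y false true
      let Y₂₁ ← block Y true false
      let Y₂₂ ← block Y true true
      let S₁ ← addMat X₂₁ X₂₂
      let S₂ ← subMat S₁ X₁₂
      let S₃ ← subMat X₁₂ X₂₂
      let S₄ ← subMat X₁₁ S₂
      let T₁ ← subMat Y₂₂ Y₂₁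
      let T₂ ← subMat Y₁₂ T₁
      let T₃ ← subMat Y₁₂ Y₂₂
      let T₄ ← subMat T₂ Y₁₁
      let P₁ ← pseudoMul s X₁₂ Y₂₁
      let P₂ ← pseudoMul s S₄ Y₁₂
      let P₃ ← pseudoMul s X₂₁ T₄
      let P₄ ← pseudoMul s S₁ T₁
      let P₅ ← pseudoMul s S₂ T₂
      let P₆ ← pseudoMul s S₃ T₃
      let U₁ ← addMat P₁ P₅
      let U₂ ← addMat U₁ P₆
      let U₃ ← addMat U₁ P₄
      let Z₁₂ ← addMat U₃ P₂
      let Z₂₁ ← subMat U₂ P₃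
      let Z₂₂ ← addMat U₂ P₄
      assemble P₁ Z₁₂ Z₂₁ Z₂₂

end Ring

/-! # The algorithms -/

section Algorithms

variable {d₁ d₂ d₃ : ℕ} [NeZero d₁] [NeZero d₂] [NeZero d₃]

/-- All pairs of indices, in some fixed order. -/
def allPairs (ι κ : Type) [Fintype ι] [Fintype κ] : List (ι × κ) :=
  (Finset.univ : Finset (ι × κ)).toList

/-- Overwrite one entry of a matrix. -/
def setEntry {m n : ℕ} {α : Type} (X : Matrix (Fin m) (Fin n) α) (i : Fin m) (j : Fin n) (a : α) :
    Matrix (Fin m) (Fin n) α :=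
  Function.update X i (Function.update (X i) j a)

/-- One-sided Monte Carlo estimate of the Boolean product of `A` and `B`, by one pseudo-product
over the field with two elements. -/
def estimateProduct (s b : ℕ) (A : Matrix (Fin d₁) (Fin d₃) Bool)
    (B : Matrix (Fin d₃) (Fin d₂) Bool) : Comp (Matrix (Fin d₁) (Fin d₂) Bool) := do
  let f₁ ← tabulate fun _ : Idx s b => draw d₁
  let f₂ ← tabulate fun _ : Idx s b => draw d₂
  let f₃ ← tabulate fun _ : Idx s b => draw d₃
  let D ← tabulate₂ fun (_ _ : Idx s b) => draw 2
  let A' : SqMat s b (ZMod 2) ← tabulate₂ fun x z => do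
    let i ← op (f₁ x)
    let k ← op (f₃ z)
    let u ← op (A i k)
    op (if u then 1 else 0)
  let B' : SqMat s b (ZMod 2) ← tabulate₂ fun z y => do
    let k ← op (f₃ z)
    let j ← op (f₂ y)
    let v ← op (B k j)
    let e ← op (D z y)
    op (if v = true ∧ e = 1 then 1 else 0)
  let C' ← pseudoMul s A' B'
  let C₀ ← tabulate₂ fun (_ : Fin d₁) (_ : Fin d₂) => op false
  forEach (allPairs (Idx s b) (Idx s b)) C₀ fun C p => do
    let c ← op (C' p.1 p.2)
    let t ← op (decide (c = 1))
    if t then do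
      let i ← op (f₁ p.1)
      let j ← op (f₂ p.2)
      op (setEntry C i j true)
    else pure C

/-- The integers `1, …, d` stand for the elements of `Fin d`. -/
def decode (d : ℕ) (c : ℤ) : Option (Fin d) :=
  if h : 1 ≤ c ∧ c ≤ d then some ⟨(c - 1).toNat, by omega⟩ else none

/-- One trial of the witness estimation, by one pseudo-product over the integers. The entries
that the trial finds are written directly into `W`. -/
def witnessTrial (s b : ℕ) (A : Matrix (Fin d₁) (Fin d₃) Bool)
    (B : Matrix (Fin d₃) (Fin d₂) Bool) (W : Matrix (Fin d₁) (Fin d₂) (Option (Fin d₃))) :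
    Comp (Matrix (Fin d₁) (Fin d₂) (Option (Fin d₃))) := do
  let f₁ ← tabulate fun _ : Idx s b => draw d₁
  let f₂ ← tabulate fun _ : Idx s b => draw d₂
  let f₃ ← tabulate fun _ : Idx s b => draw d₃
  let A' : SqMat s b ℤ ← tabulate₂ fun x z => do
    let i ← op (f₁ x)
    let k ← op (f₃ z)
    let u ← op (A i k)
    op (if u then 1 else 0)
  let B' : SqMat s b ℤ ← tabulate₂ fun z y => do
    let k ← op (f₃ z)
    let j ← op (f₂ y)
    let v ← op (B k j)
    op (if v then (k : ℤ) + 1 else 0)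
  let C' ← pseudoMul s A' B'
  forEach (allPairs (Idx s b) (Idx s b)) W fun W p => do
    let i ← op (f₁ p.1)
    let j ← op (f₂ p.2)
    let c ← op (C' p.1 p.2)
    let r ← op (decode d₃ c)
    match r with
    | none => pure W
    | some k => do
        let u ← op (A i k)
        let v ← op (B k j)
        if u && v then op (setEntry W i j (some k)) else pure W

/-- A random permutation, by exchanging entry `i` with a random entry `j ≤ i` for `i = 0, …, d - 1`
(four array accesses each). -/
def shuffle (d : ℕ) : Comp (Equiv.Perm (Fin d)) := do
  charge d
  forEach (List.finRange d) 1 fun π i => do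
    let j ← draw (i.val + 1)
    charge 4
    pure (π * Equiv.swap i (Fin.castLE i.isLt j))

/-- The first `π k`, for `k` in the list, which is a witness for the entry `i, j`. -/
def search (A : Matrix (Fin d₁) (Fin d₃) Bool) (B : Matrix (Fin d₃) (Fin d₂) Bool)
    (π : Equiv.Perm (Fin d₃)) (i : Fin d₁) (j : Fin d₂) :
    List (Fin d₃) → Comp (Option (Fin d₃))
  | [] => pure none
  | k :: l => do
      charge 1
      let p ← op (π k)
      let u ← op (A i p)
      let v ← op (B p j)
      if u && v then pure (some p) else search A B π i j l

/-- `d₁ + d₂ + d₃` -/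
def ψ₁ (d₁ d₂ d₃ : ℕ) : ℝ := d₁ + d₂ + d₃

/-- `d₁ d₂ + d₁ d₃ + d₂ d₃` -/
def ψ₂ (d₁ d₂ d₃ : ℕ) : ℝ := d₁ * d₂ + d₁ * d₃ + d₂ * d₃

/-- `d₁ d₂ d₃` -/
def ψ₃ (d₁ d₂ d₃ : ℕ) : ℝ := d₁ * d₂ * d₃

/-- The number `⌈log₇ (a b⁻³ ψ₃ log ψ₃)⌉` of levels. -/
def levels (a : ℝ) (b d₁ d₂ d₃ : ℕ) : ℕ :=
  ⌈Real.logb 7 (a * ((b : ℝ) ^ 3)⁻¹ * ψ₃ d₁ d₂ d₃ * Real.log (ψ₃ d₁ d₂ d₃))⌉₊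

/-- The algorithm for witnessing Boolean matrix multiplication. The constant `c` is the exponent
of the error probability at which the Boolean product is computed in the first line. -/
def witnessProduct (c : ℝ) (b : ℕ) (A : Matrix (Fin d₁) (Fin d₃) Bool)
    (B : Matrix (Fin d₃) (Fin d₂) Bool) : Comp (Matrix (Fin d₁) (Fin d₂) (Option (Fin d₃))) := do
  let C ← estimateProduct (levels (2 + 3 * c) b d₁ d₂ d₃) b A B
  let W₀ ← tabulate₂ fun (_ : Fin d₁) (_ : Fin d₂) => op (none : Option (Fin d₃))
  let sMax := levels 1 b d₁ d₂ d₃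
  let W₁ ← forEach (List.range (sMax + 1)) W₀ fun W s =>
    forEach (List.range (20 * 4 ^ (sMax - s))) W fun W _ => witnessTrial s b A B W
  let π ← shuffle d₃
  forEach (allPairs (Fin d₁) (Fin d₂)) W₁ fun W p => do
    let u ← op (C p.1 p.2)
    let w ← op (W p.1 p.2)
    if u && w.isNone then do
      let r ← search A B π p.1 p.2 (List.finRange d₃)
      op (setEntry W p.1 p.2 r)
    else pure W

end Algorithms

/-- `W` is a correct witness matrix for the Boolean product of `A` and `B`. -/
def IsWitnessMatrix {d₁ d₂ d₃ : ℕ} (A : Matrix (Fin d₁) (Fin d₃) Bool)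
    (B : Matrix (Fin d₃) (Fin d₂) Bool) (W : Matrix (Fin d₁) (Fin d₂) (Option (Fin d₃))) : Prop :=
  ∀ i j, (∀ k, W i j = some k → A i k = true ∧ B k j = true) ∧
    (W i j = none → ∀ k, ¬ (A i k = true ∧ B k j = true))

end

end BoolMM

/-! Write X = ψ₃, L = log X. One broken Strassen level keeps seven of the eight bit patterns (x, y,
z), so `pseudoProd` sums over 7^s b^3 covering triples and costs O(6^s b^3) steps
(`isDet_pseudoMul`, `pseudoCost_le`). Fix an entry i, j with w witnesses. The preimages of i, of j
and of the witness set under f₁, f₂, f₃ are independent random sets of densities 1/d₁, 1/d₂, w/d₃,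
so the expected number of covering triples in their product is μ = 7^s b^3 w / X. By Janson's
inequality (`janson`, `bE_noHit_le`) there is none with probability at most exp(-μ + Δ), where Δ
bounds the expected number of overlapping pairs. Counting bit by bit gives 25^s b^5 pairs of
covering triples with a common vertex in a prescribed class and 13^s b^4 with a common pair in two
prescribed classes. Since 7^s is at most of order X L, the hypotheses on ψ₁ and ψ₂ are what makes Δ,
for w = 1, a negative power of X (`exists_pairBound_le`).

Correctness. Every entry written is checked, and the final search fills every entry of the estimate
that is still empty. An error therefore requires that the estimate misses an entry of the Boolean
product. Over GF(2) the mask D makes each column that contains a covering triple visible with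
probability at least 1/2 independently of the others. This has the effect of thinning the preimage
of j to density 1/(2 d₂) (`expect_estimate_miss_le`). At the level of the estimate the exponent is
at least (1 + c) L up to a constant, and a union bound over d₁ d₂ ≤ X entries leaves a constant
times X^(-c).

Running time. A trial fills an entry if some x, y has exactly one covering z among the witnesses,
because the integer sum is then the name of that witness. It fails with probability at most exp(-μ +
Δ) + Δ (`expect_witnessTrial_miss_le`). Going down t levels from the top divides μ by 7^t and Δ by
at least 13^t, so t of order log w / log (13/7) makes Δ small against μ, although Δ grows like w^2.
The 20 · 4^t trials there leave the entry empty with probability at most X^(-0.08)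
(`exists_missBound_pow_le`). All levels together cost O(6^n), n being the top level, since the sum
of 4^(n-s) 6^s is geometric. A search along a random permutation takes O(d₃ / w) expected steps
(`expect_waiting_le`). Searching the empty entries thus costs O(X^0.92) in expectation, which is
absorbed because log 6 / log 7 > 0.92. -/

namespace Comp

noncomputable section

/-! # Expectations of randomized computations -/

section Calculus

variable {α β : Type}

/-- The joint law of the result and of the number of steps. -/
def law (p : Comp α) : PMF (α × ℕ) := p

/-- The expectation of a function of the result and of the number of steps. -/
def mean (p : Comp α) (G : α × ℕ → ℝ≥0∞) : ℝ≥0∞ :=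
  ∑' r : α × ℕ, (law p) r * G r

/-- The expectation of a function of the result. -/
def expect (p : Comp α) (F : α → ℝ≥0∞) : ℝ≥0∞ := mean p fun r => F r.1

/-- The computation with result `a` and `n` steps. -/
def det (a : α) (n : ℕ) : Comp α := (PMF.pure (a, n) : PMF _)

theorem pure_eq_det (a : α) : (pure a : Comp α) = det a 0 := rfl
theorem charge_eq_det (n : ℕ) : charge n = det () n := rfl

theorem tsum_pmf_bind {γ δ : Type} (p : PMF γ) (f : γ → PMF δ) (G : δ → ℝ≥0∞) :
    ∑' d, (p.bind f) d * G d = ∑' a, p a * ∑' d, f a d * G d := by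
  simp_rw [PMF.bind_apply, ← ENNReal.tsum_mul_right, ← ENNReal.tsum_mul_left]
  rw [ENNReal.tsum_comm]
  simp_rw [mul_assoc]

theorem tsum_pmf_pure {γ : Type} (a : γ) (G : γ → ℝ≥0∞) :
    ∑' d, (PMF.pure a) d * G d = G a := by
  rw [tsum_eq_single a]
  · simp
  · intro b hb
    simp [hb]

theorem tsum_pmf_map {γ δ : Type} (p : PMF γ) (f : γ → δ) (G : δ → ℝ≥0∞) :
    ∑' d, (PMF.map f p) d * G d = ∑' a, p a * G (f a) := by
  rw [← PMF.bind_pure_comp, tsum_pmf_bind]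
  simp_rw [Function.comp_apply, tsum_pmf_pure]

theorem mean_det (a : α) (n : ℕ) (G : α × ℕ → ℝ≥0∞) : mean (det a n) G = G (a, n) :=
  tsum_pmf_pure _ _

theorem mean_bind (p : Comp α) (f : α → Comp β) (G : β × ℕ → ℝ≥0∞) :
    mean (p >>= f) G = mean p fun r => mean (f r.1) fun q => G (q.1, r.2 + q.2) := by
  exact (tsum_pmf_bind _ _ _).trans (tsum_congr fun r => congrArg _ (tsum_pmf_map _ _ _))

theorem mean_const (p : Comp α) (c : ℝ≥0∞) : mean p (fun _ => c) = c := by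
  unfold mean
  rw [ENNReal.tsum_mul_right, PMF.tsum_coe, one_mul]

theorem mean_add (p : Comp α) (F G : α × ℕ → ℝ≥0∞) :
    mean p (fun r => F r + G r) = mean p F + mean p G := by
  unfold mean
  simp_rw [mul_add]
  exact ENNReal.tsum_add

theorem mean_mono {p : Comp α} {F G : α × ℕ → ℝ≥0∞} (h : ∀ r, F r ≤ G r) :
    mean p F ≤ mean p G :=
  ENNReal.tsum_le_tsum fun r => mul_le_mul_right (h r) _

@[simp] theorem expect_det (a : α) (n : ℕ) (F : α → ℝ≥0∞) : expect (det a n) F = F a :=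
  mean_det _ _ _

@[simp] theorem expect_bind (p : Comp α) (f : α → Comp β) (F : β → ℝ≥0∞) :
    expect (p >>= f) F = expect p fun a => expect (f a) F :=
  mean_bind _ _ _

@[simp] theorem expect_const (p : Comp α) (c : ℝ≥0∞) : expect p (fun _ => c) = c :=
  mean_const _ _

theorem expect_add (p : Comp α) (F G : α → ℝ≥0∞) :
    expect p (fun r => F r + G r) = expect p F + expect p G :=
  mean_add _ _ _

theorem expect_mono {p : Comp α} {F G : α → ℝ≥0∞} (h : ∀ a, F a ≤ G a) :
    expect p F ≤ expect p G :=
  mean_mono fun r => h r.1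

theorem expect_const_mul (p : Comp α) (c : ℝ≥0∞) (F : α → ℝ≥0∞) :
    expect p (fun a => c * F a) = c * expect p F := by
  unfold expect mean
  rw [← ENNReal.tsum_mul_left]
  exact tsum_congr fun r => by ring

theorem expect_mul_const (p : Comp α) (c : ℝ≥0∞) (F : α → ℝ≥0∞) :
    expect p (fun a => F a * c) = expect p F * c := by
  simp_rw [mul_comm _ c]
  exact expect_const_mul p c F

theorem expect_sum {ι : Type} (p : Comp α) (s : Finset ι) (F : ι → α → ℝ≥0∞) :
    expect p (fun a => ∑ i ∈ s, F i a) = ∑ i ∈ s, expect p (F i) := by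
  classical
  induction s using Finset.induction_on with
  | empty => simp
  | insert i s hi ih => simp_rw [Finset.sum_insert hi, expect_add, ih]

theorem expectedCost_eq_mean (p : Comp α) : p.expectedCost = mean p fun r => (r.2 : ℝ≥0∞) := rfl

@[simp] theorem expectedCost_det (a : α) (n : ℕ) : (det a n).expectedCost = n :=
  mean_det _ _ _

theorem expectedCost_bind (p : Comp α) (f : α → Comp β) :
    (p >>= f).expectedCost = p.expectedCost + expect p fun a => (f a).expectedCost := by
  simp_rw [expectedCost_eq_mean, mean_bind]
  simp only [Nat.cast_add, mean_add, mean_const]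
  rfl

theorem expectedCost_bind_le {p : Comp α} {f : α → Comp β} {m n : ℝ≥0∞}
    (hp : p.expectedCost ≤ m) (hf : ∀ a, (f a).expectedCost ≤ n) :
    (p >>= f).expectedCost ≤ m + n := by
  rw [expectedCost_bind]
  refine add_le_add hp ((expect_mono hf).trans ?_)
  rw [expect_const]

theorem prob_eq_expect (p : Comp α) (S : Set α) :
    p.prob S = expect p (S.indicator 1) := by
  refine (PMF.toOuterMeasure_apply (law p) _).trans (tsum_congr fun r => ?_)
  by_cases h : r.1 ∈ S <;> simp [Set.indicator, h]

/-- Every possible result of `p` lies in `S`. -/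
def Always (p : Comp α) (S : α → Prop) : Prop :=
  ∀ r : α × ℕ, (law p) r ≠ 0 → S r.1

theorem always_true (p : Comp α) : Always p fun _ => True := fun _ _ => trivial

theorem always_det {a : α} {n : ℕ} {S : α → Prop} (h : S a) : Always (det a n) S := by
  intro r hr
  have : r ∈ (PMF.pure (a, n)).support := hr
  rw [PMF.support_pure, Set.mem_singleton_iff] at this
  rw [this]
  exact h

theorem Always.bind {p : Comp α} {f : α → Comp β} {S : α → Prop} {T : β → Prop}
    (hp : Always p S) (hf : ∀ a, S a → Always (f a) T) : Always (p >>= f) T := by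
  intro r hr
  have h : r ∈ (PMF.bind (law p) fun r =>
    PMF.map (fun q => (q.1, r.2 + q.2)) (law (f r.1))).support := hr
  rw [PMF.mem_support_bind_iff] at h
  obtain ⟨u, hu, h⟩ := h
  rw [PMF.mem_support_map_iff] at h
  obtain ⟨v, hv, rfl⟩ := h
  exact hf u.1 (hp u hu) v hv

theorem Always.expect_mono {p : Comp α} {S : α → Prop} (hp : Always p S) {F G : α → ℝ≥0∞}
    (h : ∀ a, S a → F a ≤ G a) : expect p F ≤ expect p G := by
  refine ENNReal.tsum_le_tsum fun r => ?_
  by_cases hr : (law p) r = 0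
  · rw [hr, zero_mul, zero_mul]
  · exact mul_le_mul_right (h _ (hp r hr)) _

/-! ### Deterministic computations -/

/-- `p` has the result `a` and takes at most `N` steps. -/
def IsDet (p : Comp α) (a : α) (N : ℕ) : Prop := ∃ n ≤ N, p = det a n

theorem isDet_pure (a : α) : IsDet (pure a) a 0 := ⟨0, le_rfl, rfl⟩
theorem isDet_op (a : α) : IsDet (op a) a 1 := ⟨1, le_rfl, rfl⟩
theorem isDet_charge (n : ℕ) : IsDet (charge n) () n := ⟨n, le_rfl, rfl⟩

theorem IsDet.mono {p : Comp α} {a : α} {M N : ℕ} (h : IsDet p a M) (hMN : M ≤ N) :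
    IsDet p a N :=
  let ⟨n, hn, e⟩ := h
  ⟨n, hn.trans hMN, e⟩

theorem det_bind_det (a : α) (m : ℕ) (f : α → Comp β) {b : β} {n : ℕ} (h : f a = det b n) :
    (det a m >>= f) = det b (m + n) := by
  have : (det a m >>= f) = (PMF.bind (PMF.pure (a, m)) fun r =>
    PMF.map (fun q => (q.1, r.2 + q.2)) (law (f r.1)) : PMF _) := rfl
  rw [this, PMF.pure_bind]
  simp only [h]
  exact PMF.pure_map _ _

theorem IsDet.bind {p : Comp α} {f : α → Comp β} {a : α} {b : β} {M N : ℕ}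
    (hp : IsDet p a M) (hf : IsDet (f a) b N) : IsDet (p >>= f) b (M + N) := by
  obtain ⟨m, hm, rfl⟩ := hp
  obtain ⟨n, hn, e⟩ := hf
  exact ⟨m + n, add_le_add hm hn, det_bind_det _ _ _ e⟩

theorem IsDet.op_bind {f : α → Comp β} {a : α} {b : β} {N : ℕ} (hf : IsDet (f a) b N) :
    IsDet (op a >>= f) b (N + 1) := by
  rw [add_comm]
  exact (isDet_op a).bind hf

theorem IsDet.expect_eq {p : Comp α} {a : α} {N : ℕ} (h : IsDet p a N) (F : α → ℝ≥0∞) :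
    expect p F = F a := by
  obtain ⟨n, -, rfl⟩ := h
  simp

theorem IsDet.expectedCost_le {p : Comp α} {a : α} {N : ℕ} (h : IsDet p a N) :
    p.expectedCost ≤ N := by
  obtain ⟨n, hn, rfl⟩ := h
  simpa using hn

theorem IsDet.always {p : Comp α} {a : α} {N : ℕ} (h : IsDet p a N) {S : α → Prop} (hS : S a) :
    Always p S := by
  obtain ⟨n, -, rfl⟩ := h
  exact always_det hS

theorem IsDet.ite {c : Prop} [Decidable c] {p q : Comp α} {a b : α} {N : ℕ}
    (hp : c → IsDet p a N) (hq : ¬ c → IsDet q b N) :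
    IsDet (if c then p else q) (if c then a else b) N := by
  split_ifs with h
  · exact hp h
  · exact hq h

theorem isDet_forEach {ι σ : Type} (l : List ι) (s : σ) (body : σ → ι → Comp σ) (g : σ → ι → σ)
    (N : ι → ℕ) (h : ∀ s i, IsDet (body s i) (g s i) (N i)) :
    IsDet (forEach l s body) (l.foldl g s) (l.map fun i => N i + 1).sum := by
  induction l generalizing s with
  | nil => exact isDet_pure s
  | cons i l ih =>
    refine ((isDet_charge 1).bind ((h s i).bind (ih (g s i)))).mono ?_
    simp only [List.map_cons, List.sum_cons]
    omega

theorem isDet_forEach_const {ι σ : Type} (l : List ι) (s : σ) (body : σ → ι → Comp σ)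
    (g : σ → ι → σ) (N : ℕ) (h : ∀ s i, IsDet (body s i) (g s i) N) :
    IsDet (forEach l s body) (l.foldl g s) (l.length * (N + 1)) := by
  refine (isDet_forEach l s body g (fun _ => N) h).mono ?_
  simp

theorem isDet_tabulateFin (n : ℕ) (g : Fin n → Comp α) (a : Fin n → α) (N : ℕ)
    (h : ∀ i, IsDet (g i) (a i) N) : IsDet (tabulateFin n g) a (n * (N + 1)) := by
  induction n with
  | zero =>
    have : a = Fin.elim0 := Subsingleton.elim _ _
    rw [this]
    exact (isDet_pure _).mono (Nat.zero_le _)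
  | succ n ih =>
    refine IsDet.mono (M := N + (1 + (n * (N + 1) + 0))) ?_ (le_of_eq (by ring))
    refine (h 0).bind ((isDet_charge 1).bind ((ih (fun i => g i.succ) (fun i => a i.succ)
      fun i => h i.succ).bind ?_))
    have := isDet_pure (Fin.cons (a 0) fun i => a i.succ : Fin (n + 1) → α)
    rwa [show (Fin.cons (a 0) fun i => a i.succ : Fin (n + 1) → α) = a from
      Fin.cons_self_tail a] at this ⊢

theorem isDet_tabulate {ι : Type} [Fintype ι] (g : ι → Comp α) (a : ι → α) (N : ℕ)
    (h : ∀ i, IsDet (g i) (a i) N) : IsDet (tabulate g) a (Fintype.card ι * (N + 1)) := by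
  refine IsDet.bind (N := 0) (isDet_tabulateFin _ (fun i => g ((Fintype.equivFin ι).symm i)) _ N
    fun i => h _) ?_
  simpa only [Equiv.symm_apply_apply] using
    isDet_pure fun i => a ((Fintype.equivFin ι).symm (Fintype.equivFin ι i))

theorem isDet_tabulate₂ {ι κ : Type} [Fintype ι] [Fintype κ] (g : ι → κ → Comp α)
    (a : Matrix ι κ α) (N : ℕ) (h : ∀ i j, IsDet (g i j) (a i j) N) :
    IsDet (tabulate₂ g) a (Fintype.card ι * Fintype.card κ * (N + 1)) := by
  rw [← Fintype.card_prod]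
  exact IsDet.bind (N := 0) (isDet_tabulate (fun p : ι × κ => g p.1 p.2) (fun p => a p.1 p.2) N
    fun p => h _ _) (isDet_pure (fun i j => a i j : Matrix ι κ α))

/-! ### Loops -/

/-- Φ is a potential that contracts in every pass, whatever the current state. With Φ the indicator
of an empty entry, this multiplies the failure probabilities of repeated trials. -/
theorem expect_forEach_le {ι σ : Type} (l : List ι) (s : σ) (body : σ → ι → Comp σ)
    (Φ : σ → ℝ≥0∞) (q : ℝ≥0∞) (h : ∀ s, ∀ i ∈ l, expect (body s i) Φ ≤ q * Φ s) :
    expect (forEach l s body) Φ ≤ q ^ l.length * Φ s := by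
  induction l generalizing s with
  | nil =>
    rw [forEach, pure_eq_det, expect_det]
    simp
  | cons i l ih =>
    simp only [forEach, charge_eq_det, expect_bind, expect_det]
    calc expect (body s i) (fun a => expect (forEach l a body) Φ)
        ≤ expect (body s i) (fun a => q ^ l.length * Φ a) :=
          expect_mono fun a => ih a fun s j hj => h s j (List.mem_cons_of_mem _ hj)
      _ = q ^ l.length * expect (body s i) Φ := expect_const_mul _ _ _
      _ ≤ q ^ l.length * (q * Φ s) := by gcongr; exact h s i List.mem_cons_self
      _ = _ := by rw [List.length_cons, pow_succ, mul_assoc]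

/-- A single good pass suffices if the others do not increase Φ. The passes will be the levels:
which one is good depends on the number of witnesses of the entry, and the algorithm need not know
it. -/
theorem expect_forEach_le_of_mem {ι σ : Type} (l : List ι) (s : σ) (body : σ → ι → Comp σ)
    (Φ : σ → ℝ≥0∞) (q : ℝ≥0∞) (i₀ : ι) (hi₀ : i₀ ∈ l)
    (h : ∀ s i, expect (body s i) Φ ≤ Φ s) (h₀ : ∀ s, expect (body s i₀) Φ ≤ q * Φ s) :
    expect (forEach l s body) Φ ≤ q * Φ s := by
  induction l generalizing s with
  | nil => simp at hi₀
  | cons i l ih =>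
    simp only [forEach, charge_eq_det, expect_bind, expect_det]
    rcases List.mem_cons.1 hi₀ with rfl | hm
    · refine (expect_mono fun a => ?_).trans (h₀ s)
      simpa using expect_forEach_le l a body Φ 1 fun s i _ => by simpa using h s i
    · refine (expect_mono fun a => ih a hm).trans ?_
      rw [expect_const_mul]
      gcongr
      exact h s i

theorem always_forEach {ι σ : Type} (l : List ι) (s : σ) (body : σ → ι → Comp σ)
    (S : σ → Prop) (hs : S s) (h : ∀ s i, S s → Always (body s i) S) :
    Always (forEach l s body) S := by
  induction l generalizing s with
  | nil => exact always_det hs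
  | cons i l ih =>
    exact (always_true _).bind fun _ _ => (h s i hs).bind fun s' hs' => ih s' hs'

theorem expectedCost_forEach_le {ι σ : Type} (l : List ι) (s : σ) (body : σ → ι → Comp σ)
    (N : ι → ℝ≥0∞) (h : ∀ s i, (body s i).expectedCost ≤ N i) :
    (forEach l s body).expectedCost ≤ (l.map fun i => N i + 1).sum := by
  induction l generalizing s with
  | nil =>
    rw [forEach, pure_eq_det, expectedCost_det]
    simp
  | cons i l ih =>
    refine (expectedCost_bind_le (isDet_charge 1).expectedCost_le fun _ =>
      expectedCost_bind_le (h s i) fun s' => ih s').trans ?_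
    simp only [List.map_cons, List.sum_cons, Nat.cast_one]
    apply le_of_eq
    ring

/-! ### Arrays of independent uniform draws -/

theorem expect_draw (d : ℕ) [NeZero d] (F : Fin d → ℝ≥0∞) :
    expect (draw d) F = (d : ℝ≥0∞)⁻¹ * ∑ a, F a := by
  refine (tsum_pmf_map (PMF.uniformOfFintype (Fin d)) (fun a => (a, 1)) fun r => F r.1).trans ?_
  rw [tsum_fintype, Finset.mul_sum]
  simp

theorem expectedCost_draw (d : ℕ) [NeZero d] : (draw d).expectedCost = 1 := by
  refine (tsum_pmf_map (PMF.uniformOfFintype (Fin d)) (fun a => (a, 1))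
    fun r : Fin d × ℕ => (r.2 : ℝ≥0∞)).trans ?_
  simp only [Nat.cast_one, mul_one]
  exact PMF.tsum_coe _

theorem expect_tabulateFin_draw (n d : ℕ) [NeZero d] (F : (Fin n → Fin d) → ℝ≥0∞) :
    expect (tabulateFin n fun _ => draw d) F = ((d : ℝ≥0∞)⁻¹) ^ n * ∑ f, F f := by
  induction n with
  | zero =>
    rw [tabulateFin, pure_eq_det, expect_det, Fintype.sum_subsingleton _ Fin.elim0]
    simp
  | succ n ih =>
    simp only [tabulateFin, charge_eq_det, pure_eq_det, expect_bind, expect_det, ih, expect_draw]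
    rw [← (Fin.consEquiv fun _ : Fin (n + 1) => Fin d).sum_comp, Fintype.sum_prod_type,
      ← Finset.mul_sum, ← mul_assoc, pow_succ']
    rfl

theorem expect_tabulate_draw {ι : Type} [Fintype ι] [DecidableEq ι] (d : ℕ) [NeZero d]
    (F : (ι → Fin d) → ℝ≥0∞) :
    expect (tabulate fun _ : ι => draw d) F
      = ((d : ℝ≥0∞)⁻¹) ^ Fintype.card ι * ∑ f, F f := by
  simp only [tabulate, pure_eq_det, expect_bind, expect_det, expect_tabulateFin_draw]
  refine congrArg _ ?_
  exact ((Fintype.equivFin ι).symm.arrowCongr (Equiv.refl (Fin d))).sum_comp F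

theorem expectedCost_tabulateFin (n : ℕ) (g : Fin n → Comp α) (N : ℝ≥0∞)
    (h : ∀ i, (g i).expectedCost ≤ N) : (tabulateFin n g).expectedCost ≤ n * (N + 1) := by
  induction n with
  | zero =>
    rw [tabulateFin, pure_eq_det, expectedCost_det]
    simp
  | succ n ih =>
    refine (expectedCost_bind_le (h 0) fun _ => expectedCost_bind_le
      (isDet_charge 1).expectedCost_le fun _ => expectedCost_bind_le (ih _ fun i => h i.succ)
      fun _ => (isDet_pure _).expectedCost_le).trans (le_of_eq ?_)
    push_cast
    ring

theorem expectedCost_tabulate {ι : Type} [Fintype ι] (g : ι → Comp α) (N : ℝ≥0∞)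
    (h : ∀ i, (g i).expectedCost ≤ N) :
    (tabulate g).expectedCost ≤ Fintype.card ι * (N + 1) := by
  refine (expectedCost_bind_le (expectedCost_tabulateFin _ _ N fun i => h _) fun _ =>
    (isDet_pure _).expectedCost_le).trans (le_of_eq ?_)
  simp

theorem expectedCost_tabulate₂ {ι κ : Type} [Fintype ι] [Fintype κ] (g : ι → κ → Comp α)
    (N : ℝ≥0∞) (h : ∀ i j, (g i j).expectedCost ≤ N) :
    (tabulate₂ g).expectedCost ≤ Fintype.card ι * Fintype.card κ * (N + 1) := by
  refine (expectedCost_bind_le (expectedCost_tabulate _ N fun p => h _ _) fun _ =>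
    (isDet_pure _).expectedCost_le).trans (le_of_eq ?_)
  simp

theorem expect_tabulate₂_draw {ι κ : Type} [Fintype ι] [Fintype κ] [DecidableEq ι]
    [DecidableEq κ] (d : ℕ) [NeZero d] (F : Matrix ι κ (Fin d) → ℝ≥0∞) :
    expect (tabulate₂ fun (_ : ι) (_ : κ) => draw d) F
      = ((d : ℝ≥0∞)⁻¹) ^ (Fintype.card ι * Fintype.card κ) * ∑ D : ι → κ → Fin d, F D := by
  simp only [tabulate₂, expect_bind, expect_tabulate_draw, Fintype.card_prod]
  refine congrArg _ (Eq.trans ?_ ((Equiv.curry ι κ (Fin d)).sum_comp fun D => F D))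
  exact Finset.sum_congr rfl fun D _ => expect_det _ _ _

/-- The arithmetic mean of a function on a finite type. -/
def avg {ι : Type} [Fintype ι] (F : ι → ℝ) : ℝ := (∑ i, F i) / Fintype.card ι

/-- Passage from `ℝ≥0∞` to real averages, where subtraction and the exponential are available. -/
theorem expect_tabulate_draw_ofReal {ι : Type} [Fintype ι] [DecidableEq ι] (d : ℕ) [NeZero d]
    (F : (ι → Fin d) → ℝ) (hF : ∀ f, 0 ≤ F f) :
    expect (tabulate fun _ : ι => draw d) (fun f => ENNReal.ofReal (F f))
      = ENNReal.ofReal (avg F) := by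
  have hd : (0 : ℝ) < d := Nat.cast_pos.2 (NeZero.pos d)
  rw [expect_tabulate_draw, avg, ENNReal.ofReal_div_of_pos (by positivity),
    ENNReal.ofReal_sum_of_nonneg fun f _ => hF f, mul_comm, ENNReal.div_eq_inv_mul, mul_comm]
  congr 1
  rw [← ENNReal.inv_pow]
  simp

theorem expect_tabulate₂_draw_ofReal {ι κ : Type} [Fintype ι] [Fintype κ] [DecidableEq ι]
    [DecidableEq κ] (d : ℕ) [NeZero d] (F : (ι → κ → Fin d) → ℝ) (hF : ∀ f, 0 ≤ F f) :
    expect (tabulate₂ fun (_ : ι) (_ : κ) => draw d) (fun f => ENNReal.ofReal (F f))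
      = ENNReal.ofReal (avg F) := by
  have hd : (0 : ℝ) < d := Nat.cast_pos.2 (NeZero.pos d)
  rw [expect_tabulate₂_draw, avg, ENNReal.ofReal_div_of_pos (by positivity),
    ENNReal.ofReal_sum_of_nonneg fun f _ => hF f, mul_comm, ENNReal.div_eq_inv_mul, mul_comm]
  congr 1
  rw [← ENNReal.inv_pow]
  simp [← pow_mul, mul_comm]

end Calculus

end

end Comp

namespace BoolMM

noncomputable section

open Comp

/-! # The pseudo-product -/

section PseudoProduct

variable {s b : ℕ}

/-- At each bit, at least one of the three indices is `1`. -/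
def Covers (x y z : Idx s b) : Prop := ∀ i, (x.1 i || y.1 i || z.1 i) = true

instance (x y z : Idx s b) : Decidable (Covers x y z) := by unfold Covers; infer_instance

/-- The pseudo-product of two matrices. -/
def pseudoProd {R : Type} [CommRing R] (X Y : SqMat s b R) : SqMat s b R :=
  fun x y => ∑ z, if Covers x y z then X x z * Y z y else 0

theorem card_idx : Fintype.card (Idx s b) = 2 ^ s * b := by simp [Idx]

theorem covers_push (c c' c'' : Bool) (x y z : Idx s b) :
    Covers (x.push c) (y.push c') (z.push c'') ↔ (c || c' || c'') = true ∧ Covers x y z := by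
  simp only [Covers, Idx.push]
  rw [Fin.forall_fin_succ]
  simp only [Fin.cons_zero, Fin.cons_succ]

theorem Idx.push_rest (x : Idx (s + 1) b) : x.rest.push (x.1 0) = x := by
  simp [Idx.push, Idx.rest]

/-- An index consists of its leading bit and the remaining part. -/
def idxEquiv (s b : ℕ) : Bool × Idx s b ≃ Idx (s + 1) b where
  toFun p := p.2.push p.1
  invFun x := (x.1 0, x.rest)
  left_inv p := by simp [Idx.push, Idx.rest]
  right_inv x := x.push_rest

theorem sum_idx_succ {M : Type} [AddCommMonoid M] (F : Idx (s + 1) b → M) :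
    ∑ z, F z = ∑ z : Idx s b, F (z.push true) + ∑ z : Idx s b, F (z.push false) := by
  rw [← (idxEquiv s b).sum_comp, Fintype.sum_prod_type, Fintype.sum_bool]
  rfl

/-- A block of a matrix. -/
def blockMat {R : Type} (X : SqMat (s + 1) b R) (p q : Bool) : SqMat s b R :=
  fun x y => X (x.push p) (y.push q)

theorem isDet_block {R : Type} (X : SqMat (s + 1) b R) (p q : Bool) :
    IsDet (block X p q) (blockMat X p q) ((2 ^ s * b) ^ 2 * 2) := by
  have := isDet_tabulate₂ (fun x y => op (X (x.push p) (y.push q))) (blockMat X p q) 1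
    fun x y => isDet_op _
  rwa [card_idx, ← sq] at this

variable {R : Type} [CommRing R]

theorem isDet_addMat (X Y : SqMat s b R) :
    IsDet (addMat X Y) (X + Y) ((2 ^ s * b) ^ 2 * 4) := by
  have := isDet_tabulate₂ (fun x y => do
    let u ← op (X x y)
    let v ← op (Y x y)
    op (u + v)) (X + Y) 3 fun x y => by
      refine IsDet.op_bind ?_
      refine IsDet.op_bind ?_
      exact isDet_op _
  rwa [card_idx, ← sq] at this

theorem isDet_subMat (X Y : SqMat s b R) :
    IsDet (subMat X Y) (X - Y) ((2 ^ s * b) ^ 2 * 4) := by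
  have := isDet_tabulate₂ (fun x y => do
    let u ← op (X x y)
    let v ← op (Y x y)
    op (u - v)) (X - Y) 3 fun x y => by
      refine IsDet.op_bind ?_
      refine IsDet.op_bind ?_
      exact isDet_op _
  rwa [card_idx, ← sq] at this

theorem isDet_assemble {R : Type} (X₁₁ X₁₂ X₂₁ X₂₂ : SqMat s b R) (Z : SqMat (s + 1) b R)
    (h₁₁ : X₁₁ = blockMat Z false false) (h₁₂ : X₁₂ = blockMat Z false true)
    (h₂₁ : X₂₁ = blockMat Z true false) (h₂₂ : X₂₂ = blockMat Z true true) :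
    IsDet (assemble X₁₁ X₁₂ X₂₁ X₂₂) Z ((2 ^ s * b) ^ 2 * 16) := by
  have e : (2 ^ s * b) ^ 2 * 16
      = Fintype.card (Idx (s + 1) b) * Fintype.card (Idx (s + 1) b) * (3 + 1) := by
    rw [card_idx]
    ring
  rw [e]
  refine isDet_tabulate₂ _ Z 3 fun x y => ?_
  refine IsDet.op_bind ?_
  refine IsDet.op_bind ?_
  have hx := x.push_rest
  have hy := y.push_rest
  subst h₁₁ h₁₂ h₂₁ h₂₂
  cases h : x.1 0 <;> cases h' : y.1 0 <;> rw [h] at hx <;> rw [h'] at hy <;>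
    simpa only [blockMat, hx, hy] using isDet_op (Z x y)

theorem foldl_add_eq_sum {ι : Type} (l : List ι) (F : ι → R) (a : R) :
    l.foldl (fun acc z => acc + F z) a = a + (l.map F).sum := by
  induction l generalizing a with
  | nil => simp
  | cons i l ih => rw [List.foldl_cons, ih, List.map_cons, List.sum_cons, add_assoc]

theorem isDet_naiveMul (X Y : SqMat 0 b R) :
    IsDet (naiveMul X Y) (pseudoProd X Y) (b * b * (b * 5 + 1)) := by
  have hc : Fintype.card (Idx 0 b) = b := by simp [Idx]
  have := isDet_tabulate₂ (fun x y =>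
    forEach (Finset.univ : Finset (Idx 0 b)).toList 0 fun acc z => do
      let u ← op (X x z)
      let v ← op (Y z y)
      let w ← op (u * v)
      op (acc + w)) (pseudoProd X Y) (b * 5) fun x y => by
    have := isDet_forEach_const (Finset.univ : Finset (Idx 0 b)).toList (0 : R) (fun acc z => do
      let u ← op (X x z)
      let v ← op (Y z y)
      let w ← op (u * v)
      op (acc + w)) (fun acc z => acc + X x z * Y z y) 4 fun acc z => by
        refine IsDet.op_bind ?_
        refine IsDet.op_bind ?_
        refine IsDet.op_bind ?_
        exact isDet_op _
    rw [foldl_add_eq_sum, zero_add, Finset.sum_map_toList, Finset.length_toList,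
      Finset.card_univ, hc] at this
    have e : pseudoProd X Y x y = ∑ z, X x z * Y z y :=
      Finset.sum_congr rfl fun z _ => if_pos fun i => i.elim0
    rwa [e]
  rwa [hc] at this

/-- A bound for the number of steps of the pseudo-product. -/
def pseudoCost (b : ℕ) : ℕ → ℕ
  | 0 => b * b * (b * 5 + 1)
  | s + 1 => 6 * pseudoCost b s + 88 * (2 ^ s * b) ^ 2

/-- The added term makes the recursion purely multiplicative: 88 + 44 · 4 = 6 · 44. It is also the
slack that later pays for the random draws and the passes over the matrices. -/
theorem pseudoCost_le (b s : ℕ) : pseudoCost b s + 44 * (2 ^ s * b) ^ 2 ≤ 6 ^ s * (50 * b ^ 3) := by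
  induction s with
  | zero =>
    have : b * b * 1 ≤ b * b * b := by
      rcases Nat.eq_zero_or_pos b with rfl | hb
      · simp
      · exact Nat.mul_le_mul_left _ hb
    simp only [pseudoCost]
    nlinarith
  | succ s ih =>
    simp only [pseudoCost]
    calc _ = 6 * (pseudoCost b s + 44 * (2 ^ s * b) ^ 2) := by ring
      _ ≤ 6 * (6 ^ s * (50 * b ^ 3)) := by gcongr
      _ = _ := by ring

theorem isDet_pseudoMul (s : ℕ) (X Y : SqMat s b R) :
    IsDet (pseudoMul s X Y) (pseudoProd X Y) (pseudoCost b s) := by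
  induction s with
  | zero => exact isDet_naiveMul X Y
  | succ s ih =>
    set N := (2 ^ s * b) ^ 2 with hN
    -- The summands follow the order of the operations: 8 copies of blocks, 14 additions and the
    -- final assembly give 8 · 2 + 14 · 4 + 16 = 88.
    have e : pseudoCost b (s + 1) = N * 2 + (N * 2 + (N * 2 + (N * 2 + (N * 2 + (N * 2 +
      (N * 2 + (N * 2 + (N * 4 + (N * 4 + (N * 4 + (N * 4 + (N * 4 + (N * 4 + (N * 4 + (N * 4 +
      (pseudoCost b s + (pseudoCost b s + (pseudoCost b s + (pseudoCost b s + (pseudoCost b s +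
      (pseudoCost b s + (N * 4 + (N * 4 + (N * 4 + (N * 4 + (N * 4 + (N * 4 +
      N * 16))))))))))))))))))))))))))) := by
      simp only [pseudoCost]
      ring
    rw [e]
    unfold pseudoMul
    refine (isDet_block X _ _).bind ((isDet_block X _ _).bind ((isDet_block X _ _).bind
      ((isDet_block X _ _).bind ((isDet_block Y _ _).bind ((isDet_block Y _ _).bind
      ((isDet_block Y _ _).bind ((isDet_block Y _ _).bind ?_)))))))
    refine (isDet_addMat _ _).bind ((isDet_subMat _ _).bind ((isDet_subMat _ _).bind
      ((isDet_subMat _ _).bind ((isDet_subMat _ _).bind ((isDet_subMat _ _).bind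
      ((isDet_subMat _ _).bind ((isDet_subMat _ _).bind ?_)))))))
    refine (ih _ _).bind ((ih _ _).bind ((ih _ _).bind ((ih _ _).bind ((ih _ _).bind
      ((ih _ _).bind ?_)))))
    refine (isDet_addMat _ _).bind ((isDet_addMat _ _).bind ((isDet_addMat _ _).bind
      ((isDet_addMat _ _).bind ((isDet_subMat _ _).bind ((isDet_addMat _ _).bind ?_)))))
    -- Splitting the sum over z by its leading bit reduces each block to a ring identity for a
    -- single z. In the first block only the leading bit 1 can cover, so the block is `P₁` itself.
    refine isDet_assemble _ _ _ _ _ ?_ ?_ ?_ ?_ <;> ext x y <;>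
    · simp only [pseudoProd, blockMat, sum_idx_succ, covers_push, Matrix.add_apply,
        Matrix.sub_apply, Bool.or_true, Bool.or_false, true_and, Bool.false_eq_true,
        false_and, if_false, Finset.sum_const_zero, add_zero, ← Finset.sum_add_distrib,
        ← Finset.sum_sub_distrib]
      try refine Finset.sum_congr rfl fun z _ => ?_
      try split_ifs <;> ring

end PseudoProduct

end

end BoolMM

namespace BoolMM

noncomputable section

open Comp

/-! # Random subsets and Janson's inequality -/

section Biased

variable {V : Type}

/-- All the values of `p` are probabilities. -/
def IsProb (p : V → ℝ) : Prop := ∀ v, 0 ≤ p v ∧ p v ≤ 1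

theorem IsProb.prod_nonneg {p : V → ℝ} (hp : IsProb p) (t : Finset V) : 0 ≤ ∏ v ∈ t, p v :=
  Finset.prod_nonneg fun v _ => (hp v).1

open Classical in
/-- The indicator of the event that all the coordinates in `t` are on. -/
def allOn (t : Finset V) (ω : V → Bool) : ℝ := if ∀ v ∈ t, ω v = true then 1 else 0

theorem allOn_mono (t : Finset V) : Monotone (allOn t) := by
  intro ω ω' h
  unfold allOn
  split_ifs with h1 h2 h2
  · exact le_rfl
  · exact absurd (fun v hv => by
      have := h v
      rw [h1 v hv] at this
      exact top_le_iff.1 this) h2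
  · exact zero_le_one
  · exact le_rfl

theorem allOn_nonneg (t : Finset V) (ω : V → Bool) : 0 ≤ allOn t ω := by
  unfold allOn
  split_ifs <;> norm_num

theorem allOn_le_one (t : Finset V) (ω : V → Bool) : allOn t ω ≤ 1 := by
  unfold allOn
  split_ifs <;> norm_num

variable {τ : Type}

/-- The indicator of the event that none of the sets `e t`, `t ∈ S`, is contained in the
random set. -/
def noneOn (e : τ → Finset V) (S : Finset τ) (ω : V → Bool) : ℝ := ∏ t ∈ S, (1 - allOn (e t) ω)

theorem noneOn_nonneg (e : τ → Finset V) (S : Finset τ) (ω : V → Bool) : 0 ≤ noneOn e S ω :=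
  Finset.prod_nonneg fun _ _ => sub_nonneg.2 (allOn_le_one _ _)

theorem noneOn_anti (e : τ → Finset V) (S : Finset τ) : Antitone (noneOn e S) := fun _ _ h =>
  Finset.prod_le_prod (fun _ _ => sub_nonneg.2 (allOn_le_one _ _))
    fun _ _ => sub_le_sub_left (allOn_mono _ h) _

/-- The probability of `ω` when the values `ω v = true` occur independently with
probabilities `p v`. -/
def wt [Fintype V] (p : V → ℝ) (ω : V → Bool) : ℝ := ∏ v, if ω v then p v else 1 - p v

theorem wt_nonneg [Fintype V] {p : V → ℝ} (hp : IsProb p) (ω : V → Bool) : 0 ≤ wt p ω := by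
  refine Finset.prod_nonneg fun v _ => ?_
  have := hp v
  split_ifs <;> linarith

variable [DecidableEq V]

/-- Turn on all the coordinates in `t`. -/
def turnOn (t : Finset V) (ω : V → Bool) : V → Bool := fun v => ω v || decide (v ∈ t)

theorem turnOn_mono (t : Finset V) : Monotone (turnOn t) := by
  intro ω ω' h v
  have := h v
  unfold turnOn
  revert this
  cases ω v <;> cases ω' v <;> simp

theorem allOn_turnOn_of_disjoint {t u : Finset V} (h : Disjoint t u) (ω : V → Bool) :
    allOn u (turnOn t ω) = allOn u ω := by
  unfold allOn
  have : (∀ v ∈ u, turnOn t ω v = true) ↔ ∀ v ∈ u, ω v = true :=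
    forall₂_congr fun v hv => by
      simp [turnOn, Finset.disjoint_right.1 h hv]
  simp only [this]

theorem allOn_mul_allOn (t u : Finset V) (ω : V → Bool) :
    allOn t ω * allOn u ω = allOn (t ∪ u) ω := by
  unfold allOn
  simp only [Finset.forall_mem_union]
  by_cases h1 : ∀ v ∈ t, ω v = true
  · by_cases h2 : ∀ v ∈ u, ω v = true
    · rw [if_pos h1, if_pos h2, if_pos ⟨h1, h2⟩, one_mul]
    · rw [if_pos h1, if_neg h2, if_neg fun h => h2 h.2, one_mul]
  · rw [if_neg h1, if_neg (not_and_of_not_left _ h1), zero_mul]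

theorem one_sub_sum_le_prod {ι : Type} (s : Finset ι) (a : ι → ℝ) (h0 : ∀ i, 0 ≤ a i)
    (h1 : ∀ i, a i ≤ 1) : 1 - ∑ i ∈ s, a i ≤ ∏ i ∈ s, (1 - a i) := by
  classical
  induction s using Finset.induction_on with
  | empty => simp
  | insert i s hi ih =>
    rw [Finset.sum_insert hi, Finset.prod_insert hi]
    have hs : 0 ≤ ∑ i ∈ s, a i := Finset.sum_nonneg fun i _ => h0 i
    nlinarith [h0 i, h1 i, mul_nonneg (h0 i) hs, mul_le_mul_of_nonneg_left ih (sub_nonneg.2 (h1 i))]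

/-- The contribution of a pair of distinct intersecting sets. -/
def overlap [DecidableEq τ] (p : V → ℝ) (e : τ → Finset V) (t u : τ) : ℝ :=
  if t ≠ u ∧ ¬ Disjoint (e t) (e u) then ∏ v ∈ e t ∪ e u, p v else 0

theorem overlap_nonneg [DecidableEq τ] {p : V → ℝ} (hp : IsProb p) (e : τ → Finset V) (t u : τ) :
    0 ≤ overlap p e t u := by
  unfold overlap
  split_ifs
  · exact hp.prod_nonneg _
  · exact le_rfl

variable [Fintype V]

theorem sum_prod_bool (h : V → Bool → ℝ) :
    ∑ ω : V → Bool, ∏ v, h v (ω v) = ∏ v, (h v true + h v false) := by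
  simp_rw [← Fintype.sum_bool]
  rw [Finset.prod_univ_sum, Fintype.piFinset_univ]

/-- The expectation with respect to `wt p`. -/
def bE (p : V → ℝ) (F : (V → Bool) → ℝ) : ℝ := ∑ ω, wt p ω * F ω

theorem bE_prod_univ (p : V → ℝ) (g : V → Bool → ℝ) :
    bE p (fun ω => ∏ v, g v (ω v)) = ∏ v, (p v * g v true + (1 - p v) * g v false) := by
  unfold bE wt
  simp_rw [← Finset.prod_mul_distrib]
  rw [sum_prod_bool fun v c => (if c then p v else 1 - p v) * g v c]
  simp

theorem bE_const (p : V → ℝ) (c : ℝ) : bE p (fun _ => c) = c := by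
  have := bE_prod_univ p fun _ _ => 1
  simp only [Finset.prod_const_one, mul_one, add_sub_cancel] at this
  unfold bE at this ⊢
  rw [← Finset.sum_mul]
  simp only [mul_one] at this
  rw [this, one_mul]

theorem bE_mono {p : V → ℝ} (hp : IsProb p) {F G : (V → Bool) → ℝ} (h : ∀ ω, F ω ≤ G ω) :
    bE p F ≤ bE p G :=
  Finset.sum_le_sum fun ω _ => mul_le_mul_of_nonneg_left (h ω) (wt_nonneg hp ω)

theorem bE_nonneg {p : V → ℝ} (hp : IsProb p) {F : (V → Bool) → ℝ} (h : ∀ ω, 0 ≤ F ω) :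
    0 ≤ bE p F :=
  Finset.sum_nonneg fun ω _ => mul_nonneg (wt_nonneg hp ω) (h ω)

theorem bE_add (p : V → ℝ) (F G : (V → Bool) → ℝ) :
    bE p (fun ω => F ω + G ω) = bE p F + bE p G := by
  simp only [bE, mul_add, Finset.sum_add_distrib]

theorem bE_sub (p : V → ℝ) (F G : (V → Bool) → ℝ) :
    bE p (fun ω => F ω - G ω) = bE p F - bE p G := by
  simp only [bE, mul_sub, Finset.sum_sub_distrib]

theorem bE_const_mul (p : V → ℝ) (c : ℝ) (F : (V → Bool) → ℝ) :
    bE p (fun ω => c * F ω) = c * bE p F := by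
  simp only [bE, Finset.mul_sum]
  exact Finset.sum_congr rfl fun ω _ => by ring

theorem bE_mul_const (p : V → ℝ) (c : ℝ) (F : (V → Bool) → ℝ) :
    bE p (fun ω => F ω * c) = bE p F * c := by
  simp_rw [mul_comm _ c]
  exact bE_const_mul p c F

theorem bE_finset_sum {ι : Type} (p : V → ℝ) (s : Finset ι) (F : ι → (V → Bool) → ℝ) :
    bE p (fun ω => ∑ i ∈ s, F i ω) = ∑ i ∈ s, bE p (F i) := by
  simp only [bE, Finset.mul_sum]
  exact Finset.sum_comm

/-- Pairing ω with the point that differs from it only at v puts both values of this coordinate into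
one summand. Hence the sums are doubled in the proof. -/
theorem bE_single (p : V → ℝ) (v : V) (F : (V → Bool) → ℝ) :
    bE p (fun ω => (if ω v then 1 else 0) * F ω)
      = p v * bE p fun ω => F (Function.update ω v true) := by
  set flip : (V → Bool) → (V → Bool) := fun ω => Function.update ω v (!ω v) with hflip
  have hinv : Function.Involutive flip := fun ω => by
    simp [hflip]
  have hsum : ∀ G : (V → Bool) → ℝ, 2 * ∑ ω, G ω = ∑ ω, (G ω + G (flip ω)) := fun G => by
    rw [Finset.sum_add_distrib, two_mul, ← Equiv.sum_comp hinv.toPerm G]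
    rfl
  have hwt : ∀ ω, wt p ω = (if ω v then p v else 1 - p v) *
      ∏ u ∈ Finset.univ.erase v, if ω u then p u else 1 - p u := fun ω =>
    (Finset.mul_prod_erase _ _ (Finset.mem_univ v)).symm
  have hflipwt : ∀ ω, wt p (flip ω) = (if ω v then 1 - p v else p v) *
      ∏ u ∈ Finset.univ.erase v, if ω u then p u else 1 - p u := fun ω => by
    rw [hwt]
    congr 1
    · simp only [hflip, Function.update_self]
      cases ω v <;> simp
    · refine Finset.prod_congr rfl fun u hu => ?_
      simp only [hflip, Function.update_of_ne (Finset.ne_of_mem_erase hu)]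
  have key : (2 : ℝ) * bE p (fun ω => (if ω v then 1 else 0) * F ω)
      = 2 * (p v * bE p fun ω => F (Function.update ω v true)) := by
    unfold bE
    rw [hsum, mul_left_comm, hsum, Finset.mul_sum]
    refine Finset.sum_congr rfl fun ω _ => ?_
    rw [hflipwt, hwt]
    cases h : ω v
    · simp [hflip, h]
      ring
    · have : Function.update ω v true = ω := by rw [← h, Function.update_eq_self]
      simp [hflip, h, this]
      ring
  linarith

/-- By independence, conditioning on the coordinates in t being on amounts to turning them on. This
formulation replaces conditional probabilities in the proof of Janson's inequality. -/
theorem bE_allOn (p : V → ℝ) (t : Finset V) (F : (V → Bool) → ℝ) :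
    bE p (fun ω => allOn t ω * F ω) = (∏ v ∈ t, p v) * bE p fun ω => F (turnOn t ω) := by
  induction t using Finset.induction_on generalizing F with
  | empty =>
    have : ∀ ω : V → Bool, turnOn ∅ ω = ω := fun ω => funext fun v => by simp [turnOn]
    simp [allOn, this]
  | insert a t ha ih =>
    have h1 : ∀ ω : V → Bool, allOn (insert a t) ω * F ω
        = (if ω a then 1 else 0) * (allOn t ω * F ω) := fun ω => by
      simp only [allOn, Finset.forall_mem_insert]
      by_cases h : ω a = true <;> simp [h]
    have h2 : ∀ ω : V → Bool, allOn t (Function.update ω a true) = allOn t ω := fun ω => by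
      unfold allOn
      have : (∀ v ∈ t, Function.update ω a true v = true) ↔ ∀ v ∈ t, ω v = true :=
        forall₂_congr fun v hv => by
          rw [Function.update_of_ne (ne_of_mem_of_not_mem hv ha)]
      by_cases h : ∀ v ∈ t, ω v = true
      · rw [if_pos h, if_pos (this.2 h)]
      · rw [if_neg h, if_neg fun h' => h (this.1 h')]
    have h3 : ∀ ω : V → Bool,
        Function.update (turnOn t ω) a true = turnOn (insert a t) ω := fun ω => by
      funext v
      by_cases h : v = a
      · subst h
        simp [turnOn]
      · simp [turnOn, h]
    simp_rw [h1]
    rw [bE_single]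
    simp_rw [h2]
    rw [ih, Finset.prod_insert ha, mul_assoc]
    simp_rw [h3]

theorem bE_allOn_eq (p : V → ℝ) (t : Finset V) : bE p (allOn t) = ∏ v ∈ t, p v := by
  have := bE_allOn p t fun _ => 1
  rw [bE_const] at this
  simpa using this

/-- Harris's inequality. -/
theorem bE_mul_le {p : V → ℝ} (hp : IsProb p) {F G : (V → Bool) → ℝ} (hF : ∀ ω, 0 ≤ F ω)
    (hG : ∀ ω, 0 ≤ G ω) (hF' : Antitone F) (hG' : Antitone G) :
    bE p F * bE p G ≤ bE p fun ω => F ω * G ω := by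
  -- The FKG inequality is stated for monotone functions, hence the dual order. For a product
  -- measure the lattice condition is an equality.
  have := fkg (α := (V → Bool)ᵒᵈ) (β := ℝ) (μ := fun ω => wt p (OrderDual.ofDual ω))
    (f := fun ω => F (OrderDual.ofDual ω)) (g := fun ω => G (OrderDual.ofDual ω))
    (fun ω => wt_nonneg hp _) (fun ω => hF _) (fun ω => hG _) hF'.dual_left hG'.dual_left
    (fun a b => le_of_eq ?_)
  · have h1 : ∑ ω : (V → Bool)ᵒᵈ, wt p (OrderDual.ofDual ω) = 1 := by
      have := bE_const p 1
      unfold bE at this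
      simp only [mul_one] at this
      exact this
    rw [h1, one_mul] at this
    exact this
  · simp only [wt, ← Finset.prod_mul_distrib]
    refine Finset.prod_congr rfl fun v _ => ?_
    change (if OrderDual.ofDual a v then p v else 1 - p v) *
      (if OrderDual.ofDual b v then p v else 1 - p v)
      = (if (OrderDual.ofDual a v || OrderDual.ofDual b v) then p v else 1 - p v) *
        (if (OrderDual.ofDual a v && OrderDual.ofDual b v) then p v else 1 - p v)
    cases OrderDual.ofDual a v <;> cases OrderDual.ofDual b v <;> simp [mul_comm]

/-- The sets disjoint from `e t` are unaffected when `e t` is turned on. Harris's inequality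
decouples them from the intersecting ones, which are left to a union bound. -/
theorem bE_noneOn_insert_le [DecidableEq τ] {p : V → ℝ} (hp : IsProb p) (e : τ → Finset V) (S : Finset τ) (t : τ)
    (ht : t ∉ S) :
    bE p (noneOn e (insert t S))
      ≤ bE p (noneOn e S) * (1 - ∏ v ∈ e t, p v + ∑ u ∈ S, overlap p e t u) := by
  set S₁ := S.filter fun u => Disjoint (e t) (e u)
  set S₂ := S.filter fun u => ¬ Disjoint (e t) (e u)
  set P := ∏ v ∈ e t, p v
  have hP : 0 ≤ P := hp.prod_nonneg _
  have h1 : bE p (noneOn e (insert t S))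
      = bE p (noneOn e S) - P * bE p fun ω => noneOn e S (turnOn (e t) ω) := by
    rw [← bE_allOn, ← bE_sub]
    congr 1
    funext ω
    rw [noneOn, Finset.prod_insert ht]
    simp only [noneOn]
    ring
  have hsplit : ∀ ω, noneOn e S ω = noneOn e S₁ ω * noneOn e S₂ ω := fun ω =>
    (Finset.prod_filter_mul_prod_filter_not S (fun u => Disjoint (e t) (e u)) _).symm
  have hS₁ : ∀ ω, noneOn e S₁ (turnOn (e t) ω) = noneOn e S₁ ω := fun ω =>
    Finset.prod_congr rfl fun u hu => by
      rw [allOn_turnOn_of_disjoint (Finset.mem_filter.1 hu).2]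
  set Q := bE p fun ω => noneOn e S₂ (turnOn (e t) ω)
  have hQ0 : 0 ≤ Q := bE_nonneg hp fun ω => noneOn_nonneg _ _ _
  -- Both factors are antitone, the second because turning on is monotone, so Harris's inequality
  -- applies.
  have h2 : bE p (noneOn e S₁) * Q ≤ bE p fun ω => noneOn e S (turnOn (e t) ω) := by
    simp_rw [hsplit, hS₁]
    exact bE_mul_le hp (noneOn_nonneg _ _) (fun _ => noneOn_nonneg _ _ _) (noneOn_anti _ _)
      fun ω ω' h => noneOn_anti e S₂ (turnOn_mono _ h)
  have h3 : bE p (noneOn e S) ≤ bE p (noneOn e S₁) := bE_mono hp fun ω => by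
    rw [hsplit]
    exact mul_le_of_le_one_right (noneOn_nonneg _ _ _)
      (Finset.prod_le_one (fun t _ => sub_nonneg.2 (allOn_le_one _ _))
        fun t _ => sub_le_self _ (allOn_nonneg _ _))
  -- A union bound over the sets that meet `e t`. Multiplying by P turns the events back into unions
  -- of two of the sets being on.
  have h4 : P * (1 - Q) ≤ ∑ u ∈ S, overlap p e t u := by
    have : 1 - ∑ u ∈ S₂, bE p (fun ω => allOn (e u) (turnOn (e t) ω)) ≤ Q := by
      rw [← bE_finset_sum, ← bE_const p 1, ← bE_sub]
      refine bE_mono hp fun ω => ?_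
      exact one_sub_sum_le_prod _ _ (fun u => allOn_nonneg _ _) fun u => allOn_le_one _ _
    calc P * (1 - Q) ≤ P * ∑ u ∈ S₂, bE p (fun ω => allOn (e u) (turnOn (e t) ω)) :=
          mul_le_mul_of_nonneg_left (by linarith) hP
      _ = ∑ u ∈ S₂, ∏ v ∈ e t ∪ e u, p v := by
          rw [Finset.mul_sum]
          refine Finset.sum_congr rfl fun u _ => ?_
          rw [← bE_allOn, ← bE_allOn_eq]
          simp_rw [allOn_mul_allOn]
      _ = ∑ u ∈ S, overlap p e t u := by
          rw [Finset.sum_filter]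
          refine Finset.sum_congr rfl fun u hu => ?_
          simp only [overlap, (ne_of_mem_of_not_mem hu ht).symm, ne_eq, not_false_eq_true,
            true_and]
  have hN : 0 ≤ bE p (noneOn e S) := bE_nonneg hp (noneOn_nonneg _ _)
  have h5 : P * (bE p (noneOn e S) * Q) ≤ P * bE p fun ω => noneOn e S (turnOn (e t) ω) :=
    mul_le_mul_of_nonneg_left ((mul_le_mul_of_nonneg_right h3 hQ0).trans h2) hP
  rw [h1]
  nlinarith [mul_le_mul_of_nonneg_left h4 hN]

/-- Janson's inequality. -/
theorem janson [DecidableEq τ] {p : V → ℝ} (hp : IsProb p) (e : τ → Finset V) (S : Finset τ) :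
    bE p (noneOn e S)
      ≤ Real.exp (-∑ t ∈ S, ∏ v ∈ e t, p v + ∑ t ∈ S, ∑ u ∈ S, overlap p e t u) := by
  induction S using Finset.induction_on with
  | empty =>
    rw [Finset.sum_empty, Finset.sum_empty, neg_zero, add_zero, Real.exp_zero]
    exact (bE_const p 1).le
  | insert t S ht ih =>
    refine (bE_noneOn_insert_le hp e S t ht).trans ?_
    have hN : 0 ≤ bE p (noneOn e S) := bE_nonneg hp (noneOn_nonneg _ _)
    calc _ ≤ bE p (noneOn e S) * Real.exp (-∏ v ∈ e t, p v + ∑ u ∈ S, overlap p e t u) := by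
          refine mul_le_mul_of_nonneg_left ?_ hN
          have := Real.add_one_le_exp (-∏ v ∈ e t, p v + ∑ u ∈ S, overlap p e t u)
          linarith
      _ ≤ _ := mul_le_mul_of_nonneg_right ih (Real.exp_nonneg _)
      _ ≤ _ := by
          rw [← Real.exp_add]
          refine Real.exp_le_exp.2 ?_
          -- The induction meets each unordered pair once, whereas the right side has it in both
          -- orders. The surplus is dropped by nonnegativity.
          have h : ∑ u ∈ S, overlap p e t u + ∑ t ∈ S, ∑ u ∈ S, overlap p e t u
              ≤ ∑ t' ∈ insert t S, ∑ u ∈ insert t S, overlap p e t' u := by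
            rw [Finset.sum_insert ht]
            refine add_le_add ?_ (Finset.sum_le_sum fun u _ => ?_)
            all_goals
              exact Finset.sum_le_sum_of_subset_of_nonneg (Finset.subset_insert _ _)
                fun _ _ _ => overlap_nonneg hp _ _ _
          have h' := Finset.sum_insert ht (f := fun t => ∏ v ∈ e t, p v)
          rw [h']
          linear_combination h

end Biased

end

end BoolMM

namespace BoolMM

noncomputable section

open Comp

/-! # Counting covering triples -/

section Counting

variable {s b : ℕ}

/-- The indicator of `Covers`. -/
def cov (x y z : Idx s b) : ℝ := if Covers x y z then 1 else 0

theorem cov_push (c c' c'' : Bool) (x y z : Idx s b) :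
    cov (x.push c) (y.push c') (z.push c'') = (if c || c' || c'' then 1 else 0) * cov x y z := by
  unfold cov
  simp only [covers_push]
  by_cases h : (c || c' || c'') = true <;> simp [h]

theorem cov_zero (x y z : Idx 0 b) : cov x y z = 1 := if_pos fun i => i.elim0

theorem cov_nonneg (x y z : Idx s b) : 0 ≤ cov x y z := by
  unfold cov
  split_ifs <;> norm_num

/-- Each bit contributes the factor 7 independently, as only the pattern 0, 0, 0 is excluded; the
last components are free. -/
theorem sum_cov : ∑ x : Idx s b, ∑ y, ∑ z, cov x y z = 7 ^ s * (b : ℝ) ^ 3 := by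
  induction s with
  | zero =>
    simp [cov_zero]
    ring
  | succ s ih =>
    simp only [sum_idx_succ, cov_push, Bool.or_true, Bool.or_false,
      if_true, one_mul, Bool.false_eq_true, if_false, zero_mul, Finset.sum_const_zero,
      Finset.sum_add_distrib, ih, add_zero]
    ring

/-- Per bit: x = 1 leaves 4 · 4 choices for the two remaining pairs, x = 0 leaves 3 · 3, and 16 + 9
= 25. -/
theorem sum_cov_x : ∑ x : Idx s b, ∑ y, ∑ z, ∑ y', ∑ z', cov x y z * cov x y' z'
    = 25 ^ s * (b : ℝ) ^ 5 := by
  induction s with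
  | zero =>
    simp [cov_zero]
    ring
  | succ s ih =>
    simp only [sum_idx_succ, cov_push, Bool.or_true, Bool.or_false,
      if_true, one_mul, Bool.false_eq_true, if_false, zero_mul, mul_zero, Finset.sum_const_zero,
      Finset.sum_add_distrib, ih, add_zero]
    ring

theorem sum_cov_y : ∑ x : Idx s b, ∑ y, ∑ z, ∑ x', ∑ z', cov x y z * cov x' y z'
    = 25 ^ s * (b : ℝ) ^ 5 := by
  induction s with
  | zero =>
    simp [cov_zero]
    ring
  | succ s ih =>
    simp only [sum_idx_succ, cov_push, Bool.or_true, Bool.or_false,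
      if_true, one_mul, Bool.false_eq_true, if_false, zero_mul, mul_zero, Finset.sum_const_zero,
      Finset.sum_add_distrib, ih, add_zero]
    ring

theorem sum_cov_z : ∑ x : Idx s b, ∑ y, ∑ z, ∑ x', ∑ y', cov x y z * cov x' y' z
    = 25 ^ s * (b : ℝ) ^ 5 := by
  induction s with
  | zero =>
    simp [cov_zero]
    ring
  | succ s ih =>
    simp only [sum_idx_succ, cov_push, Bool.or_true, Bool.or_false,
      if_true, one_mul, Bool.false_eq_true, if_false, zero_mul, mul_zero, Finset.sum_const_zero,
      Finset.sum_add_distrib, ih, add_zero]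
    ring

/-- Per bit: the three patterns of x, y other than 0, 0 leave 2 · 2 choices of z, z', and the
pattern 0, 0 leaves one, so 3 · 4 + 1 = 13. -/
theorem sum_cov_xy : ∑ x : Idx s b, ∑ y, ∑ z, ∑ z', cov x y z * cov x y z'
    = 13 ^ s * (b : ℝ) ^ 4 := by
  induction s with
  | zero =>
    simp [cov_zero]
    ring
  | succ s ih =>
    simp only [sum_idx_succ, cov_push, Bool.or_true, Bool.or_false,
      if_true, one_mul, Bool.false_eq_true, if_false, zero_mul, mul_zero, Finset.sum_const_zero,
      Finset.sum_add_distrib, ih, add_zero]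
    ring

theorem sum_cov_xz : ∑ x : Idx s b, ∑ y, ∑ z, ∑ y', cov x y z * cov x y' z
    = 13 ^ s * (b : ℝ) ^ 4 := by
  induction s with
  | zero =>
    simp [cov_zero]
    ring
  | succ s ih =>
    simp only [sum_idx_succ, cov_push, Bool.or_true, Bool.or_false,
      if_true, one_mul, Bool.false_eq_true, if_false, zero_mul, mul_zero, Finset.sum_const_zero,
      Finset.sum_add_distrib, ih, add_zero]
    ring

theorem sum_cov_yz : ∑ x : Idx s b, ∑ y, ∑ z, ∑ x', cov x y z * cov x' y z
    = 13 ^ s * (b : ℝ) ^ 4 := by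
  induction s with
  | zero =>
    simp [cov_zero]
    ring
  | succ s ih =>
    simp only [sum_idx_succ, cov_push, Bool.or_true, Bool.or_false,
      if_true, one_mul, Bool.false_eq_true, if_false, zero_mul, mul_zero, Finset.sum_const_zero,
      Finset.sum_add_distrib, ih, add_zero]
    ring

end Counting

/-! # Random triples -/

section Pushforward

variable {V U β : Type} [Fintype V] [DecidableEq V] [Fintype U] [DecidableEq U] [Fintype β]

theorem avg_mono {ι : Type} [Fintype ι] {F G : ι → ℝ} (h : ∀ i, F i ≤ G i) : avg F ≤ avg G := by
  unfold avg
  gcongr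
  exact h _

theorem avg_nonneg {ι : Type} [Fintype ι] {F : ι → ℝ} (h : ∀ i, 0 ≤ F i) : 0 ≤ avg F :=
  div_nonneg (Finset.sum_nonneg fun i _ => h i) (Nat.cast_nonneg _)

theorem avg_comm {ι κ : Type} [Fintype ι] [Fintype κ] (F : ι → κ → ℝ) :
    avg (fun i => avg (F i)) = avg fun k => avg fun i => F i k := by
  unfold avg
  simp_rw [← Finset.sum_div]
  rw [Finset.sum_comm, div_right_comm]

theorem avg_prod (g : V → β → ℝ) : avg (fun f : V → β => ∏ v, g v (f v)) = ∏ v, avg (g v) := by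
  unfold avg
  rw [Finset.prod_div_distrib, Finset.prod_univ_sum, Fintype.piFinset_univ]
  simp

/-- The preimage of K under a uniformly random function is a random set in which the points appear
independently. The functions with a prescribed preimage form a product of copies of K and of its
complement. -/
theorem avg_mem [DecidableEq β] [Nonempty β] (K : Finset β) (G : (V → Bool) → ℝ) :
    avg (fun f : V → β => G fun v => decide (f v ∈ K))
      = bE (fun _ => (K.card : ℝ) / Fintype.card β) G := by
  unfold avg bE
  have hβ : (Fintype.card β : ℝ) ≠ 0 := Nat.cast_ne_zero.2 Fintype.card_ne_zero
  rw [← Finset.sum_fiberwise Finset.univ (fun (f : V → β) v => decide (f v ∈ K)), Finset.sum_div]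
  refine Finset.sum_congr rfl fun ω _ => ?_
  have h1 : ∑ f : V → β with (fun v => decide (f v ∈ K)) = ω, G (fun v => decide (f v ∈ K))
      = ∑ f : V → β with (fun v => decide (f v ∈ K)) = ω, G ω :=
    Finset.sum_congr rfl fun f hf => by rw [(Finset.mem_filter.1 hf).2]
  have h2 : (Finset.univ.filter fun f : V → β => (fun v => decide (f v ∈ K)) = ω)
      = Fintype.piFinset fun v => if ω v then K else Kᶜ := by
    ext f
    simp only [Finset.mem_filter, Finset.mem_univ, true_and, Fintype.mem_piFinset, funext_iff]
    refine forall_congr' fun v => ?_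
    cases ω v <;> simp
  rw [h1, Finset.sum_const, h2, Fintype.card_piFinset, nsmul_eq_mul, mul_div_right_comm]
  congr 1
  rw [wt, Fintype.card_fun]
  push_cast
  rw [← Finset.card_univ (α := V), ← Finset.prod_const, ← Finset.prod_div_distrib]
  refine Finset.prod_congr rfl fun v _ => ?_
  split_ifs
  · rfl
  · rw [Finset.card_compl, Nat.cast_sub (Finset.card_le_univ K), sub_div, div_self hβ]

theorem avg_avg_mem {γ : Type} [Fintype γ] [DecidableEq β] [DecidableEq γ] [Nonempty β]
    [Nonempty γ] (K : Finset β) (K' : Finset γ) (G : (V → Bool) → (U → Bool) → ℝ) :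
    avg (fun f : V → β => avg fun f' : U → γ =>
      G (fun v => decide (f v ∈ K)) fun v => decide (f' v ∈ K'))
      = bE (fun _ => (K.card : ℝ) / Fintype.card β) fun X =>
        bE (fun _ => (K'.card : ℝ) / Fintype.card γ) fun Y => G X Y := by
  rw [← avg_mem]
  exact congrArg avg (funext fun f => avg_mem K' (G _))

/-- Two independent random sets become one random set on the disjoint union. Applied twice, it
brings a triple of random sets into the form required by `janson`. -/
theorem bE_sum (p : V → ℝ) (q : U → ℝ) (G : (V → Bool) → (U → Bool) → ℝ) :
    bE p (fun ω => bE q (G ω))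
      = bE (Sum.elim p q) fun ω => G (fun v => ω (Sum.inl v)) fun u => ω (Sum.inr u) := by
  unfold bE
  rw [← (Equiv.sumArrowEquivProdArrow V U Bool).symm.sum_comp, Fintype.sum_prod_type]
  refine Finset.sum_congr rfl fun ω _ => ?_
  rw [Finset.mul_sum]
  refine Finset.sum_congr rfl fun ω' _ => ?_
  unfold wt
  rw [Fintype.prod_sum_type, ← mul_assoc]
  rfl

theorem bE_comm (p : V → ℝ) (q : U → ℝ) (G : (V → Bool) → (U → Bool) → ℝ) :
    bE p (fun ω => bE q (G ω)) = bE q fun ω' => bE p fun ω => G ω ω' := by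
  unfold bE
  simp_rw [Finset.mul_sum]
  rw [Finset.sum_comm]
  exact Finset.sum_congr rfl fun _ _ => Finset.sum_congr rfl fun _ _ => by ring

end Pushforward

/-! ### Covering triples in a product of three random sets -/

section Hits

variable {s b : ℕ}

/-- The indicator of the event that there is no covering triple in `X × Y × Z`. -/
def noHit (X Y Z : Idx s b → Bool) : ℝ := by
  classical
  exact if ∃ x y z, X x ∧ Y y ∧ Z z ∧ Covers x y z then 0 else 1

/-- The number of pairs of distinct covering triples in `X × Y × Z` that differ only in the third
element. -/
def twoHits (X Y Z : Idx s b → Bool) : ℝ :=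
  ∑ x, (if X x then 1 else 0) * ∑ y, (if Y y then 1 else 0) *
    ∑ z, ∑ z', cov x y z * cov x y z' * if z ≠ z' then allOn {z, z'} Z else 0

/-- The vertices of a triple. -/
def tripleSet (t : Idx s b × Idx s b × Idx s b) : Finset (Idx s b ⊕ Idx s b ⊕ Idx s b) :=
  {Sum.inl t.1, Sum.inr (Sum.inl t.2.1), Sum.inr (Sum.inr t.2.2)}

/-- The probabilities of the vertices. -/
def vertexProb (s b : ℕ) (p q r : ℝ) : Idx s b ⊕ Idx s b ⊕ Idx s b → ℝ :=
  Sum.elim (fun _ => p) (Sum.elim (fun _ => q) fun _ => r)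

theorem prod_tripleSet (p q r : ℝ) (t : Idx s b × Idx s b × Idx s b) :
    ∏ v ∈ tripleSet t, vertexProb s b p q r v = p * q * r := by
  simp [tripleSet, vertexProb, mul_assoc]

/-- Two triples sharing one vertex have five vertices in their union, those sharing two have four,
and equal triples do not count. Overlapping indicators are used instead of exact cases so that each
term can be summed separately by one of the counts 25^s or 13^s. -/
theorem overlap_tripleSet_le {p q r : ℝ} (hp : 0 ≤ p) (hq : 0 ≤ q) (hr : 0 ≤ r)
    (x y z x' y' z' : Idx s b) :
    overlap (vertexProb s b p q r) tripleSet (x, y, z) (x', y', z')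
      ≤ (if x' = x then p * q ^ 2 * r ^ 2 else 0) + (if y' = y then p ^ 2 * q * r ^ 2 else 0)
        + (if z' = z then p ^ 2 * q ^ 2 * r else 0)
        + (if x' = x ∧ y' = y then p * q * r ^ 2 else 0)
        + (if x' = x ∧ z' = z then p * q ^ 2 * r else 0)
        + (if y' = y ∧ z' = z then p ^ 2 * q * r else 0) := by
  have h1 : 0 ≤ p * q ^ 2 * r ^ 2 := by positivity
  have h2 : 0 ≤ p ^ 2 * q * r ^ 2 := by positivity
  have h3 : 0 ≤ p ^ 2 * q ^ 2 * r := by positivity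
  have h4 : 0 ≤ p * q * r ^ 2 := by positivity
  have h5 : 0 ≤ p * q ^ 2 * r := by positivity
  have h6 : 0 ≤ p ^ 2 * q * r := by positivity
  unfold overlap
  by_cases hx : x' = x <;> by_cases hy : y' = y <;> by_cases hz : z' = z <;> subst_vars
  · simp
    linarith
  · have : tripleSet (x', y', z) ∪ tripleSet (x', y', z') = {Sum.inl x', Sum.inr (Sum.inl y'),
        Sum.inr (Sum.inr z), Sum.inr (Sum.inr z')} := by ext v; simp [tripleSet]
    rw [this]
    simp [vertexProb, hz, Ne.symm hz]
    split_ifs <;> nlinarith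
  · have : tripleSet (x', y, z') ∪ tripleSet (x', y', z') = {Sum.inl x', Sum.inr (Sum.inl y),
        Sum.inr (Sum.inl y'), Sum.inr (Sum.inr z')} := by ext v; simp [tripleSet]; tauto
    rw [this]
    simp [vertexProb, hy, Ne.symm hy]
    split_ifs <;> nlinarith
  · have : tripleSet (x', y, z) ∪ tripleSet (x', y', z') = {Sum.inl x', Sum.inr (Sum.inl y),
        Sum.inr (Sum.inl y'), Sum.inr (Sum.inr z), Sum.inr (Sum.inr z')} := by
      ext v; simp [tripleSet]; tauto
    rw [this]
    simp [vertexProb, hy, Ne.symm hy, hz, Ne.symm hz]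
    split_ifs <;> nlinarith
  · have : tripleSet (x, y', z') ∪ tripleSet (x', y', z') = {Sum.inl x, Sum.inl x',
        Sum.inr (Sum.inl y'), Sum.inr (Sum.inr z')} := by ext v; simp [tripleSet]; tauto
    rw [this]
    simp [vertexProb, hx, Ne.symm hx]
    split_ifs <;> nlinarith
  · have : tripleSet (x, y', z) ∪ tripleSet (x', y', z') = {Sum.inl x, Sum.inl x',
        Sum.inr (Sum.inl y'), Sum.inr (Sum.inr z), Sum.inr (Sum.inr z')} := by
      ext v; simp [tripleSet]; tauto
    rw [this]
    simp [vertexProb, hx, Ne.symm hx, hz, Ne.symm hz]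
    split_ifs <;> nlinarith
  · have : tripleSet (x, y, z') ∪ tripleSet (x', y', z') = {Sum.inl x, Sum.inl x',
        Sum.inr (Sum.inl y), Sum.inr (Sum.inl y'), Sum.inr (Sum.inr z')} := by
      ext v; simp [tripleSet]; tauto
    rw [this]
    simp [vertexProb, hx, Ne.symm hx, hy, Ne.symm hy]
    split_ifs <;> nlinarith
  · have : Disjoint (tripleSet (x, y, z)) (tripleSet (x', y', z')) := by
      simp [tripleSet, hx, hy, hz]
    simp [this, hx, hy, hz]

/-- The expected number of ordered pairs of distinct intersecting covering triples, when the three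
sets have the densities `p`, `q`, `r`. -/
def hitOverlap (s b : ℕ) (p q r : ℝ) : ℝ :=
  25 ^ s * (b : ℝ) ^ 5 * (p * q ^ 2 * r ^ 2 + p ^ 2 * q * r ^ 2 + p ^ 2 * q ^ 2 * r)
    + 13 ^ s * (b : ℝ) ^ 4 * (p * q * r ^ 2 + p * q ^ 2 * r + p ^ 2 * q * r)

theorem sum_overlap_le {p q r : ℝ} (hp : 0 ≤ p) (hq : 0 ≤ q) (hr : 0 ≤ r) :
    ∑ x : Idx s b, ∑ y, ∑ z, ∑ x', ∑ y', ∑ z', cov x y z * cov x' y' z' *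
      overlap (vertexProb s b p q r) tripleSet (x, y, z) (x', y', z') ≤ hitOverlap s b p q r := by
  have e : ∀ x y z x' y' z' : Idx s b, cov x y z * cov x' y' z' *
      overlap (vertexProb s b p q r) tripleSet (x, y, z) (x', y', z')
      ≤ (if x' = x then cov x y z * cov x' y' z' * (p * q ^ 2 * r ^ 2) else 0)
        + (if y' = y then cov x y z * cov x' y' z' * (p ^ 2 * q * r ^ 2) else 0)
        + (if z' = z then cov x y z * cov x' y' z' * (p ^ 2 * q ^ 2 * r) else 0)
        + (if x' = x then if y' = y then cov x y z * cov x' y' z' * (p * q * r ^ 2) else 0 else 0)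
        + (if x' = x then if z' = z then cov x y z * cov x' y' z' * (p * q ^ 2 * r) else 0 else 0)
        + (if y' = y then if z' = z then cov x y z * cov x' y' z' * (p ^ 2 * q * r) else 0
            else 0) := fun x y z x' y' z' => by
    refine (mul_le_mul_of_nonneg_left (overlap_tripleSet_le hp hq hr x y z x' y' z')
      (mul_nonneg (cov_nonneg _ _ _) (cov_nonneg _ _ _))).trans (le_of_eq ?_)
    simp only [mul_add, mul_ite, mul_zero, ite_and]
  calc _ ≤ ∑ x : Idx s b, ∑ y, ∑ z, ∑ x', ∑ y', ∑ z', _ :=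
        Finset.sum_le_sum fun x _ => Finset.sum_le_sum fun y _ => Finset.sum_le_sum fun z _ =>
          Finset.sum_le_sum fun x' _ => Finset.sum_le_sum fun y' _ => Finset.sum_le_sum
            fun z' _ => e x y z x' y' z'
    _ = _ := by
        have hx : ∀ (x : Idx s b) (F : Idx s b → Idx s b → Idx s b → ℝ),
            ∑ x', ∑ y', ∑ z', (if x' = x then F x' y' z' else 0) = ∑ y', ∑ z', F x y' z' :=
          fun x F => by
            rw [Finset.sum_eq_single x]
            · simp
            · intro x' _ h
              simp [h]
            · simp
        have hy : ∀ (y : Idx s b) (F : Idx s b → Idx s b → ℝ),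
            ∑ y', ∑ z', (if y' = y then F y' z' else 0) = ∑ z', F y z' :=
          fun y F => by
            rw [Finset.sum_eq_single y]
            · simp
            · intro y' _ h
              simp [h]
            · simp
        simp only [Finset.sum_add_distrib]
        simp only [hx, hy, Finset.sum_ite_eq', Finset.mem_univ, if_true, ← Finset.sum_mul,
          sum_cov_x, sum_cov_y, sum_cov_z, sum_cov_xy, sum_cov_xz, sum_cov_yz]
        unfold hitOverlap
        ring

theorem sum_triple (F : Idx s b × Idx s b × Idx s b → ℝ) :
    ∑ t, F t = ∑ x, ∑ y, ∑ z, F (x, y, z) := by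
  rw [Fintype.sum_prod_type]
  exact Finset.sum_congr rfl fun x _ => Fintype.sum_prod_type _

/-- Janson's inequality for the covering triples, regarded as three-element subsets of the disjoint
union of three copies of the index set. -/
theorem bE_noHit_le {p q r : ℝ} (hp : 0 ≤ p) (hp' : p ≤ 1) (hq : 0 ≤ q) (hq' : q ≤ 1)
    (hr : 0 ≤ r) (hr' : r ≤ 1) :
    bE (fun _ : Idx s b => p) (fun X => bE (fun _ : Idx s b => q) fun Y =>
      bE (fun _ : Idx s b => r) fun Z => noHit X Y Z)
      ≤ Real.exp (-(7 ^ s * (b : ℝ) ^ 3 * (p * q * r)) + hitOverlap s b p q r) := by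
  classical
  have hP : IsProb (vertexProb s b p q r) := by
    rintro (v | v | v)
    exacts [⟨hp, hp'⟩, ⟨hq, hq'⟩, ⟨hr, hr'⟩]
  have hJ := janson hP (tripleSet (s := s) (b := b))
    (Finset.univ.filter fun t => Covers t.1 t.2.1 t.2.2)
  simp_rw [bE_sum]
  refine le_trans (bE_mono hP fun ω => ?_) (hJ.trans (Real.exp_le_exp.2 ?_))
  · unfold noHit
    split_ifs with h
    · exact noneOn_nonneg _ _ _
    · refine le_of_eq (Finset.prod_eq_one fun t ht => ?_).symm
      rw [allOn, if_neg, sub_zero]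
      intro h'
      refine h ⟨t.1, t.2.1, t.2.2, ?_, ?_, ?_, (Finset.mem_filter.1 ht).2⟩
      all_goals exact h' _ (by simp [tripleSet])
  · refine add_le_add (le_of_eq ?_) ?_
    · simp_rw [prod_tripleSet]
      rw [Finset.sum_filter, sum_triple, ← sum_cov]
      simp_rw [Finset.sum_mul]
      simp only [cov, ite_mul, one_mul, zero_mul]
    · refine le_trans (le_of_eq ?_) (sum_overlap_le hp hq hr)
      simp_rw [Finset.sum_filter, sum_triple]
      refine Finset.sum_congr rfl fun x _ => Finset.sum_congr rfl fun y _ =>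
        Finset.sum_congr rfl fun z _ => ?_
      by_cases h : Covers x y z
      · rw [if_pos h]
        refine Finset.sum_congr rfl fun x' _ => Finset.sum_congr rfl fun y' _ =>
          Finset.sum_congr rfl fun z' _ => ?_
        simp only [cov, if_pos h, ite_mul, one_mul, zero_mul]
      · simp only [cov, if_neg h, zero_mul, Finset.sum_const_zero]

theorem bE_on {V : Type} [Fintype V] [DecidableEq V] (p : V → ℝ) (v : V) :
    bE p (fun ω => if ω v then 1 else 0) = p v := by
  have := bE_single p v fun _ => 1
  simpa [bE_const] using this

/-- A first moment computation. The count 13^s includes the diagonal z = z', which `twoHits` omits,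
whence only an inequality. -/
theorem bE_twoHits_le {p q r : ℝ} (hp : 0 ≤ p) (hq : 0 ≤ q) :
    bE (fun _ : Idx s b => p) (fun X => bE (fun _ : Idx s b => q) fun Y =>
      bE (fun _ : Idx s b => r) fun Z => twoHits X Y Z)
      ≤ 13 ^ s * (b : ℝ) ^ 4 * (p * q * r ^ 2) := by
  unfold twoHits
  simp only [bE_finset_sum, bE_const_mul, bE_mul_const, bE_on]
  rw [← sum_cov_xy]
  simp_rw [Finset.sum_mul, Finset.mul_sum]
  refine Finset.sum_le_sum fun x _ => Finset.sum_le_sum fun y _ => Finset.sum_le_sum fun z _ =>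
    Finset.sum_le_sum fun z' _ => ?_
  have h := mul_nonneg (cov_nonneg x y z) (cov_nonneg x y z')
  by_cases hz : z = z'
  · simp only [hz, ne_eq, not_true_eq_false, if_false, bE_const, mul_zero]
    have := mul_nonneg (cov_nonneg x y z') (cov_nonneg x y z')
    positivity
  · simp only [ne_eq, hz, not_false_eq_true, if_true, bE_allOn_eq]
    rw [Finset.prod_pair hz]
    exact le_of_eq (by ring)

end Hits

end

end BoolMM

namespace BoolMM

noncomputable section

open Comp

/-! # The estimate of the Boolean product -/

section Estimate

variable {d₁ d₂ d₃ : ℕ} {s b : ℕ}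

theorem length_allPairs : (allPairs (Idx s b) (Idx s b)).length = (2 ^ s * b) ^ 2 := by
  rw [allPairs, Finset.length_toList, Finset.card_univ, Fintype.card_prod, card_idx, sq]

theorem mem_allPairs {ι κ : Type} [Fintype ι] [Fintype κ] (p : ι × κ) : p ∈ allPairs ι κ :=
  Finset.mem_toList.2 (Finset.mem_univ p)

theorem nodup_allPairs {ι κ : Type} [Fintype ι] [Fintype κ] : (allPairs ι κ).Nodup :=
  Finset.nodup_toList _

theorem setEntry_apply {m n : ℕ} {α : Type} (X : Matrix (Fin m) (Fin n) α) (i i' : Fin m)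
    (j j' : Fin n) (a : α) :
    setEntry X i j a i' j' = if i = i' ∧ j = j' then a else X i' j' := by
  have h : ∀ Y : Fin m → Fin n → α, Function.update Y i (Function.update (Y i) j a) i' j'
      = if i = i' ∧ j = j' then a else Y i' j' := fun Y => by
    by_cases hi : i = i'
    · subst hi
      by_cases hj : j = j'
      · subst hj
        simp
      · simp [hj, Ne.symm hj]
    · simp [hi, Ne.symm hi]
  exact h X

/-- The random matrix made from the rows and columns of `A`. -/
def leftMat {R : Type} [CommRing R] (A : Matrix (Fin d₁) (Fin d₃) Bool) (f₁ : Idx s b → Fin d₁)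
    (f₃ : Idx s b → Fin d₃) : SqMat s b R := fun x z => if A (f₁ x) (f₃ z) then 1 else 0

/-- The random matrix over the field with two elements made from `B` and `D`. -/
def maskMat (B : Matrix (Fin d₃) (Fin d₂) Bool) (f₂ : Idx s b → Fin d₂) (f₃ : Idx s b → Fin d₃)
    (D : Matrix (Idx s b) (Idx s b) (Fin 2)) : SqMat s b (ZMod 2) :=
  fun z y => if B (f₃ z) (f₂ y) = true ∧ D z y = 1 then 1 else 0

/-- The result of the estimate, as a function of the random choices. -/
def estimateResult (A : Matrix (Fin d₁) (Fin d₃) Bool) (B : Matrix (Fin d₃) (Fin d₂) Bool)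
    (f₁ : Idx s b → Fin d₁) (f₂ : Idx s b → Fin d₂) (f₃ : Idx s b → Fin d₃)
    (D : Matrix (Idx s b) (Idx s b) (Fin 2)) : Matrix (Fin d₁) (Fin d₂) Bool :=
  (allPairs (Idx s b) (Idx s b)).foldl (fun C p =>
    if decide (pseudoProd (leftMat A f₁ f₃) (maskMat B f₂ f₃ D) p.1 p.2 = 1) = true then
      setEntry C (f₁ p.1) (f₂ p.2) true else C) (Matrix.of fun _ _ => false)

/-- The bound for the number of steps of a trial that is not spent in the pseudo-product. -/
theorem add_pseudoCost_le (hb : 0 < b) (c : ℕ) (hc : c ≤ 38) :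
    6 * (2 ^ s * b) + c * (2 ^ s * b) ^ 2 + pseudoCost b s ≤ 6 ^ s * (50 * b ^ 3) := by
  have h := pseudoCost_le b s
  have hm : 1 ≤ 2 ^ s * b := Nat.mul_pos (by positivity) hb
  have h2 : 2 ^ s * b ≤ (2 ^ s * b) ^ 2 := by nlinarith
  have h3 : c * (2 ^ s * b) ^ 2 ≤ 38 * (2 ^ s * b) ^ 2 := Nat.mul_le_mul_right _ hc
  omega

theorem isDet_estimate_rest (A : Matrix (Fin d₁) (Fin d₃) Bool)
    (B : Matrix (Fin d₃) (Fin d₂) Bool)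
    (f₁ : Idx s b → Fin d₁) (f₂ : Idx s b → Fin d₂) (f₃ : Idx s b → Fin d₃)
    (D : Matrix (Idx s b) (Idx s b) (Fin 2)) :
    IsDet (do
      let A' : SqMat s b (ZMod 2) ← tabulate₂ fun x z => do
        let i ← op (f₁ x)
        let k ← op (f₃ z)
        let u ← op (A i k)
        op (if u then 1 else 0)
      let B' : SqMat s b (ZMod 2) ← tabulate₂ fun z y => do
        let k ← op (f₃ z)
        let j ← op (f₂ y)
        let v ← op (B k j)
        let e ← op (D z y)
        op (if v = true ∧ e = 1 then 1 else 0)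
      let C' ← pseudoMul s A' B'
      let C₀ ← tabulate₂ fun (_ : Fin d₁) (_ : Fin d₂) => op false
      forEach (allPairs (Idx s b) (Idx s b)) C₀ fun C p => do
        let c ← op (C' p.1 p.2)
        let t ← op (decide (c = 1))
        if t then do
          let i ← op (f₁ p.1)
          let j ← op (f₂ p.2)
          op (setEntry C i j true)
        else pure C) (estimateResult A B f₁ f₂ f₃ D)
      ((2 ^ s * b) * (2 ^ s * b) * 5 +
        ((2 ^ s * b) * (2 ^ s * b) * 6 + (pseudoCost b s +
        (d₁ * d₂ * 2 + (2 ^ s * b) ^ 2 * 6)))) := by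
  refine IsDet.bind (a := leftMat A f₁ f₃) ?_ ?_
  · rw [← card_idx]
    refine isDet_tabulate₂ _ _ 4 fun x z => ?_
    refine IsDet.op_bind ?_
    refine IsDet.op_bind ?_
    refine IsDet.op_bind ?_
    exact isDet_op _
  refine IsDet.bind (a := maskMat B f₂ f₃ D) ?_ ?_
  · rw [← card_idx]
    refine isDet_tabulate₂ _ _ 5 fun x z => ?_
    refine IsDet.op_bind ?_
    refine IsDet.op_bind ?_
    refine IsDet.op_bind ?_
    refine IsDet.op_bind ?_
    exact isDet_op _
  refine (isDet_pseudoMul _ _ _).bind ?_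
  refine IsDet.bind (a := (Matrix.of fun _ _ => false : Matrix (Fin d₁) (Fin d₂) Bool)) ?_ ?_
  · have := isDet_tabulate₂ (fun (_ : Fin d₁) (_ : Fin d₂) => op false)
      (Matrix.of fun _ _ => false) 1 fun _ _ => isDet_op _
    simpa only [Fintype.card_fin] using this
  rw [← length_allPairs]
  refine isDet_forEach_const _ _ _ _ 5 fun C p => ?_
  refine IsDet.op_bind ?_
  refine IsDet.op_bind ?_
  refine IsDet.ite (fun _ => ?_) fun _ => ?_
  · refine IsDet.op_bind ?_
    refine IsDet.op_bind ?_
    exact isDet_op _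
  · exact (isDet_pure _).mono (Nat.zero_le _)

theorem foldl_setEntry_true {ι : Type} (l : List ι) (c : ι → Bool) (r : ι → Fin d₁)
    (q : ι → Fin d₂) (C : Matrix (Fin d₁) (Fin d₂) Bool) (i : Fin d₁) (j : Fin d₂) :
    l.foldl (fun C p => if c p = true then setEntry C (r p) (q p) true else C) C i j = true ↔
      C i j = true ∨ ∃ p ∈ l, c p = true ∧ r p = i ∧ q p = j := by
  induction l generalizing C with
  | nil => simp
  | cons a l ih =>
    rw [List.foldl_cons, ih]
    simp only [List.mem_cons, exists_eq_or_imp]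
    by_cases h : c a = true
    · simp only [h, if_true, setEntry_apply, true_and]
      by_cases h' : r a = i ∧ q a = j
      · simp [h']
      · simp only [h', if_false, false_or]
    · simp [h]

theorem estimateResult_eq_true (A : Matrix (Fin d₁) (Fin d₃) Bool)
    (B : Matrix (Fin d₃) (Fin d₂) Bool)
    (f₁ : Idx s b → Fin d₁) (f₂ : Idx s b → Fin d₂) (f₃ : Idx s b → Fin d₃)
    (D : Matrix (Idx s b) (Idx s b) (Fin 2)) (i : Fin d₁) (j : Fin d₂) :
    estimateResult A B f₁ f₂ f₃ D i j = true ↔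
      ∃ x y, pseudoProd (leftMat A f₁ f₃) (maskMat B f₂ f₃ D) x y = 1 ∧ f₁ x = i ∧ f₂ y = j := by
  unfold estimateResult
  refine (foldl_setEntry_true (allPairs (Idx s b) (Idx s b)) (fun p =>
    decide (pseudoProd (leftMat A f₁ f₃) (maskMat B f₂ f₃ D) p.1 p.2 = 1)) (fun p => f₁ p.1)
    (fun p => f₂ p.2) _ i j).trans ?_
  simp [mem_allPairs]

/-- The error is one-sided: without a witness every term of the relevant sums vanishes, whatever the
mask is. -/
theorem exists_witness_of_estimateResult (A : Matrix (Fin d₁) (Fin d₃) Bool)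
    (B : Matrix (Fin d₃) (Fin d₂) Bool)
    (f₁ : Idx s b → Fin d₁) (f₂ : Idx s b → Fin d₂) (f₃ : Idx s b → Fin d₃)
    (D : Matrix (Idx s b) (Idx s b) (Fin 2)) (i : Fin d₁) (j : Fin d₂)
    (h : estimateResult A B f₁ f₂ f₃ D i j = true) : ∃ k, A i k = true ∧ B k j = true := by
  obtain ⟨x, y, hxy, rfl, rfl⟩ := (estimateResult_eq_true A B f₁ f₂ f₃ D i j).1 h
  by_contra! hk
  refine one_ne_zero (hxy.symm.trans (Finset.sum_eq_zero fun z _ => ?_))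
  have := hk (f₃ z)
  unfold leftMat maskMat
  by_cases h1 : A (f₁ x) (f₃ z) = true
  · simp [h1, this h1]
  · simp [h1]

theorem avg_boole {ι : Type} [Fintype ι] (P : ι → Prop) [DecidablePred P] :
    avg (fun i => if P i then 1 else 0)
      = ((Finset.univ.filter P).card : ℝ) / Fintype.card ι := by
  unfold avg
  rw [Finset.sum_boole]

/-- For given functions, the estimate misses the entry `i, j` with probability at most
`2 ^ (-t)`, where `t` is the number of columns that contain a covering triple. -/
theorem avg_estimate_miss_le (A : Matrix (Fin d₁) (Fin d₃) Bool)
    (B : Matrix (Fin d₃) (Fin d₂) Bool)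
    (f₁ : Idx s b → Fin d₁) (f₂ : Idx s b → Fin d₂) (f₃ : Idx s b → Fin d₃) (i : Fin d₁)
    (j : Fin d₂) (k : Fin d₃) (hA : A i k = true) (hB : B k j = true)
    (T : Finset (Idx s b)) (hT : ∀ y ∈ T, f₂ y = j ∧ ∃ x z, f₁ x = i ∧ f₃ z = k ∧ Covers x y z) :
    avg (fun D : Idx s b → Idx s b → Fin 2 =>
      if estimateResult A B f₁ f₂ f₃ D i j = false then (1 : ℝ) else 0)
      ≤ (1 / 2) ^ T.card := by
  classical
  rw [avg_boole]
  set bad := Finset.univ.filter fun D : Idx s b → Idx s b → Fin 2 =>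
    estimateResult A B f₁ f₂ f₃ D i j = false
  choose! hj X Z hX hZ hcov using hT
  have hbad : ∀ D ∈ bad, ∀ y ∈ T,
      pseudoProd (leftMat A f₁ f₃) (maskMat B f₂ f₃ D) (X y) y = 0 := fun D hD y hy => by
    have h0 : ∀ a : ZMod 2, a ≠ 1 → a = 0 := by decide
    refine h0 _ fun h => ?_
    have := (estimateResult_eq_true A B f₁ f₂ f₃ D i j).2 ⟨X y, y, h, hX y hy, hj y hy⟩
    rw [(Finset.mem_filter.1 hD).2] at this
    exact Bool.false_ne_true this
  -- Adding an arbitrary bit to D at the position `(Z y, y)` for each y in T embeds the bad masks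
  -- times 2^|T| into all masks. Dividing the cardinalities gives the bound.
  have hinj : Set.InjOn (fun q : (Idx s b → Idx s b → Fin 2) × (T → Fin 2) =>
      fun z y => if h : y ∈ T then if z = Z y then q.1 z y + q.2 ⟨y, h⟩ else q.1 z y else q.1 z y)
      (bad ×ˢ (Finset.univ : Finset (T → Fin 2)) : Finset _) := by
    rintro ⟨D, ε⟩ h ⟨D', ε'⟩ h' heq
    have hD := (Finset.mem_product.1 h).1
    have hD' := (Finset.mem_product.1 h').1
    have hpt : ∀ z y, (if h : y ∈ T then if z = Z y then D z y + ε ⟨y, h⟩ else D z y else D z y)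
        = if h : y ∈ T then if z = Z y then D' z y + ε' ⟨y, h⟩ else D' z y else D' z y :=
      fun z y => congrFun (congrFun heq z) y
    have hout : ∀ z y, (y ∈ T → z ≠ Z y) → D z y = D' z y := fun z y hzy => by
      have := hpt z y
      by_cases hy : y ∈ T
      · simpa only [hy, dif_pos, hzy hy, if_false] using this
      · simpa only [hy, dif_neg, not_false_eq_true] using this
    -- For a bad mask the pseudo-product vanishes at `(X y, y)`. As the term of `Z y` has
    -- coefficient 1, the rest of the column determines the entry at `(Z y, y)`, so the added bit
    -- can be recovered.
    have hin : ∀ y ∈ T, D (Z y) y = D' (Z y) y := fun y hy => by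
      have e := (hbad D hD y hy).trans (hbad D' hD' y hy).symm
      unfold pseudoProd at e
      rw [← Finset.add_sum_erase _ _ (Finset.mem_univ (Z y)),
        ← Finset.add_sum_erase _ _ (Finset.mem_univ (Z y)), Finset.sum_congr rfl (fun z hz => by
          show (if Covers (X y) y z then leftMat A f₁ f₃ (X y) z * maskMat B f₂ f₃ D z y else 0)
            = if Covers (X y) y z then leftMat A f₁ f₃ (X y) z * maskMat B f₂ f₃ D' z y else 0
          simp only [maskMat, hout z y fun _ => Finset.ne_of_mem_erase hz])] at e
      have e := add_right_cancel e
      rw [if_pos (hcov y hy), if_pos (hcov y hy)] at e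
      simp only [leftMat, maskMat, hX y hy, hZ y hy, hj y hy, hA, hB, if_true, one_mul,
        true_and] at e
      have h2 : ∀ a b : Fin 2, (if a = 1 then (1 : ZMod 2) else 0) = (if b = 1 then 1 else 0) →
          a = b := by decide
      exact h2 _ _ e
    have hDD : D = D' := by
      funext z y
      by_cases hzy : y ∈ T ∧ z = Z y
      · rw [hzy.2]
        exact hin y hzy.1
      · exact hout z y fun hy hz => hzy ⟨hy, hz⟩
    have hεε : ε = ε' := by
      funext y
      have := hpt (Z y) y
      rw [dif_pos y.2, dif_pos y.2, if_pos rfl, if_pos rfl, hDD] at this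
      exact add_left_cancel this
    rw [hDD, hεε]
  have hcard := Finset.card_le_card_of_injOn _ (fun _ _ => Finset.mem_univ _) hinj
  rw [Finset.card_product, Finset.card_univ, Finset.card_univ, Fintype.card_fun,
    Fintype.card_fin, Fintype.card_coe] at hcard
  rw [div_le_iff₀ (Nat.cast_pos.2 Fintype.card_pos), one_div, inv_pow, ← div_eq_inv_mul,
    le_div_iff₀ (by positivity)]
  exact_mod_cast hcard

variable [NeZero d₁] [NeZero d₂] [NeZero d₃]

theorem expect_estimateProduct (A : Matrix (Fin d₁) (Fin d₃) Bool)
    (B : Matrix (Fin d₃) (Fin d₂) Bool) (F : Matrix (Fin d₁) (Fin d₂) Bool → ℝ≥0∞) :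
    expect (estimateProduct s b A B) F
      = expect (tabulate fun _ : Idx s b => draw d₁) fun f₁ =>
        expect (tabulate fun _ : Idx s b => draw d₂) fun f₂ =>
        expect (tabulate fun _ : Idx s b => draw d₃) fun f₃ =>
        expect (tabulate₂ fun (_ _ : Idx s b) => draw 2) fun D =>
          F (estimateResult A B f₁ f₂ f₃ D) := by
  unfold estimateProduct
  rw [expect_bind]
  congr 1; funext f₁
  rw [expect_bind]
  congr 1; funext f₂
  rw [expect_bind]
  congr 1; funext f₃
  rw [expect_bind]
  congr 1; funext D
  exact (isDet_estimate_rest A B f₁ f₂ f₃ D).expect_eq F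

theorem expectedCost_draws (d : ℕ) [NeZero d] :
    (tabulate fun _ : Idx s b => draw d).expectedCost ≤ ((2 * (2 ^ s * b) : ℕ) : ℝ≥0∞) := by
  refine (expectedCost_tabulate _ 1 fun _ => (expectedCost_draw d).le).trans (le_of_eq ?_)
  rw [card_idx]
  push_cast
  ring

theorem expectedCost_estimateProduct (hb : 0 < b) (A : Matrix (Fin d₁) (Fin d₃) Bool)
    (B : Matrix (Fin d₃) (Fin d₂) Bool) :
    (estimateProduct s b A B).expectedCost
      ≤ ((6 ^ s * (50 * b ^ 3) + 2 * (d₁ * d₂) : ℕ) : ℝ≥0∞) := by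
  have hD : (tabulate₂ fun (_ _ : Idx s b) => draw 2).expectedCost
      ≤ ((2 * (2 ^ s * b) ^ 2 : ℕ) : ℝ≥0∞) := by
    refine (expectedCost_tabulate₂ _ 1 fun _ _ => (expectedCost_draw 2).le).trans (le_of_eq ?_)
    rw [card_idx]
    push_cast
    ring
  unfold estimateProduct
  refine (expectedCost_bind_le (expectedCost_draws d₁) fun f₁ =>
    expectedCost_bind_le (expectedCost_draws d₂) fun f₂ =>
    expectedCost_bind_le (expectedCost_draws d₃) fun f₃ =>
    expectedCost_bind_le hD fun D =>
    (isDet_estimate_rest A B f₁ f₂ f₃ D).expectedCost_le).trans ?_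
  simp only [← Nat.cast_add]
  refine Nat.cast_le.2 ?_
  have := add_pseudoCost_le (s := s) hb 19 (by norm_num)
  nlinarith

theorem always_estimateProduct (A : Matrix (Fin d₁) (Fin d₃) Bool)
    (B : Matrix (Fin d₃) (Fin d₂) Bool) :
    Always (estimateProduct s b A B)
      fun C => ∀ i j, C i j = true → ∃ k, A i k = true ∧ B k j = true := by
  unfold estimateProduct
  refine (always_true _).bind fun f₁ _ => (always_true _).bind fun f₂ _ =>
    (always_true _).bind fun f₃ _ => (always_true _).bind fun D _ =>
    (isDet_estimate_rest A B f₁ f₂ f₃ D).always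
      (exists_witness_of_estimateResult A B f₁ f₂ f₃ D)

theorem expect_draws {G : (Idx s b → Fin d₁) → (Idx s b → Fin d₂) → (Idx s b → Fin d₃) → ℝ≥0∞}
    {R : (Idx s b → Fin d₁) → (Idx s b → Fin d₂) → (Idx s b → Fin d₃) → ℝ}
    (h0 : ∀ f₁ f₂ f₃, 0 ≤ R f₁ f₂ f₃) (h : ∀ f₁ f₂ f₃, G f₁ f₂ f₃ = ENNReal.ofReal (R f₁ f₂ f₃)) :
    expect (tabulate fun _ : Idx s b => draw d₁) (fun f₁ =>
      expect (tabulate fun _ : Idx s b => draw d₂) fun f₂ =>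
        expect (tabulate fun _ : Idx s b => draw d₃) fun f₃ => G f₁ f₂ f₃)
      = ENNReal.ofReal (avg fun f₁ => avg fun f₂ => avg fun f₃ => R f₁ f₂ f₃) := by
  simp_rw [h]
  rw [congrArg (expect _) (funext fun f₁ => congrArg (expect _) (funext fun f₂ =>
    expect_tabulate_draw_ofReal d₃ _ (h0 f₁ f₂)))]
  rw [congrArg (expect _) (funext fun f₁ =>
    expect_tabulate_draw_ofReal d₂ _ fun f₂ => avg_nonneg (h0 f₁ f₂))]
  rw [expect_tabulate_draw_ofReal d₁ _ fun f₁ => avg_nonneg fun f₂ => avg_nonneg (h0 f₁ f₂)]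

/-- Only one witness k is used. Averaging the factor 1/2 per good column over f₂ gives 1 - 1/(2 d₂)
per good position, the probability that a set of density 1/(2 d₂) avoids it. The mask is thereby
traded for a thinner second set. -/
theorem expect_estimate_miss_le (A : Matrix (Fin d₁) (Fin d₃) Bool)
    (B : Matrix (Fin d₃) (Fin d₂) Bool) (i : Fin d₁)
    (j : Fin d₂) (k : Fin d₃) (hA : A i k = true) (hB : B k j = true) :
    expect (estimateProduct s b A B) (fun C => if C i j = false then 1 else 0)
      ≤ ENNReal.ofReal (Real.exp (-(7 ^ s * (b : ℝ) ^ 3 * (1 / d₁ * (1 / 2 / d₂) * (1 / d₃)))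
        + hitOverlap s b (1 / d₁) (1 / 2 / d₂) (1 / d₃))) := by
  classical
  have hd₁ : (1 : ℝ) ≤ d₁ := Nat.one_le_cast.2 (NeZero.pos d₁)
  have hd₂ : (1 : ℝ) ≤ d₂ := Nat.one_le_cast.2 (NeZero.pos d₂)
  have hd₃ : (1 : ℝ) ≤ d₃ := Nat.one_le_cast.2 (NeZero.pos d₃)
  have hle : ∀ {d : ℝ}, 1 ≤ d → 1 / d ≤ 1 := fun h => by
    rw [div_le_one (by linarith)]
    exact h
  have hq : 1 / 2 / (d₂ : ℝ) ≤ 1 := by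
    rw [div_le_one (by linarith)]
    linarith
  have key := bE_noHit_le (s := s) (b := b) (p := 1 / d₁) (q := 1 / 2 / d₂) (r := 1 / d₃)
    (by positivity) (hle hd₁) (by positivity) hq (by positivity) (hle hd₃)
  have hnn : ∀ (f₁ : Idx s b → Fin d₁) (f₂ : Idx s b → Fin d₂) (f₃ : Idx s b → Fin d₃)
      (D : Idx s b → Idx s b → Fin 2),
      (0 : ℝ) ≤ if estimateResult A B f₁ f₂ f₃ D i j = false then 1 else 0 := by
    intro f₁ f₂ f₃ D
    split_ifs <;> norm_num
  refine ((expect_estimateProduct A B _).trans (expect_draws (R := fun f₁ f₂ f₃ =>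
    avg fun D : Idx s b → Idx s b → Fin 2 =>
      if estimateResult A B f₁ f₂ f₃ D i j = false then 1 else 0)
    (fun f₁ f₂ f₃ => avg_nonneg (hnn f₁ f₂ f₃)) fun f₁ f₂ f₃ =>
      (congrArg (expect _) (funext fun D => ?_)).trans
        (expect_tabulate₂_draw_ofReal 2 _ (hnn f₁ f₂ f₃)))).trans_le ?_
  · split_ifs <;> simp
  refine ENNReal.ofReal_le_ofReal (le_trans ?_ key)
  -- With f₁ and f₃ fixed, the good positions y form a fixed set, and both sides factor over y.
  have hstep : ∀ (f₁ : Idx s b → Fin d₁) (f₃ : Idx s b → Fin d₃),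
      avg (fun f₂ : Idx s b → Fin d₂ => avg fun D : Idx s b → Idx s b → Fin 2 =>
        if estimateResult A B f₁ f₂ f₃ D i j = false then (1 : ℝ) else 0)
      ≤ bE (fun _ : Idx s b => 1 / 2 / (d₂ : ℝ)) fun Y =>
        noHit (fun x => decide (f₁ x ∈ ({i} : Finset (Fin d₁)))) Y
          fun z => decide (f₃ z ∈ ({k} : Finset (Fin d₃))) := by
    intro f₁ f₃
    set h : Idx s b → Prop := fun y => ∃ x z, f₁ x = i ∧ f₃ z = k ∧ Covers x y z with hh
    have h1 : ∀ f₂ : Idx s b → Fin d₂, avg (fun D : Idx s b → Idx s b → Fin 2 =>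
        if estimateResult A B f₁ f₂ f₃ D i j = false then (1 : ℝ) else 0)
        ≤ ∏ y, if f₂ y = j ∧ h y then 1 / 2 else 1 := fun f₂ => by
      refine (avg_estimate_miss_le A B f₁ f₂ f₃ i j k hA hB
        (Finset.univ.filter fun y => f₂ y = j ∧ h y)
        fun y hy => (Finset.mem_filter.1 hy).2).trans (le_of_eq ?_)
      rw [Finset.prod_ite]
      simp
    refine (avg_mono h1).trans (le_of_eq ?_)
    rw [avg_prod fun y a => if a = j ∧ h y then (1 / 2 : ℝ) else 1]
    have h2 : ∀ Y : Idx s b → Bool,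
        noHit (fun x => decide (f₁ x ∈ ({i} : Finset (Fin d₁)))) Y
          (fun z => decide (f₃ z ∈ ({k} : Finset (Fin d₃))))
        = ∏ y, if Y y = true ∧ h y then (0 : ℝ) else 1 := fun Y => by
      unfold noHit
      by_cases hY : ∃ y, Y y = true ∧ h y
      · obtain ⟨y, hy⟩ := hY
        have h0 : ∏ y, (if Y y = true ∧ h y then (0 : ℝ) else 1) = 0 :=
          Finset.prod_eq_zero (Finset.mem_univ y) (if_pos hy)
        rw [h0, if_pos]
        obtain ⟨hy, x, z, hx, hz, hc⟩ := hy
        exact ⟨x, y, z, by simpa using hx, hy, by simpa using hz, hc⟩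
      · rw [Finset.prod_eq_one fun y _ => if_neg fun hy => hY ⟨y, hy⟩, if_neg]
        rintro ⟨x, y, z, hx, hy, hz, hc⟩
        exact hY ⟨y, hy, x, z, by simpa using hx, by simpa using hz, hc⟩
    simp_rw [h2]
    rw [bE_prod_univ _ fun y c => if c = true ∧ h y then (0 : ℝ) else 1]
    refine Finset.prod_congr rfl fun y _ => ?_
    by_cases hy : h y
    · have h3 : ∀ a : Fin d₂, (if a = j then (1 / 2 : ℝ) else 1)
          = 1 - if a = j then 1 / 2 else 0 := fun a => by split_ifs <;> norm_num
      simp only [hy, and_true, avg, h3]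
      rw [Finset.sum_sub_distrib, Finset.sum_ite_eq', if_pos (Finset.mem_univ j)]
      have : (d₂ : ℝ) ≠ 0 := by positivity
      simp
      field_simp
    · simp only [hy, and_false, avg, if_false]
      simp
  -- The average over f₂ has to be innermost for `hstep`; the order of the random sets is restored
  -- in the last line.
  calc _ = avg fun f₁ : Idx s b → Fin d₁ => avg fun f₃ : Idx s b → Fin d₃ =>
        avg fun f₂ : Idx s b → Fin d₂ => avg fun D : Idx s b → Idx s b → Fin 2 =>
        if estimateResult A B f₁ f₂ f₃ D i j = false then (1 : ℝ) else 0 := by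
        congr 1
        funext f₁
        exact avg_comm _
    _ ≤ avg fun f₁ : Idx s b → Fin d₁ => avg fun f₃ : Idx s b → Fin d₃ =>
        bE (fun _ : Idx s b => 1 / 2 / (d₂ : ℝ)) fun Y =>
        noHit (fun x => decide (f₁ x ∈ ({i} : Finset (Fin d₁)))) Y
          fun z => decide (f₃ z ∈ ({k} : Finset (Fin d₃))) :=
        avg_mono fun f₁ => avg_mono fun f₃ => hstep f₁ f₃
    _ = bE (fun _ : Idx s b => 1 / (d₁ : ℝ)) fun X => bE (fun _ : Idx s b => 1 / (d₃ : ℝ)) fun Z =>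
        bE (fun _ : Idx s b => 1 / 2 / (d₂ : ℝ)) fun Y => noHit X Y Z := by
        have := avg_avg_mem (V := Idx s b) (U := Idx s b) {i} {k} fun X Z =>
          bE (fun _ : Idx s b => 1 / 2 / (d₂ : ℝ)) fun Y => noHit X Y Z
        simpa only [Finset.card_singleton, Nat.cast_one, Fintype.card_fin] using this
    _ = _ := by
        congr 1
        funext X
        exact bE_comm _ _ _

end Estimate

end

end BoolMM

namespace BoolMM

noncomputable section

open Comp

/-! # The witness trials -/

section Trial

variable {d₁ d₂ d₃ : ℕ} {s b : ℕ}

/-- The random matrix made from `B` whose entries carry the names of the witnesses. -/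
def nameMat (B : Matrix (Fin d₃) (Fin d₂) Bool) (f₂ : Idx s b → Fin d₂) (f₃ : Idx s b → Fin d₃) :
    SqMat s b ℤ :=
  fun z y => if B (f₃ z) (f₂ y) then ((f₃ z : ℕ) : ℤ) + 1 else 0

/-- Enter a witness that has been checked. -/
def enterWitness (A : Matrix (Fin d₁) (Fin d₃) Bool) (B : Matrix (Fin d₃) (Fin d₂) Bool)
    (W : Matrix (Fin d₁) (Fin d₂) (Option (Fin d₃))) (i : Fin d₁) (j : Fin d₂) :
    Option (Fin d₃) → Matrix (Fin d₁) (Fin d₂) (Option (Fin d₃))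
  | none => W
  | some k => if (A i k && B k j) = true then setEntry W i j (some k) else W

/-- The result of a trial, as a function of the random choices. -/
def trialResult (A : Matrix (Fin d₁) (Fin d₃) Bool) (B : Matrix (Fin d₃) (Fin d₂) Bool)
    (W : Matrix (Fin d₁) (Fin d₂) (Option (Fin d₃)))
    (f₁ : Idx s b → Fin d₁) (f₂ : Idx s b → Fin d₂) (f₃ : Idx s b → Fin d₃) :
    Matrix (Fin d₁) (Fin d₂) (Option (Fin d₃)) :=
  (allPairs (Idx s b) (Idx s b)).foldl (fun W p => enterWitness A B W (f₁ p.1) (f₂ p.2)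
    (decode d₃ (pseudoProd (leftMat A f₁ f₃) (nameMat B f₂ f₃) p.1 p.2))) W

theorem isDet_trial_rest (A : Matrix (Fin d₁) (Fin d₃) Bool)
    (B : Matrix (Fin d₃) (Fin d₂) Bool) (W : Matrix (Fin d₁) (Fin d₂) (Option (Fin d₃)))
    (f₁ : Idx s b → Fin d₁) (f₂ : Idx s b → Fin d₂) (f₃ : Idx s b → Fin d₃) :
    IsDet (do
      let A' : SqMat s b ℤ ← tabulate₂ fun x z => do
        let i ← op (f₁ x)
        let k ← op (f₃ z)
        let u ← op (A i k)
        op (if u then 1 else 0)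
      let B' : SqMat s b ℤ ← tabulate₂ fun z y => do
        let k ← op (f₃ z)
        let j ← op (f₂ y)
        let v ← op (B k j)
        op (if v then (k : ℤ) + 1 else 0)
      let C' ← pseudoMul s A' B'
      forEach (allPairs (Idx s b) (Idx s b)) W fun W p => do
        let i ← op (f₁ p.1)
        let j ← op (f₂ p.2)
        let c ← op (C' p.1 p.2)
        let r ← op (decode d₃ c)
        match r with
        | none => pure W
        | some k => do
            let u ← op (A i k)
            let v ← op (B k j)
            if u && v then op (setEntry W i j (some k)) else pure W)
      (trialResult A B W f₁ f₂ f₃)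
      ((2 ^ s * b) * (2 ^ s * b) * 5 + ((2 ^ s * b) * (2 ^ s * b) * 5 + (pseudoCost b s +
        (2 ^ s * b) ^ 2 * 8))) := by
  refine IsDet.bind (a := leftMat A f₁ f₃) ?_ ?_
  · rw [← card_idx]
    refine isDet_tabulate₂ _ _ 4 fun x z => ?_
    refine IsDet.op_bind ?_
    refine IsDet.op_bind ?_
    refine IsDet.op_bind ?_
    exact isDet_op _
  refine IsDet.bind (a := nameMat B f₂ f₃) ?_ ?_
  · rw [← card_idx]
    refine isDet_tabulate₂ _ _ 4 fun x z => ?_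
    refine IsDet.op_bind ?_
    refine IsDet.op_bind ?_
    refine IsDet.op_bind ?_
    exact isDet_op _
  refine (isDet_pseudoMul _ _ _).bind ?_
  rw [← length_allPairs]
  refine isDet_forEach_const _ _ _ _ 7 fun W p => ?_
  refine IsDet.op_bind ?_
  refine IsDet.op_bind ?_
  refine IsDet.op_bind ?_
  refine IsDet.op_bind ?_
  cases decode d₃ (pseudoProd (leftMat A f₁ f₃) (nameMat B f₂ f₃) p.1 p.2) with
  | none => exact (isDet_pure _).mono (Nat.zero_le _)
  | some k =>
    refine IsDet.op_bind ?_
    refine IsDet.op_bind ?_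
    refine IsDet.ite (fun _ => isDet_op _) fun _ => ?_
    exact (isDet_pure _).mono (Nat.zero_le _)

/-- All the entries of `W` are witnesses. -/
def IsPartialWitness (A : Matrix (Fin d₁) (Fin d₃) Bool) (B : Matrix (Fin d₃) (Fin d₂) Bool)
    (W : Matrix (Fin d₁) (Fin d₂) (Option (Fin d₃))) : Prop :=
  ∀ i j k, W i j = some k → A i k = true ∧ B k j = true

theorem IsPartialWitness.setEntry {A : Matrix (Fin d₁) (Fin d₃) Bool}
    {B : Matrix (Fin d₃) (Fin d₂) Bool} {W : Matrix (Fin d₁) (Fin d₂) (Option (Fin d₃))}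
    (hW : IsPartialWitness A B W) (i : Fin d₁) (j : Fin d₂) (r : Option (Fin d₃))
    (h : ∀ k, r = some k → A i k = true ∧ B k j = true) :
    IsPartialWitness A B (setEntry W i j r) := by
  intro i' j' k hk
  rw [setEntry_apply] at hk
  split_ifs at hk with h'
  · obtain ⟨rfl, rfl⟩ := h'
    exact h k hk
  · exact hW i' j' k hk

theorem IsPartialWitness.enterWitness {A : Matrix (Fin d₁) (Fin d₃) Bool}
    {B : Matrix (Fin d₃) (Fin d₂) Bool} {W : Matrix (Fin d₁) (Fin d₂) (Option (Fin d₃))}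
    (hW : IsPartialWitness A B W) (i : Fin d₁) (j : Fin d₂) (r : Option (Fin d₃)) :
    IsPartialWitness A B (enterWitness A B W i j r) := by
  cases r with
  | none => exact hW
  | some k =>
    change IsPartialWitness A B
      (if (A i k && B k j) = true then BoolMM.setEntry W i j (some k) else W)
    split_ifs with h
    · refine hW.setEntry _ _ _ fun k' hk' => ?_
      rw [← Option.some.inj hk']
      simpa using h
    · exact hW

theorem isPartialWitness_foldl {ι : Type} {A : Matrix (Fin d₁) (Fin d₃) Bool}
    {B : Matrix (Fin d₃) (Fin d₂) Bool} (l : List ι)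
    (g : Matrix (Fin d₁) (Fin d₂) (Option (Fin d₃)) → ι →
      Matrix (Fin d₁) (Fin d₂) (Option (Fin d₃)))
    (hg : ∀ W p, IsPartialWitness A B W → IsPartialWitness A B (g W p))
    {W : Matrix (Fin d₁) (Fin d₂) (Option (Fin d₃))} (hW : IsPartialWitness A B W) :
    IsPartialWitness A B (l.foldl g W) := by
  induction l generalizing W with
  | nil => exact hW
  | cons p l ih => exact ih (hg W p hW)

theorem enterWitness_eq_none {A : Matrix (Fin d₁) (Fin d₃) Bool}
    {B : Matrix (Fin d₃) (Fin d₂) Bool} {W : Matrix (Fin d₁) (Fin d₂) (Option (Fin d₃))}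
    {i' : Fin d₁} {j' : Fin d₂} {r : Option (Fin d₃)} {i : Fin d₁} {j : Fin d₂}
    (h : enterWitness A B W i' j' r i j = none) :
    W i j = none ∧ (i' = i → j' = j → ∀ k, r = some k → ¬ (A i k = true ∧ B k j = true)) := by
  cases r with
  | none => exact ⟨h, by simp⟩
  | some k =>
    change (if (A i' k && B k j') = true then setEntry W i' j' (some k) else W) i j = none at h
    split_ifs at h with h'
    · rw [setEntry_apply] at h
      split_ifs at h with h''
      exact ⟨h, fun hi hj => absurd ⟨hi, hj⟩ h''⟩
    · refine ⟨h, ?_⟩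
      rintro rfl rfl k' hk'
      rw [← Option.some.inj hk']
      simpa using h'

/-- Entries may be overwritten but are never erased, so an entry empty at the end was empty
throughout and no valid name was decoded for it. -/
theorem foldl_enterWitness_eq_none {ι : Type} {A : Matrix (Fin d₁) (Fin d₃) Bool}
    {B : Matrix (Fin d₃) (Fin d₂) Bool} (l : List ι) (f : ι → Fin d₁) (g : ι → Fin d₂)
    (r : ι → Option (Fin d₃)) (W : Matrix (Fin d₁) (Fin d₂) (Option (Fin d₃)))
    {i : Fin d₁} {j : Fin d₂}
    (h : l.foldl (fun W p => enterWitness A B W (f p) (g p) (r p)) W i j = none) :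
    W i j = none ∧ ∀ p ∈ l, f p = i → g p = j → ∀ k, r p = some k →
      ¬ (A i k = true ∧ B k j = true) := by
  induction l generalizing W with
  | nil => exact ⟨h, by simp⟩
  | cons p l ih =>
    obtain ⟨h1, h2⟩ := ih _ h
    obtain ⟨h3, h4⟩ := enterWitness_eq_none h1
    refine ⟨h3, fun q hq => ?_⟩
    rcases List.mem_cons.1 hq with rfl | hq
    · exact h4
    · exact h2 q hq

theorem decode_add_one (k : Fin d₃) : decode d₃ ((k : ℕ) + 1) = some k := by
  unfold decode
  rw [dif_pos ⟨by omega, by have := k.2; omega⟩]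
  congr 1
  ext
  simp

theorem noHit_nonneg (X Y Z : Idx s b → Bool) : 0 ≤ noHit X Y Z := by
  unfold noHit
  split_ifs <;> norm_num

theorem twoHits_term_nonneg (Z : Idx s b → Bool) (x y z z' : Idx s b) :
    0 ≤ cov x y z * cov x y z' * (if z ≠ z' then allOn {z, z'} Z else 0) := by
  refine mul_nonneg (mul_nonneg (cov_nonneg _ _ _) (cov_nonneg _ _ _)) ?_
  split_ifs
  · exact allOn_nonneg _ _
  · exact le_rfl

theorem twoHits_sum_nonneg (Z : Idx s b → Bool) (x y : Idx s b) :
    0 ≤ ∑ z, ∑ z', cov x y z * cov x y z' * (if z ≠ z' then allOn {z, z'} Z else 0) :=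
  Finset.sum_nonneg fun z _ => Finset.sum_nonneg fun z' _ => twoHits_term_nonneg Z x y z z'

theorem twoHits_nonneg (X Y Z : Idx s b → Bool) : 0 ≤ twoHits X Y Z := by
  refine Finset.sum_nonneg fun x _ => mul_nonneg ?_ (Finset.sum_nonneg fun y _ =>
    mul_nonneg ?_ (twoHits_sum_nonneg Z x y))
  all_goals split_ifs <;> norm_num

/-- If a trial leaves the entry `i, j` empty, then there is no covering triple for it, or two
covering triples share their first two elements. -/
theorem one_le_of_trialResult_eq_none (A : Matrix (Fin d₁) (Fin d₃) Bool)
    (B : Matrix (Fin d₃) (Fin d₂) Bool) (W : Matrix (Fin d₁) (Fin d₂) (Option (Fin d₃)))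
    (f₁ : Idx s b → Fin d₁) (f₂ : Idx s b → Fin d₂) (f₃ : Idx s b → Fin d₃)
    (i : Fin d₁) (j : Fin d₂) (K : Finset (Fin d₃))
    (hK : ∀ k, k ∈ K ↔ A i k = true ∧ B k j = true)
    (h : trialResult A B W f₁ f₂ f₃ i j = none) :
    (1 : ℝ) ≤ noHit (fun x => decide (f₁ x ∈ ({i} : Finset (Fin d₁))))
        (fun y => decide (f₂ y ∈ ({j} : Finset (Fin d₂)))) (fun z => decide (f₃ z ∈ K))
      + twoHits (fun x => decide (f₁ x ∈ ({i} : Finset (Fin d₁))))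
        (fun y => decide (f₂ y ∈ ({j} : Finset (Fin d₂)))) (fun z => decide (f₃ z ∈ K)) := by
  classical
  have hnone := (foldl_enterWitness_eq_none _ _ _ _ _ h).2
  set X : Idx s b → Bool := fun x => decide (f₁ x ∈ ({i} : Finset (Fin d₁))) with hX
  set Y : Idx s b → Bool := fun y => decide (f₂ y ∈ ({j} : Finset (Fin d₂))) with hY
  set Z : Idx s b → Bool := fun z => decide (f₃ z ∈ K) with hZ
  have hterm := twoHits_term_nonneg Z
  have hite : ∀ c : Prop, [Decidable c] → (0 : ℝ) ≤ if c then 1 else 0 := fun c _ => by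
    split_ifs <;> norm_num
  have hzz := twoHits_sum_nonneg Z
  have hyy : ∀ x, 0 ≤ ∑ y, (if Y y then (1 : ℝ) else 0) * ∑ z, ∑ z',
      cov x y z * cov x y z' * (if z ≠ z' then allOn {z, z'} Z else 0) := fun x =>
    Finset.sum_nonneg fun y _ => mul_nonneg (hite _) (hzz x y)
  have htwo := twoHits_nonneg X Y Z
  by_cases hhit : ∃ x y z, X x ∧ Y y ∧ Z z ∧ Covers x y z
  · obtain ⟨x, y, z, hx, hy, hz, hc⟩ := hhit
    have hx' : f₁ x = i := by simpa [hX] using hx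
    have hy' : f₂ y = j := by simpa [hY] using hy
    have hz' : f₃ z ∈ K := by simpa [hZ] using hz
    have hn0 := noHit_nonneg X Y Z
    -- If z is the only covering index over a witness, all other terms vanish and the integer sum is
    -- the name of that witness, which the trial would have entered.
    by_cases huniq : ∀ z', Z z' = true → Covers x y z' → z' = z
    · exfalso
      have hval : pseudoProd (leftMat A f₁ f₃) (nameMat B f₂ f₃) x y = ((f₃ z : ℕ) : ℤ) + 1 := by
        unfold pseudoProd
        rw [Finset.sum_eq_single z]
        · have := (hK _).1 hz'
          simp [hc, leftMat, nameMat, hx', hy', this]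
        · intro z' _ hne
          by_cases hc' : Covers x y z'
          · have hz0 : f₃ z' ∉ K := fun hmem => hne (huniq z' (by simpa [hZ] using hmem) hc')
            rw [hK] at hz0
            simp only [hc', if_true, leftMat, nameMat, hx', hy']
            by_cases hA : A i (f₃ z') = true
            · rw [if_neg fun hB => hz0 ⟨hA, hB⟩, mul_zero]
            · simp [hA]
          · simp [hc']
        · simp
      exact hnone (x, y) (mem_allPairs _) hx' hy' (f₃ z) (by rw [hval]; exact decode_add_one _)
        ((hK _).1 hz')
    · push Not at huniq
      obtain ⟨z', hZ', hc', hne⟩ := huniq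
      -- A second covering index makes one term of the nonnegative sum equal to 1.
      have h1 : (1 : ℝ) ≤ twoHits X Y Z := by
        calc (1 : ℝ) = cov x y z * cov x y z' * (if z ≠ z' then allOn {z, z'} Z else 0) := by
              have : ∀ v ∈ ({z, z'} : Finset _), Z v = true := by
                simp [hz, hZ']
              rw [if_pos hne.symm, allOn, if_pos this, cov, cov, if_pos hc, if_pos hc']
              norm_num
          _ ≤ ∑ z', cov x y z * cov x y z' * (if z ≠ z' then allOn {z, z'} Z else 0) :=
              Finset.single_le_sum (fun z' _ => hterm x y z z') (Finset.mem_univ z')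
          _ ≤ ∑ z, ∑ z', cov x y z * cov x y z' * (if z ≠ z' then allOn {z, z'} Z else 0) :=
              Finset.single_le_sum (f := fun z => ∑ z', cov x y z * cov x y z' *
                (if z ≠ z' then allOn {z, z'} Z else 0))
                (fun z _ => Finset.sum_nonneg fun z' _ => hterm x y z z') (Finset.mem_univ z)
          _ = (if Y y then (1 : ℝ) else 0) * ∑ z, ∑ z',
                cov x y z * cov x y z' * (if z ≠ z' then allOn {z, z'} Z else 0) := by
              rw [if_pos hy, one_mul]
          _ ≤ ∑ y, (if Y y then (1 : ℝ) else 0) * ∑ z, ∑ z',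
                cov x y z * cov x y z' * (if z ≠ z' then allOn {z, z'} Z else 0) :=
              Finset.single_le_sum (f := fun y => (if Y y then (1 : ℝ) else 0) * ∑ z, ∑ z',
                cov x y z * cov x y z' * (if z ≠ z' then allOn {z, z'} Z else 0))
                (fun y _ => mul_nonneg (hite _) (hzz x y)) (Finset.mem_univ y)
          _ = (if X x then (1 : ℝ) else 0) * ∑ y, (if Y y then (1 : ℝ) else 0) * ∑ z, ∑ z',
                cov x y z * cov x y z' * (if z ≠ z' then allOn {z, z'} Z else 0) := by
              rw [if_pos hx, one_mul]
          _ ≤ _ := Finset.single_le_sum (f := fun x => (if X x then (1 : ℝ) else 0) *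
                ∑ y, (if Y y then (1 : ℝ) else 0) * ∑ z, ∑ z',
                cov x y z * cov x y z' * (if z ≠ z' then allOn {z, z'} Z else 0))
                (fun x _ => mul_nonneg (hite _) (hyy x)) (Finset.mem_univ x)
      linarith
  · have : noHit X Y Z = 1 := if_neg hhit
    linarith

variable [NeZero d₁] [NeZero d₂] [NeZero d₃]

theorem expect_witnessTrial (A : Matrix (Fin d₁) (Fin d₃) Bool)
    (B : Matrix (Fin d₃) (Fin d₂) Bool) (W : Matrix (Fin d₁) (Fin d₂) (Option (Fin d₃)))
    (F : Matrix (Fin d₁) (Fin d₂) (Option (Fin d₃)) → ℝ≥0∞) :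
    expect (witnessTrial s b A B W) F
      = expect (tabulate fun _ : Idx s b => draw d₁) fun f₁ =>
        expect (tabulate fun _ : Idx s b => draw d₂) fun f₂ =>
        expect (tabulate fun _ : Idx s b => draw d₃) fun f₃ =>
          F (trialResult A B W f₁ f₂ f₃) := by
  unfold witnessTrial
  rw [expect_bind]
  congr 1; funext f₁
  rw [expect_bind]
  congr 1; funext f₂
  rw [expect_bind]
  congr 1; funext f₃
  exact (isDet_trial_rest A B W f₁ f₂ f₃).expect_eq F

theorem expectedCost_witnessTrial (hb : 0 < b) (A : Matrix (Fin d₁) (Fin d₃) Bool)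
    (B : Matrix (Fin d₃) (Fin d₂) Bool) (W : Matrix (Fin d₁) (Fin d₂) (Option (Fin d₃))) :
    (witnessTrial s b A B W).expectedCost ≤ ((6 ^ s * (50 * b ^ 3) : ℕ) : ℝ≥0∞) := by
  unfold witnessTrial
  refine (expectedCost_bind_le (expectedCost_draws d₁) fun f₁ =>
    expectedCost_bind_le (expectedCost_draws d₂) fun f₂ =>
    expectedCost_bind_le (expectedCost_draws d₃) fun f₃ =>
    (isDet_trial_rest A B W f₁ f₂ f₃).expectedCost_le).trans ?_
  simp only [← Nat.cast_add]
  refine Nat.cast_le.2 ?_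
  have := add_pseudoCost_le (s := s) hb 18 (by norm_num)
  nlinarith

theorem always_witnessTrial (A : Matrix (Fin d₁) (Fin d₃) Bool)
    (B : Matrix (Fin d₃) (Fin d₂) Bool) (W : Matrix (Fin d₁) (Fin d₂) (Option (Fin d₃)))
    (hW : IsPartialWitness A B W) : Always (witnessTrial s b A B W) (IsPartialWitness A B) := by
  unfold witnessTrial
  exact (always_true _).bind fun f₁ _ => (always_true _).bind fun f₂ _ =>
    (always_true _).bind fun f₃ _ => (isDet_trial_rest A B W f₁ f₂ f₃).always
      (isPartialWitness_foldl _ _ (fun W p hW => hW.enterWitness _ _ _) hW)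

/-- A bound for the probability that a trial leaves an entry with `w` witnesses empty. -/
def missBound (s b d₁ d₂ d₃ w : ℕ) : ℝ :=
  Real.exp (-(7 ^ s * (b : ℝ) ^ 3 * (1 / d₁ * (1 / d₂) * (w / d₃)))
    + hitOverlap s b (1 / d₁) (1 / d₂) (w / d₃))
    + 13 ^ s * (b : ℝ) ^ 4 * (1 / d₁ * (1 / d₂) * (w / d₃) ^ 2)

theorem expect_witnessTrial_le_one (A : Matrix (Fin d₁) (Fin d₃) Bool)
    (B : Matrix (Fin d₃) (Fin d₂) Bool) (W : Matrix (Fin d₁) (Fin d₂) (Option (Fin d₃)))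
    (i : Fin d₁) (j : Fin d₂) :
    expect (witnessTrial s b A B W) (fun W => if W i j = none then 1 else 0)
      ≤ if W i j = none then 1 else 0 := by
  rw [expect_witnessTrial]
  have : ∀ (f₁ : Idx s b → Fin d₁) (f₂ : Idx s b → Fin d₂) (f₃ : Idx s b → Fin d₃),
      (if trialResult A B W f₁ f₂ f₃ i j = none then (1 : ℝ≥0∞) else 0)
        ≤ if W i j = none then 1 else 0 := fun f₁ f₂ f₃ => by
    by_cases h : trialResult A B W f₁ f₂ f₃ i j = none
    · rw [if_pos h, if_pos (foldl_enterWitness_eq_none _ _ _ _ _ h).1]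
    · rw [if_neg h]
      exact zero_le
  refine (expect_mono fun f₁ => expect_mono fun f₂ => expect_mono fun f₃ => this f₁ f₂ f₃).trans ?_
  simp only [expect_const, le_refl]

/-- The indicator on the right is the old value of the potential, as `expect_forEach_le` requires;
if the entry is already filled, both sides vanish. Otherwise failure implies no hit or two hits over
the same x, y. -/
theorem expect_witnessTrial_miss_le (A : Matrix (Fin d₁) (Fin d₃) Bool)
    (B : Matrix (Fin d₃) (Fin d₂) Bool) (W : Matrix (Fin d₁) (Fin d₂) (Option (Fin d₃)))
    (i : Fin d₁) (j : Fin d₂) (K : Finset (Fin d₃))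
    (hK : ∀ k, k ∈ K ↔ A i k = true ∧ B k j = true) :
    expect (witnessTrial s b A B W) (fun W => if W i j = none then 1 else 0)
      ≤ ENNReal.ofReal (missBound s b d₁ d₂ d₃ K.card) * if W i j = none then 1 else 0 := by
  classical
  by_cases hW : W i j = none
  swap
  · refine (expect_witnessTrial_le_one A B W i j).trans ?_
    simp [hW]
  rw [if_pos hW, mul_one]
  have hd₁ : (1 : ℝ) ≤ d₁ := Nat.one_le_cast.2 (NeZero.pos d₁)
  have hd₂ : (1 : ℝ) ≤ d₂ := Nat.one_le_cast.2 (NeZero.pos d₂)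
  have hd₃ : (1 : ℝ) ≤ d₃ := Nat.one_le_cast.2 (NeZero.pos d₃)
  have hle : ∀ {d : ℝ}, 1 ≤ d → 1 / d ≤ 1 := fun h => by
    rw [div_le_one (by linarith)]
    exact h
  have hr : (K.card : ℝ) / d₃ ≤ 1 := by
    rw [div_le_one (by linarith)]
    exact_mod_cast (Finset.card_le_univ K).trans (by simp)
  have key₁ := bE_noHit_le (s := s) (b := b) (p := 1 / d₁) (q := 1 / d₂) (r := K.card / d₃)
    (by positivity) (hle hd₁) (by positivity) (hle hd₂) (by positivity) hr
  have key₂ := bE_twoHits_le (s := s) (b := b) (p := 1 / d₁) (q := 1 / d₂) (r := K.card / d₃)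
    (by positivity) (by positivity)
  have hnn : ∀ (f₁ : Idx s b → Fin d₁) (f₂ : Idx s b → Fin d₂) (f₃ : Idx s b → Fin d₃),
      (0 : ℝ) ≤ if trialResult A B W f₁ f₂ f₃ i j = none then 1 else 0 := by
    intro f₁ f₂ f₃
    split_ifs <;> norm_num
  refine ((expect_witnessTrial A B W _).trans (expect_draws (R := fun f₁ f₂ f₃ =>
      if trialResult A B W f₁ f₂ f₃ i j = none then 1 else 0) hnn
      fun f₁ f₂ f₃ => ?_)).trans_le ?_
  · split_ifs <;> simp
  refine ENNReal.ofReal_le_ofReal (le_trans ?_ (add_le_add key₁ key₂))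
  simp_rw [← bE_add]
  refine (avg_mono fun f₁ => avg_mono fun f₂ => avg_mono fun f₃ => ?_).trans
    (le_of_eq (?_ : avg (fun f₁ : Idx s b → Fin d₁ => avg fun f₂ : Idx s b → Fin d₂ =>
      avg fun f₃ : Idx s b → Fin d₃ =>
      noHit (fun x => decide (f₁ x ∈ ({i} : Finset (Fin d₁))))
        (fun y => decide (f₂ y ∈ ({j} : Finset (Fin d₂)))) (fun z => decide (f₃ z ∈ K))
      + twoHits (fun x => decide (f₁ x ∈ ({i} : Finset (Fin d₁))))
        (fun y => decide (f₂ y ∈ ({j} : Finset (Fin d₂)))) (fun z => decide (f₃ z ∈ K))) = _))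
  · by_cases h : trialResult A B W f₁ f₂ f₃ i j = none
    · rw [if_pos h]
      exact one_le_of_trialResult_eq_none A B W f₁ f₂ f₃ i j K hK h
    · rw [if_neg h]
      exact add_nonneg (noHit_nonneg _ _ _) (twoHits_nonneg _ _ _)
  · have := avg_avg_mem (V := Idx s b) (U := Idx s b) {i} {j} fun X Y =>
      bE (fun _ : Idx s b => (K.card : ℝ) / Fintype.card (Fin d₃)) fun Z =>
        noHit X Y Z + twoHits X Y Z
    simp only [Finset.card_singleton, Nat.cast_one, Fintype.card_fin] at this
    rw [← this]
    refine congrArg avg (funext fun f₁ => congrArg avg (funext fun f₂ => ?_))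
    have := avg_mem (V := Idx s b) K fun Z =>
      noHit (fun x => decide (f₁ x ∈ ({i} : Finset (Fin d₁))))
        (fun y => decide (f₂ y ∈ ({j} : Finset (Fin d₂)))) Z
      + twoHits (fun x => decide (f₁ x ∈ ({i} : Finset (Fin d₁))))
        (fun y => decide (f₂ y ∈ ({j} : Finset (Fin d₂)))) Z
    simpa only [Fintype.card_fin] using this

end Trial

end

end BoolMM

namespace BoolMM

noncomputable section

open Comp

/-! # The random permutation -/

section Shuffle

variable {d : ℕ}

theorem perm_apply_inv {α : Type} (π : Equiv.Perm α) (a : α) : π (π⁻¹ a) = a :=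
  π.apply_symm_apply a

theorem perm_inv_apply {α : Type} (π : Equiv.Perm α) (a : α) : π⁻¹ (π a) = a :=
  π.symm_apply_apply a

/-- The permutations that fix all the elements from `n` on. -/
def fixFrom (d n : ℕ) : Finset (Equiv.Perm (Fin d)) :=
  Finset.univ.filter fun π => ∀ k : Fin d, n ≤ k → π k = k

theorem mem_fixFrom {n : ℕ} {π : Equiv.Perm (Fin d)} :
    π ∈ fixFrom d n ↔ ∀ k : Fin d, n ≤ k → π k = k := by
  simp [fixFrom]

/-- Each permutation fixing everything beyond i is π times a swap of i and j in exactly one way,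
with π also fixing i: necessarily j is the preimage of i. -/
theorem sum_fixFrom_succ (i : Fin d) (G : Equiv.Perm (Fin d) → ℝ≥0∞) :
    ∑ π ∈ fixFrom d i, ∑ j : Fin (i.val + 1), G (π * Equiv.swap i (Fin.castLE i.isLt j))
      = ∑ σ ∈ fixFrom d (i.val + 1), G σ := by
  rw [← Finset.sum_product']
  refine Finset.sum_bij (fun q _ => q.1 * Equiv.swap i (Fin.castLE i.isLt q.2)) ?_ ?_ ?_ ?_
  · rintro ⟨π, j⟩ h
    have hπ := mem_fixFrom.1 (Finset.mem_product.1 h).1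
    refine mem_fixFrom.2 fun k hk => ?_
    have h1 : k ≠ i := fun h => by
      rw [h] at hk
      omega
    have h2 : k ≠ Fin.castLE i.isLt j := fun h => by
      rw [h, Fin.val_castLE] at hk
      have := j.isLt
      omega
    rw [Equiv.Perm.mul_apply, Equiv.swap_apply_of_ne_of_ne h1 h2]
    exact hπ k (by omega)
  · rintro ⟨π, j⟩ h ⟨π', j'⟩ h' heq
    have hπ := mem_fixFrom.1 (Finset.mem_product.1 h).1 i le_rfl
    have hπ' := mem_fixFrom.1 (Finset.mem_product.1 h').1 i le_rfl
    simp only at heq hπ hπ'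
    have h1 := congrArg (fun σ : Equiv.Perm (Fin d) => σ (Fin.castLE i.isLt j)) heq
    simp only [Equiv.Perm.mul_apply, Equiv.swap_apply_right, hπ] at h1
    have h2 : Equiv.swap i (Fin.castLE i.isLt j') (Fin.castLE i.isLt j) = i :=
      π'.injective (h1.symm.trans hπ'.symm)
    have h3 : Fin.castLE i.isLt j = Fin.castLE i.isLt j' :=
      (Equiv.swap i (Fin.castLE i.isLt j')).injective
        (h2.trans (Equiv.swap_apply_right _ _).symm)
    have h4 : j = j' := Fin.castLE_injective _ h3
    subst h4
    rw [mul_right_cancel heq]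
  · intro σ hσ
    have hσ' := mem_fixFrom.1 hσ
    have hj : (σ⁻¹ i).val < i.val + 1 := by
      by_contra h
      have h1 := hσ' (σ⁻¹ i) (by omega)
      rw [perm_apply_inv] at h1
      rw [← h1] at h
      omega
    refine ⟨(σ * Equiv.swap i (σ⁻¹ i), ⟨(σ⁻¹ i).val, hj⟩), ?_, ?_⟩
    · refine Finset.mem_product.2 ⟨mem_fixFrom.2 fun k hk => ?_, Finset.mem_univ _⟩
      rw [Equiv.Perm.mul_apply]
      by_cases h1 : k = i
      · rw [h1, Equiv.swap_apply_left, perm_apply_inv]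
      · have h1' : k.val ≠ i.val := fun h => h1 (Fin.ext h)
        have h2 : k ≠ σ⁻¹ i := fun h => by
          have : k.val = (σ⁻¹ i).val := congrArg _ h
          omega
        rw [Equiv.swap_apply_of_ne_of_ne h1 h2]
        exact hσ' k (by omega)
    · have : Fin.castLE i.isLt ⟨(σ⁻¹ i).val, hj⟩ = σ⁻¹ i := Fin.ext rfl
      simp only [this, mul_assoc, Equiv.swap_mul_self, mul_one]
  · intro q _
    rfl

/-- The body of the loop of `shuffle`. -/
def shuffleStep (π : Equiv.Perm (Fin d)) (i : Fin d) : Comp (Equiv.Perm (Fin d)) := do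
  let j ← draw (i.val + 1)
  charge 4
  pure (π * Equiv.swap i (Fin.castLE i.isLt j))

theorem expect_shuffleStep (π : Equiv.Perm (Fin d)) (i : Fin d)
    (F : Equiv.Perm (Fin d) → ℝ≥0∞) :
    expect (shuffleStep π i) F = ((i.val + 1 : ℕ) : ℝ≥0∞)⁻¹ *
      ∑ j : Fin (i.val + 1), F (π * Equiv.swap i (Fin.castLE i.isLt j)) := by
  unfold shuffleStep
  simp only [expect_bind, charge_eq_det, pure_eq_det, expect_det, expect_draw]

/-- The constant is left unspecified. What matters is that it does not depend on F, since
normalization determines it at the end. -/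
theorem expect_shuffle_aux (d m n : ℕ) (hmn : n + m = d) :
    ∃ c : ℝ≥0∞, ∀ F : Equiv.Perm (Fin d) → ℝ≥0∞,
      ∑ π ∈ fixFrom d n, expect (forEach ((List.finRange d).drop n) π shuffleStep) F
        = c * ∑ σ, F σ := by
  induction m generalizing n with
  | zero =>
    refine ⟨1, fun F => ?_⟩
    have h1 : (List.finRange d).drop n = [] := by simp [← hmn]
    have h2 : fixFrom d n = Finset.univ := by
      ext π
      simp only [mem_fixFrom, Finset.mem_univ, iff_true]
      intro k hk
      have := k.isLt
      omega
    rw [h1, h2, one_mul]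
    exact Finset.sum_congr rfl fun π _ => expect_det _ _ _
  | succ m ih =>
    obtain ⟨c, hc⟩ := ih (n + 1) (by omega)
    have hn : n < d := by omega
    refine ⟨((n + 1 : ℕ) : ℝ≥0∞)⁻¹ * c, fun F => ?_⟩
    have h1 : (List.finRange d).drop n = ⟨n, hn⟩ :: (List.finRange d).drop (n + 1) := by
      rw [List.drop_eq_getElem_cons (by simpa using hn)]
      simp
    rw [h1, mul_assoc, ← hc F]
    simp only [forEach, charge_eq_det, expect_bind, expect_det, expect_shuffleStep]
    rw [← Finset.mul_sum, ← sum_fixFrom_succ ⟨n, hn⟩]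

theorem shuffle_eq (d : ℕ) :
    shuffle d = (charge d >>= fun _ => forEach (List.finRange d) 1 shuffleStep) := rfl

/-- The result of `shuffle` is uniformly distributed. -/
theorem expect_shuffle (d : ℕ) (F : Equiv.Perm (Fin d) → ℝ≥0∞) :
    expect (shuffle d) F = (d.factorial : ℝ≥0∞)⁻¹ * ∑ σ, F σ := by
  obtain ⟨c, hc⟩ := expect_shuffle_aux d d 0 (zero_add d)
  have h0 : fixFrom d 0 = {1} := by
    ext π
    simp only [mem_fixFrom, Finset.mem_singleton, Nat.zero_le, true_implies]
    exact ⟨fun h => Equiv.ext h, fun h k => by rw [h]; rfl⟩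
  have h1 : ∀ F, expect (shuffle d) F = c * ∑ σ, F σ := fun F => by
    rw [← hc F, h0, Finset.sum_singleton, shuffle_eq, expect_bind, charge_eq_det, expect_det,
      List.drop_zero]
  -- The total mass 1 identifies the constant as 1/d!.
  have h2 := h1 fun _ => 1
  rw [expect_const, Finset.sum_const, Finset.card_univ, Fintype.card_perm, Fintype.card_fin,
    nsmul_one] at h2
  rw [h1, ENNReal.eq_inv_of_mul_eq_one_left h2.symm]

theorem expectedCost_shuffle (d : ℕ) : (shuffle d).expectedCost ≤ ((7 * d : ℕ) : ℝ≥0∞) := by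
  rw [shuffle_eq]
  refine (expectedCost_bind_le (isDet_charge d).expectedCost_le fun _ =>
    expectedCost_forEach_le _ _ _ (fun _ => 1 + ((4 : ℕ) + (0 : ℕ))) fun π i =>
      expectedCost_bind_le (expectedCost_draw _).le fun _ => expectedCost_bind_le
        (isDet_charge 4).expectedCost_le fun _ => (isDet_pure _).expectedCost_le).trans ?_
  rw [List.map_const', List.sum_replicate, List.length_finRange, nsmul_eq_mul]
  push_cast
  apply le_of_eq
  ring

/-- The permutations under which `a` comes before all the elements of `K`. -/
def comesFirst (a : Fin d) (K : Finset (Fin d)) : Finset (Equiv.Perm (Fin d)) :=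
  Finset.univ.filter fun π => ∀ e ∈ K, π⁻¹ a < π⁻¹ e

/-- By symmetry under swaps, each of the |K| + 1 elements of K ∪ {a} comes first equally often, and
these events are disjoint. -/
theorem card_comesFirst_le (a : Fin d) (K : Finset (Fin d)) (ha : a ∉ K) :
    (K.card + 1) * (comesFirst a K).card ≤ d.factorial := by
  set S : Fin d → Finset (Equiv.Perm (Fin d)) := fun e => comesFirst e ((insert a K).erase e)
  have hS : ∀ e ∈ insert a K, (S e).card = (comesFirst a K).card := fun e he => by
    symm
    refine Finset.card_bij (fun π _ => Equiv.swap a e * π) ?_ ?_ ?_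
    · intro π hπ
      have hπ' := (Finset.mem_filter.1 hπ).2
      refine Finset.mem_filter.2 ⟨Finset.mem_univ _, fun e' he' => ?_⟩
      obtain ⟨hne, hmem⟩ := Finset.mem_erase.1 he'
      rw [mul_inv_rev, Equiv.swap_inv, Equiv.Perm.mul_apply, Equiv.Perm.mul_apply,
        Equiv.swap_apply_right]
      refine hπ' _ ?_
      rcases Finset.mem_insert.1 hmem with rfl | hK
      · rw [Equiv.swap_apply_left]
        exact (Finset.mem_insert.1 he).resolve_left hne.symm
      · rw [Equiv.swap_apply_of_ne_of_ne (ne_of_mem_of_not_mem hK ha) hne]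
        exact hK
    · intro π _ π' _ h
      exact mul_left_cancel h
    · intro σ hσ
      have hσ' := (Finset.mem_filter.1 hσ).2
      refine ⟨Equiv.swap a e * σ, Finset.mem_filter.2 ⟨Finset.mem_univ _, fun e' he' => ?_⟩, ?_⟩
      · rw [mul_inv_rev, Equiv.swap_inv, Equiv.Perm.mul_apply, Equiv.Perm.mul_apply,
          Equiv.swap_apply_left]
        refine hσ' _ (Finset.mem_erase.2 ?_)
        by_cases h : e' = e
        · subst h
          rw [Equiv.swap_apply_right]
          exact ⟨(ne_of_mem_of_not_mem he' ha).symm, Finset.mem_insert_self _ _⟩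
        · rw [Equiv.swap_apply_of_ne_of_ne (ne_of_mem_of_not_mem he' ha) h]
          exact ⟨h, Finset.mem_insert_of_mem he'⟩
      · rw [← mul_assoc, Equiv.swap_mul_self, one_mul]
  have hdisj : ((insert a K : Finset (Fin d)) : Set (Fin d)).PairwiseDisjoint S := by
    intro e he e' he' hne
    refine Finset.disjoint_left.2 fun π h h' => ?_
    have h1 := (Finset.mem_filter.1 h).2 e' (Finset.mem_erase.2 ⟨hne.symm, he'⟩)
    have h2 := (Finset.mem_filter.1 h').2 e (Finset.mem_erase.2 ⟨hne, he⟩)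
    exact lt_asymm h1 h2
  calc (K.card + 1) * (comesFirst a K).card = ∑ e ∈ insert a K, (S e).card := by
        rw [Finset.sum_congr rfl hS, Finset.sum_const, Finset.card_insert_of_notMem ha, smul_eq_mul]
    _ = ((insert a K).biUnion S).card := (Finset.card_biUnion hdisj).symm
    _ ≤ Fintype.card (Equiv.Perm (Fin d)) := Finset.card_le_univ _
    _ = d.factorial := by rw [Fintype.card_perm, Fintype.card_fin]

/-- The number of positions before all the positions of elements of `K`. -/
def waiting (K : Finset (Fin d)) (π : Equiv.Perm (Fin d)) : ℕ :=
  (Finset.univ.filter fun k : Fin d => ∀ k', π k' ∈ K → k < k').card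

theorem sum_waiting_le (K : Finset (Fin d)) :
    (K.card + 1) * ∑ π, waiting K π ≤ d * d.factorial := by
  have h1 : ∀ π : Equiv.Perm (Fin d),
      waiting K π = ∑ a : Fin d, if π ∈ comesFirst a K then 1 else 0 := fun π => by
    unfold waiting
    -- Positions are reindexed by the elements placed there; a position counts exactly if its
    -- element comes before all of K.
    rw [Finset.card_filter, ← Equiv.sum_comp π⁻¹]
    refine Finset.sum_congr rfl fun a _ => if_congr ?_ rfl rfl
    simp only [comesFirst, Finset.mem_filter, Finset.mem_univ, true_and]
    constructor
    · intro h e he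
      exact h _ (by rwa [perm_apply_inv])
    · intro h k' hk'
      have := h _ hk'
      rwa [perm_inv_apply] at this
  simp_rw [h1]
  rw [Finset.sum_comm, Finset.mul_sum]
  calc _ ≤ ∑ _a : Fin d, d.factorial := by
        refine Finset.sum_le_sum fun a _ => ?_
        rw [Finset.sum_boole, Finset.filter_mem_eq_inter, Finset.univ_inter]
        by_cases ha : a ∈ K
        · have : comesFirst a K = ∅ := by
            refine Finset.filter_eq_empty_iff.2 fun π _ h => ?_
            exact lt_irrefl _ (h a ha)
          rw [this]
          simp
        · exact card_comesFirst_le a K ha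
    _ = d * d.factorial := by simp

/-- Stated as a product so that the factor |K| can cancel against the bound for the probability of
an empty entry. A probe costs four steps, the last probe is the hit, and one further step stores the
result. The constant is 9 = 4 + 5, using |K| ≤ d for the constant part. -/
theorem expect_waiting_le (K : Finset (Fin d)) :
    ((K.card : ℕ) : ℝ≥0∞) * expect (shuffle d) (fun π => ((4 * (waiting K π + 1) + 1 : ℕ) : ℝ≥0∞))
      ≤ ((9 * d : ℕ) : ℝ≥0∞) := by
  have hf : ((d.factorial : ℕ) : ℝ≥0∞) ≠ 0 := Nat.cast_ne_zero.2 d.factorial_ne_zero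
  have hKd : K.card ≤ d := (Finset.card_le_univ K).trans (by simp)
  have h := sum_waiting_le K
  have h' : K.card * ∑ π : Equiv.Perm (Fin d), (4 * (waiting K π + 1) + 1)
      ≤ d.factorial * (9 * d) := by
    have e : ∑ π : Equiv.Perm (Fin d), (4 * (waiting K π + 1) + 1)
        = 4 * ∑ π, waiting K π + 5 * d.factorial := by
      simp only [mul_add, Finset.sum_add_distrib, ← Finset.mul_sum, Finset.sum_const,
        Finset.card_univ, Fintype.card_perm, Fintype.card_fin, smul_eq_mul]
      ring
    rw [e]
    nlinarith [Nat.mul_le_mul_right d.factorial hKd, Nat.zero_le (∑ π, waiting K π)]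
  rw [expect_shuffle, mul_left_comm, ← Nat.cast_sum, ← Nat.cast_mul]
  calc _ ≤ (d.factorial : ℝ≥0∞)⁻¹ * ((d.factorial * (9 * d) : ℕ) : ℝ≥0∞) := by
        gcongr
    _ = _ := by
        rw [Nat.cast_mul, ← mul_assoc, ENNReal.inv_mul_cancel hf (ENNReal.natCast_ne_top _),
          one_mul]

end Shuffle

/-! # The search for the remaining witnesses -/

section Search

variable {d₁ d₂ d₃ : ℕ}

/-- The result of the search. -/
def searchResult (A : Matrix (Fin d₁) (Fin d₃) Bool) (B : Matrix (Fin d₃) (Fin d₂) Bool)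
    (π : Equiv.Perm (Fin d₃)) (i : Fin d₁) (j : Fin d₂) (l : List (Fin d₃)) : Option (Fin d₃) :=
  (l.find? fun k => A i (π k) && B (π k) j).map π

theorem isDet_search (A : Matrix (Fin d₁) (Fin d₃) Bool) (B : Matrix (Fin d₃) (Fin d₂) Bool)
    (π : Equiv.Perm (Fin d₃)) (i : Fin d₁) (j : Fin d₂) (l : List (Fin d₃)) :
    IsDet (search A B π i j l) (searchResult A B π i j l)
      (4 * ((l.takeWhile fun k => !(A i (π k) && B (π k) j)).length + 1)) := by
  induction l with
  | nil => exact (isDet_pure _).mono (Nat.zero_le _)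
  | cons k l ih =>
    unfold search
    by_cases h : (A i (π k) && B (π k) j) = true
    · have e : searchResult A B π i j (k :: l) = some (π k) := by
        rw [searchResult, List.find?_cons_of_pos (p := fun k => A i (π k) && B (π k) j) h]
        rfl
      rw [e, List.takeWhile_cons_of_neg (p := fun k => !(A i (π k) && B (π k) j))
        (by simp only [h]; decide)]
      refine IsDet.bind (M := 1) (N := 3) (isDet_charge 1) ?_
      refine IsDet.op_bind ?_
      refine IsDet.op_bind ?_
      refine IsDet.op_bind ?_
      rw [if_pos h]
      exact isDet_pure _
    · have e : searchResult A B π i j (k :: l) = searchResult A B π i j l := by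
        rw [searchResult, List.find?_cons_of_neg (p := fun k => A i (π k) && B (π k) j) h]
        rfl
      rw [e, List.takeWhile_cons_of_pos (p := fun k => !(A i (π k) && B (π k) j))
        (by rw [Bool.eq_false_of_not_eq_true h]; rfl)]
      refine IsDet.mono (M := 1 + (4 * ((l.takeWhile fun k =>
        !(A i (π k) && B (π k) j)).length + 1) + 1 + 1 + 1)) ?_ ?_
      · refine (isDet_charge 1).bind ?_
        refine IsDet.op_bind ?_
        refine IsDet.op_bind ?_
        refine IsDet.op_bind ?_
        rw [if_neg h]
        exact ih
      · rw [List.length_cons]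
        omega

theorem lt_of_mem_takeWhile {l : List (Fin d₃)} (hl : l.Pairwise (· < ·)) (p : Fin d₃ → Bool)
    {k k' : Fin d₃} (hk : k ∈ l.takeWhile p) (hk' : k' ∈ l) (hp : p k' = false) : k < k' := by
  induction l with
  | nil => simp at hk'
  | cons a l ih =>
    obtain ⟨h1, h2⟩ := List.pairwise_cons.1 hl
    by_cases ha : p a = true
    · rw [List.takeWhile_cons_of_pos ha] at hk
      have hk'' : k' ∈ l := by
        rcases List.mem_cons.1 hk' with rfl | h
        · rw [ha] at hp
          exact absurd hp (by simp)
        · exact h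
      rcases List.mem_cons.1 hk with rfl | hk
      · exact h1 k' hk''
      · exact ih h2 hk hk''
    · rw [List.takeWhile_cons_of_neg ha] at hk
      simp at hk

theorem length_takeWhile_le_waiting (A : Matrix (Fin d₁) (Fin d₃) Bool)
    (B : Matrix (Fin d₃) (Fin d₂) Bool) (π : Equiv.Perm (Fin d₃)) (i : Fin d₁) (j : Fin d₂)
    (K : Finset (Fin d₃)) (hK : ∀ k, k ∈ K ↔ A i k = true ∧ B k j = true) :
    ((List.finRange d₃).takeWhile fun k => !(A i (π k) && B (π k) j)).length ≤ waiting K π := by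
  have hnd := (List.takeWhile_sublist (fun k => !(A i (π k) && B (π k) j))).nodup
    (List.nodup_finRange d₃)
  rw [← List.toFinset_card_of_nodup hnd]
  refine Finset.card_le_card fun k hk => Finset.mem_filter.2 ⟨Finset.mem_univ _, fun k' hk' => ?_⟩
  refine lt_of_mem_takeWhile (List.pairwise_lt_finRange d₃) _ (List.mem_toFinset.1 hk)
    (List.mem_finRange k') ?_
  simpa using (hK _).1 hk'

theorem searchResult_eq_some (A : Matrix (Fin d₁) (Fin d₃) Bool)
    (B : Matrix (Fin d₃) (Fin d₂) Bool) (π : Equiv.Perm (Fin d₃)) (i : Fin d₁) (j : Fin d₂)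
    (l : List (Fin d₃)) {k : Fin d₃} (h : searchResult A B π i j l = some k) :
    A i k = true ∧ B k j = true := by
  unfold searchResult at h
  obtain ⟨k', hk', rfl⟩ := Option.map_eq_some_iff.1 h
  simpa using List.find?_some hk'

theorem searchResult_ne_none (A : Matrix (Fin d₁) (Fin d₃) Bool)
    (B : Matrix (Fin d₃) (Fin d₂) Bool) (π : Equiv.Perm (Fin d₃)) (i : Fin d₁) (j : Fin d₂)
    {k : Fin d₃} (h : A i k = true ∧ B k j = true) :
    searchResult A B π i j (List.finRange d₃) ≠ none := by
  unfold searchResult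
  rw [Ne, Option.map_eq_none_iff, List.find?_eq_none]
  intro h'
  refine h' (π⁻¹ k) (List.mem_finRange _) ?_
  rw [perm_apply_inv, h.1, h.2]
  rfl

/-- One step of the last loop. -/
def finalStep (A : Matrix (Fin d₁) (Fin d₃) Bool) (B : Matrix (Fin d₃) (Fin d₂) Bool)
    (C : Matrix (Fin d₁) (Fin d₂) Bool) (π : Equiv.Perm (Fin d₃))
    (W : Matrix (Fin d₁) (Fin d₂) (Option (Fin d₃))) (p : Fin d₁ × Fin d₂) :
    Matrix (Fin d₁) (Fin d₂) (Option (Fin d₃)) :=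
  if (C p.1 p.2 && (W p.1 p.2).isNone) = true then
    setEntry W p.1 p.2 (searchResult A B π p.1 p.2 (List.finRange d₃)) else W

/-- The list has no repetitions, so an entry is unchanged until its own turn. Hence the cost can be
written in terms of the initial W, which is what permits taking expectations entry by entry. -/
theorem isDet_final (A : Matrix (Fin d₁) (Fin d₃) Bool) (B : Matrix (Fin d₃) (Fin d₂) Bool)
    (C : Matrix (Fin d₁) (Fin d₂) Bool) (π : Equiv.Perm (Fin d₃))
    (W : Matrix (Fin d₁) (Fin d₂) (Option (Fin d₃))) (N : Fin d₁ × Fin d₂ → ℕ)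
    (hN : ∀ p, ((List.finRange d₃).takeWhile fun k => !(A p.1 (π k) && B (π k) p.2)).length ≤ N p)
    (l : List (Fin d₁ × Fin d₂)) (hl : l.Nodup) :
    IsDet (forEach l W fun W p => do
        let u ← op (C p.1 p.2)
        let w ← op (W p.1 p.2)
        if u && w.isNone then do
          let r ← search A B π p.1 p.2 (List.finRange d₃)
          op (setEntry W p.1 p.2 r)
        else pure W) (l.foldl (finalStep A B C π) W)
      (l.map fun p => 3 + if (C p.1 p.2 && (W p.1 p.2).isNone) = true then 4 * (N p + 1) + 1
        else 0).sum := by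
  induction l generalizing W with
  | nil => exact isDet_pure W
  | cons p l ih =>
    obtain ⟨hp, hl⟩ := List.nodup_cons.1 hl
    have hrest : ∀ q ∈ l, finalStep A B C π W p q.1 q.2 = W q.1 q.2 := fun q hq => by
      unfold finalStep
      split_ifs
      · rw [setEntry_apply, if_neg]
        rintro ⟨h1, h2⟩
        exact hp (by rwa [show p = q from Prod.ext h1 h2])
      · rfl
    have ih' := ih (finalStep A B C π W p) hl
    rw [List.map_congr_left fun q hq => by rw [hrest q hq]] at ih'
    rw [List.foldl_cons, List.map_cons, List.sum_cons]
    refine IsDet.mono (M := 1 + ((if (C p.1 p.2 && (W p.1 p.2).isNone) = true then 4 * (N p + 1) + 1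
      else 0) + 1 + 1 + (l.map fun p => 3 + if (C p.1 p.2 && (W p.1 p.2).isNone) = true then
        4 * (N p + 1) + 1 else 0).sum)) ?_ (by omega)
    refine (isDet_charge 1).bind (IsDet.bind (IsDet.op_bind (IsDet.op_bind ?_)) ih')
    unfold finalStep
    by_cases h : (C p.1 p.2 && (W p.1 p.2).isNone) = true
    · rw [if_pos h, if_pos h, if_pos h]
      refine ((isDet_search A B π p.1 p.2 _).mono ?_).bind (isDet_op _)
      have := hN p
      omega
    · rw [if_neg h, if_neg h, if_neg h]
      exact isDet_pure _

theorem foldl_finalStep_isPartialWitness (A : Matrix (Fin d₁) (Fin d₃) Bool)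
    (B : Matrix (Fin d₃) (Fin d₂) Bool) (C : Matrix (Fin d₁) (Fin d₂) Bool)
    (π : Equiv.Perm (Fin d₃)) {W : Matrix (Fin d₁) (Fin d₂) (Option (Fin d₃))}
    (hW : IsPartialWitness A B W) (l : List (Fin d₁ × Fin d₂)) :
    IsPartialWitness A B (l.foldl (finalStep A B C π) W) := by
  refine isPartialWitness_foldl _ _ (fun W p hW => ?_) hW
  unfold finalStep
  split_ifs
  · exact hW.setEntry _ _ _ fun k hk => searchResult_eq_some A B π _ _ _ hk
  · exact hW

theorem finalStep_ne_none (A : Matrix (Fin d₁) (Fin d₃) Bool)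
    (B : Matrix (Fin d₃) (Fin d₂) Bool) (C : Matrix (Fin d₁) (Fin d₂) Bool)
    (π : Equiv.Perm (Fin d₃)) (W : Matrix (Fin d₁) (Fin d₂) (Option (Fin d₃)))
    {i : Fin d₁} {j : Fin d₂} (p : Fin d₁ × Fin d₂) (h : W i j ≠ none) :
    finalStep A B C π W p i j ≠ none := by
  unfold finalStep
  split_ifs with h1
  · rw [setEntry_apply]
    split_ifs with h2
    · obtain ⟨rfl, rfl⟩ := h2
      simp [h] at h1
    · exact h
  · exact h

theorem foldl_finalStep_ne_none (A : Matrix (Fin d₁) (Fin d₃) Bool)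
    (B : Matrix (Fin d₃) (Fin d₂) Bool) (C : Matrix (Fin d₁) (Fin d₂) Bool)
    (π : Equiv.Perm (Fin d₃)) (W : Matrix (Fin d₁) (Fin d₂) (Option (Fin d₃)))
    {i : Fin d₁} {j : Fin d₂} {k : Fin d₃} (hk : A i k = true ∧ B k j = true)
    (hC : C i j = true) (l : List (Fin d₁ × Fin d₂)) (h : W i j ≠ none ∨ (i, j) ∈ l) :
    l.foldl (finalStep A B C π) W i j ≠ none := by
  induction l generalizing W with
  | nil => simpa using h
  | cons p l ih =>
    rw [List.foldl_cons]
    by_cases h1 : W i j ≠ none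
    · exact ih _ (Or.inl (finalStep_ne_none A B C π W p h1))
    · rcases List.mem_cons.1 (h.resolve_left h1) with rfl | h2
      · refine ih _ (Or.inl ?_)
        unfold finalStep
        rw [if_pos, setEntry_apply, if_pos ⟨rfl, rfl⟩]
        · exact searchResult_ne_none A B π i j hk
        · simpa [hC] using h1
      · exact ih _ (Or.inr h2)

end Search

end

end BoolMM

namespace BoolMM

noncomputable section

/-! # Numerical estimates -/

section Numerics

variable {b d₁ d₂ d₃ : ℕ}

theorem pow_levels_ge {a : ℝ} (ha : 0 < a) (hb : 0 < b) (hX : 1 < ψ₃ d₁ d₂ d₃) :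
    a * ψ₃ d₁ d₂ d₃ * Real.log (ψ₃ d₁ d₂ d₃) ≤ 7 ^ levels a b d₁ d₂ d₃ * (b : ℝ) ^ 3 := by
  have hL := Real.log_pos hX
  have hb' : (0 : ℝ) < b := Nat.cast_pos.2 hb
  unfold levels
  set y := a * ((b : ℝ) ^ 3)⁻¹ * ψ₃ d₁ d₂ d₃ * Real.log (ψ₃ d₁ d₂ d₃) with hy
  have hy0 : 0 < y := by positivity
  have h1 : y ≤ 7 ^ ⌈Real.logb 7 y⌉₊ := by
    rw [← Real.rpow_natCast]
    calc y = 7 ^ Real.logb 7 y := (Real.rpow_logb (by norm_num) (by norm_num) hy0).symm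
      _ ≤ _ := Real.rpow_le_rpow_of_exponent_le (by norm_num) (Nat.le_ceil _)
  calc a * ψ₃ d₁ d₂ d₃ * Real.log (ψ₃ d₁ d₂ d₃) = y * (b : ℝ) ^ 3 := by
        rw [hy]
        field_simp
    _ ≤ _ := by gcongr

/-- The hypothesis makes the logarithm nonnegative; rounding it up then costs at most a factor 7. -/
theorem pow_levels_le_of_one_le {a : ℝ} (ha : 0 < a) (hb : 0 < b) (hX : 1 < ψ₃ d₁ d₂ d₃)
    (h : (b : ℝ) ^ 3 ≤ a * ψ₃ d₁ d₂ d₃ * Real.log (ψ₃ d₁ d₂ d₃)) :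
    7 ^ levels a b d₁ d₂ d₃ * (b : ℝ) ^ 3
      ≤ 7 * (a * ψ₃ d₁ d₂ d₃ * Real.log (ψ₃ d₁ d₂ d₃)) := by
  have hL := Real.log_pos hX
  have hb' : (0 : ℝ) < b := Nat.cast_pos.2 hb
  unfold levels
  set y := a * ((b : ℝ) ^ 3)⁻¹ * ψ₃ d₁ d₂ d₃ * Real.log (ψ₃ d₁ d₂ d₃) with hy
  have hy1 : y * (b : ℝ) ^ 3 = a * ψ₃ d₁ d₂ d₃ * Real.log (ψ₃ d₁ d₂ d₃) := by
    rw [hy]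
    field_simp
  have hy0 : 1 ≤ y := by
    rw [← hy1] at h
    exact le_of_mul_le_mul_right (by linarith) (by positivity : (0 : ℝ) < b ^ 3)
  have h1 : (7 : ℝ) ^ ⌈Real.logb 7 y⌉₊ ≤ 7 * y := by
    rw [← Real.rpow_natCast]
    calc (7 : ℝ) ^ ((⌈Real.logb 7 y⌉₊ : ℕ) : ℝ) ≤ 7 ^ (Real.logb 7 y + 1) :=
          Real.rpow_le_rpow_of_exponent_le (by norm_num)
            (Nat.ceil_lt_add_one (Real.logb_nonneg (by norm_num) hy0)).le
      _ = 7 * y := by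
          rw [Real.rpow_add (by norm_num), Real.rpow_one,
            Real.rpow_logb (by norm_num) (by norm_num) (by linarith), mul_comm]
  calc _ ≤ 7 * y * (b : ℝ) ^ 3 := by gcongr
    _ = _ := by rw [mul_assoc, hy1]

theorem pow_levels_le {a : ℝ} (ha : 0 < a) (hb : 0 < b)
    (hL : 1 ≤ Real.log (ψ₃ d₁ d₂ d₃)) (hX : 1 < ψ₃ d₁ d₂ d₃) :
    7 ^ levels a b d₁ d₂ d₃
      ≤ (1 + 7 * a) * (ψ₃ d₁ d₂ d₃ * Real.log (ψ₃ d₁ d₂ d₃)) := by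
  have hb' : (1 : ℝ) ≤ b := Nat.one_le_cast.2 hb
  have hb3 : (1 : ℝ) ≤ (b : ℝ) ^ 3 := one_le_pow₀ hb'
  have hXL : 1 ≤ ψ₃ d₁ d₂ d₃ * Real.log (ψ₃ d₁ d₂ d₃) := by nlinarith
  by_cases h : (b : ℝ) ^ 3 ≤ a * ψ₃ d₁ d₂ d₃ * Real.log (ψ₃ d₁ d₂ d₃)
  · have := pow_levels_le_of_one_le ha hb hX h
    have h7 : (0 : ℝ) < 7 ^ levels a b d₁ d₂ d₃ := by positivity
    nlinarith
  · have h0 : levels a b d₁ d₂ d₃ = 0 := by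
      unfold levels
      rw [Nat.ceil_eq_zero]
      refine Real.logb_nonpos (by norm_num) (by positivity) ?_
      rw [show a * ((b : ℝ) ^ 3)⁻¹ * ψ₃ d₁ d₂ d₃ * Real.log (ψ₃ d₁ d₂ d₃)
        = a * ψ₃ d₁ d₂ d₃ * Real.log (ψ₃ d₁ d₂ d₃) / (b : ℝ) ^ 3 by field_simp,
        div_le_one (by positivity)]
      linarith
    rw [h0, pow_zero]
    nlinarith

/-- The bound for the overlap of the triples when each entry has one witness. -/
def pairBound (s b d₁ d₂ d₃ : ℕ) : ℝ :=
  (25 ^ s * (b : ℝ) ^ 5 * ψ₁ d₁ d₂ d₃ + 13 ^ s * (b : ℝ) ^ 4 * ψ₂ d₁ d₂ d₃) / ψ₃ d₁ d₂ d₃ ^ 2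

theorem hitOverlap_mono {s : ℕ} {p q q' r : ℝ} (hp : 0 ≤ p) (hq : 0 ≤ q) (hqq : q ≤ q')
    (hr : 0 ≤ r) : hitOverlap s b p q r ≤ hitOverlap s b p q' r := by
  unfold hitOverlap
  gcongr

/-- Each term contains the third density to the first or second power, and w ≤ w^2. The denominators
combine into ψ₁/ψ₃² and ψ₂/ψ₃². -/
theorem hitOverlap_le {s w : ℕ} (hd₁ : 0 < d₁) (hd₂ : 0 < d₂) (hd₃ : 0 < d₃) (hw : 1 ≤ w) :
    hitOverlap s b (1 / d₁) (1 / d₂) (w / d₃) ≤ (w : ℝ) ^ 2 * pairBound s b d₁ d₂ d₃ := by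
  have h₁ : (0 : ℝ) < d₁ := Nat.cast_pos.2 hd₁
  have h₂ : (0 : ℝ) < d₂ := Nat.cast_pos.2 hd₂
  have h₃ : (0 : ℝ) < d₃ := Nat.cast_pos.2 hd₃
  have hw' : (1 : ℝ) ≤ w := Nat.one_le_cast.2 hw
  have hww : (w : ℝ) ≤ (w : ℝ) ^ 2 := by nlinarith
  have e : (w : ℝ) ^ 2 * pairBound s b d₁ d₂ d₃
      = 25 ^ s * (b : ℝ) ^ 5 * ((w : ℝ) ^ 2 * ψ₁ d₁ d₂ d₃ / ψ₃ d₁ d₂ d₃ ^ 2)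
        + 13 ^ s * (b : ℝ) ^ 4 * ((w : ℝ) ^ 2 * ψ₂ d₁ d₂ d₃ / ψ₃ d₁ d₂ d₃ ^ 2) := by
    unfold pairBound
    ring
  rw [e]
  unfold hitOverlap ψ₁ ψ₂ ψ₃
  gcongr
  · rw [show (1 / (d₁ : ℝ) * (1 / d₂) ^ 2 * (w / d₃) ^ 2 + (1 / d₁) ^ 2 * (1 / d₂) * (w / d₃) ^ 2
      + (1 / d₁) ^ 2 * (1 / d₂) ^ 2 * (w / d₃))
      = ((w : ℝ) ^ 2 * d₁ + (w : ℝ) ^ 2 * d₂ + w * d₃) / (d₁ * d₂ * d₃) ^ 2 by field_simp]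
    gcongr
    nlinarith [mul_le_mul_of_nonneg_right hww h₃.le]
  · rw [show (1 / (d₁ : ℝ) * (1 / d₂) * (w / d₃) ^ 2 + 1 / d₁ * (1 / d₂) ^ 2 * (w / d₃)
      + (1 / d₁) ^ 2 * (1 / d₂) * (w / d₃))
      = ((w : ℝ) ^ 2 * (d₁ * d₂) + w * (d₁ * d₃) + w * (d₂ * d₃)) / (d₁ * d₂ * d₃) ^ 2 by
        field_simp]
    gcongr
    nlinarith [mul_le_mul_of_nonneg_right hww (mul_pos h₁ h₃).le,
      mul_le_mul_of_nonneg_right hww (mul_pos h₂ h₃).le]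

theorem twoHits_bound_le {s w : ℕ} (hd₁ : 0 < d₁) (hd₂ : 0 < d₂) (hd₃ : 0 < d₃) (hw : 1 ≤ w) :
    13 ^ s * (b : ℝ) ^ 4 * (1 / d₁ * (1 / d₂) * (w / d₃) ^ 2)
      ≤ (w : ℝ) ^ 2 * pairBound s b d₁ d₂ d₃ := by
  refine le_trans ?_ (hitOverlap_le hd₁ hd₂ hd₃ hw)
  unfold hitOverlap
  have h1 : (0 : ℝ) ≤ 25 ^ s * (b : ℝ) ^ 5 * (1 / d₁ * (1 / d₂) ^ 2 * (w / d₃) ^ 2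
    + (1 / d₁) ^ 2 * (1 / d₂) * (w / d₃) ^ 2 + (1 / d₁) ^ 2 * (1 / d₂) ^ 2 * (w / d₃)) := by
    positivity
  have h2 : (0 : ℝ) ≤ 13 ^ s * (b : ℝ) ^ 4 * (1 / d₁ * (1 / d₂) ^ 2 * (w / d₃)
    + (1 / d₁) ^ 2 * (1 / d₂) * (w / d₃)) := by positivity
  linarith

/-- The overlap of the triples is negligible. -/
theorem exists_pairBound_le (b : ℕ) (C : ℝ) (hC : 1 ≤ C) :
    ∃ M : ℝ, 0 < M ∧ ∀ (s d₁ d₂ d₃ : ℕ), 1 ≤ Real.log (ψ₃ d₁ d₂ d₃) → 1 < ψ₃ d₁ d₂ d₃ →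
      ψ₁ d₁ d₂ d₃ ≤ ψ₃ d₁ d₂ d₃ ^ (0.345 : ℝ) → ψ₂ d₁ d₂ d₃ ≤ ψ₃ d₁ d₂ d₃ ^ (0.681 : ℝ) →
      7 ^ s ≤ C * (ψ₃ d₁ d₂ d₃ * Real.log (ψ₃ d₁ d₂ d₃)) →
      pairBound s b d₁ d₂ d₃ ≤ M * ψ₃ d₁ d₂ d₃ ^ (-(0.0003 : ℝ)) := by
  refine ⟨((b : ℝ) ^ 5 + (b : ℝ) ^ 4 + 1) * C ^ 2 * 20000 ^ 2, by positivity, ?_⟩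
  intro s d₁ d₂ d₃ hL hX h1 h2 hs
  set X := ψ₃ d₁ d₂ d₃
  set L := Real.log X
  have hX0 : 0 < X := by linarith
  have hCL : 1 ≤ C * L := by nlinarith
  have hCXL : 0 ≤ C * (X * L) := by positivity
  -- If g ≤ 7^(m/n), then g^s is at most (7^s)^(m/n). The exponent m/n ≤ 2 is used only to replace
  -- the power of C L by its square.
  have hpow : ∀ (g : ℝ) (m n : ℕ), 0 < g → 0 < n → g ^ n ≤ 7 ^ m → (m : ℝ) / n ≤ 2 →
      g ^ s ≤ (C * L) ^ 2 * X ^ ((m : ℝ) / n) := by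
    intro g m n hg hn hgm hmn
    have hn' : (0 : ℝ) < n := Nat.cast_pos.2 hn
    have hg7 : g ≤ (7 : ℝ) ^ ((m : ℝ) / n) := by
      have : (g ^ n) ^ ((1 : ℝ) / n) ≤ ((7 : ℝ) ^ m) ^ ((1 : ℝ) / n) :=
        Real.rpow_le_rpow (by positivity) hgm (by positivity)
      rw [← Real.rpow_natCast, ← Real.rpow_natCast, ← Real.rpow_mul hg.le,
        ← Real.rpow_mul (by norm_num), mul_one_div_cancel hn'.ne', Real.rpow_one] at this
      rwa [mul_one_div] at this
    calc g ^ s ≤ ((7 : ℝ) ^ ((m : ℝ) / n)) ^ s := by gcongr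
      _ = ((7 : ℝ) ^ s) ^ ((m : ℝ) / n) := by
          rw [← Real.rpow_natCast, ← Real.rpow_mul (by norm_num), mul_comm,
            Real.rpow_mul (by norm_num), Real.rpow_natCast]
      _ ≤ (C * (X * L)) ^ ((m : ℝ) / n) := Real.rpow_le_rpow (by positivity) hs (by positivity)
      _ = (C * L) ^ ((m : ℝ) / n) * X ^ ((m : ℝ) / n) := by
          rw [← Real.mul_rpow (by positivity) hX0.le]
          ring_nf
      _ ≤ (C * L) ^ (2 : ℝ) * X ^ ((m : ℝ) / n) := by
          gcongr
      _ = _ := by rw [Real.rpow_two]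
  -- Rational bounds slightly above log 25 / log 7 and log 13 / log 7: 91/55 + 0.345 and 29/22 +
  -- 0.681 both stay below 2 - 0.0004.
  have h25 := hpow 25 91 55 (by norm_num) (by norm_num) (by norm_num) (by norm_num)
  have h13 := hpow 13 29 22 (by norm_num) (by norm_num) (by norm_num) (by norm_num)
  -- The squared logarithm costs the exponent 0.0001, which turns -0.0004 into -0.0003.
  have hL2 : L ^ 2 ≤ 20000 ^ 2 * X ^ (0.0001 : ℝ) := by
    have h := Real.log_le_rpow_div hX0.le (by norm_num : (0 : ℝ) < 0.00005)
    calc L ^ 2 ≤ (X ^ (0.00005 : ℝ) / 0.00005) ^ 2 := by gcongr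
      _ = 20000 ^ 2 * (X ^ (0.00005 : ℝ)) ^ 2 := by ring
      _ = _ := by
          rw [← Real.rpow_natCast (X ^ (0.00005 : ℝ)), ← Real.rpow_mul hX0.le]
          norm_num
  have hexp : ∀ u v : ℝ, u + v ≤ 2 - 0.0004 → X ^ u * X ^ v ≤ X ^ (-(0.0004 : ℝ)) * X ^ 2 := by
    intro u v huv
    rw [← Real.rpow_add hX0, ← Real.rpow_natCast X 2, ← Real.rpow_add hX0]
    refine Real.rpow_le_rpow_of_exponent_le hX.le ?_
    push_cast
    linarith
  have hΨ1 : 0 ≤ ψ₁ d₁ d₂ d₃ := by unfold ψ₁; positivity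
  have hΨ2 : 0 ≤ ψ₂ d₁ d₂ d₃ := by unfold ψ₂; positivity
  unfold pairBound
  rw [div_le_iff₀ (by positivity)]
  calc _ ≤ (C * L) ^ 2 * X ^ (((91 : ℕ) : ℝ) / (55 : ℕ)) * (b : ℝ) ^ 5 * X ^ (0.345 : ℝ)
        + (C * L) ^ 2 * X ^ (((29 : ℕ) : ℝ) / (22 : ℕ)) * (b : ℝ) ^ 4 * X ^ (0.681 : ℝ) := by
        gcongr
    _ = (C * L) ^ 2 * (b : ℝ) ^ 5 * (X ^ (((91 : ℕ) : ℝ) / (55 : ℕ)) * X ^ (0.345 : ℝ))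
        + (C * L) ^ 2 * (b : ℝ) ^ 4 * (X ^ (((29 : ℕ) : ℝ) / (22 : ℕ)) * X ^ (0.681 : ℝ)) := by
        ring
    _ ≤ (C * L) ^ 2 * (b : ℝ) ^ 5 * (X ^ (-(0.0004 : ℝ)) * X ^ 2)
        + (C * L) ^ 2 * (b : ℝ) ^ 4 * (X ^ (-(0.0004 : ℝ)) * X ^ 2) := by
        refine add_le_add (mul_le_mul_of_nonneg_left (hexp _ _ (by norm_num)) (by positivity))
          (mul_le_mul_of_nonneg_left (hexp _ _ (by norm_num)) (by positivity))
    _ = ((b : ℝ) ^ 5 + (b : ℝ) ^ 4) * C ^ 2 * L ^ 2 * X ^ (-(0.0004 : ℝ)) * X ^ 2 := by ring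
    _ ≤ ((b : ℝ) ^ 5 + (b : ℝ) ^ 4 + 1) * C ^ 2 * (20000 ^ 2 * X ^ (0.0001 : ℝ))
          * X ^ (-(0.0004 : ℝ)) * X ^ 2 := by
        have : (b : ℝ) ^ 5 + (b : ℝ) ^ 4 ≤ (b : ℝ) ^ 5 + (b : ℝ) ^ 4 + 1 := by linarith
        gcongr ?_ * _ * ?_ * _ * _
    _ = ((b : ℝ) ^ 5 + (b : ℝ) ^ 4 + 1) * C ^ 2 * 20000 ^ 2
          * (X ^ (0.0001 : ℝ) * X ^ (-(0.0004 : ℝ))) * X ^ 2 := by ring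
    _ = _ := by
        rw [← Real.rpow_add hX0, show (0.0001 : ℝ) + -0.0004 = -0.0003 by norm_num]

/-- After factoring out exp(-μ), the claim becomes exp Δ + exp μ · Δ ≤ exp(μ/4)^2. The left side is
at most exp(μ/4) + μ/4 ≤ 2 exp(μ/4) - 1. -/
theorem exp_add_le {μ Δ : ℝ} (hμ : 0 ≤ μ) (hΔ : Δ ≤ μ / 4) (h : Real.exp μ * Δ ≤ μ / 4) :
    Real.exp (-μ + Δ) + Δ ≤ Real.exp (-(μ / 2)) := by
  have e1 : Real.exp (-(μ / 2)) = Real.exp (-μ) * (Real.exp (μ / 4) * Real.exp (μ / 4)) := by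
    rw [← Real.exp_add, ← Real.exp_add]
    ring_nf
  have e2 : Real.exp (-μ + Δ) + Δ = Real.exp (-μ) * (Real.exp Δ + Real.exp μ * Δ) := by
    rw [mul_add, ← Real.exp_add, ← mul_assoc, ← Real.exp_add]
    simp
  rw [e1, e2]
  refine mul_le_mul_of_nonneg_left ?_ (Real.exp_nonneg _)
  have h1 : Real.exp Δ ≤ Real.exp (μ / 4) := Real.exp_le_exp.2 hΔ
  have h2 := Real.add_one_le_exp (μ / 4)
  have h3 : 1 ≤ Real.exp (μ / 4) := Real.one_le_exp (by linarith)
  nlinarith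

theorem missBound_nonneg (s b d₁ d₂ d₃ w : ℕ) : 0 ≤ missBound s b d₁ d₂ d₃ w := by
  unfold missBound
  positivity

/-- At a suitable level, the trials are likely to find a witness for an entry that has `w`
witnesses. -/
theorem exists_missBound_pow_le (b : ℕ) (hb : 0 < b) :
    ∃ K : ℝ, 0 < K ∧ ∀ (d₁ d₂ d₃ w : ℕ), 0 < d₁ → 0 < d₂ → 0 < d₃ → 1 ≤ w →
      1 ≤ Real.log (ψ₃ d₁ d₂ d₃) → 1 < ψ₃ d₁ d₂ d₃ →
      ψ₁ d₁ d₂ d₃ ≤ ψ₃ d₁ d₂ d₃ ^ (0.345 : ℝ) → ψ₂ d₁ d₂ d₃ ≤ ψ₃ d₁ d₂ d₃ ^ (0.681 : ℝ) →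
      1 ≤ K * (w * ψ₃ d₁ d₂ d₃ ^ (-(0.08 : ℝ))) ∨
      ∃ s ≤ levels 1 b d₁ d₂ d₃,
        missBound s b d₁ d₂ d₃ w ^ (20 * 4 ^ (levels 1 b d₁ d₂ d₃ - s))
          ≤ K * (w * ψ₃ d₁ d₂ d₃ ^ (-(0.08 : ℝ))) := by
  obtain ⟨M, hM, hpair⟩ := exists_pairBound_le b 8 (by norm_num)
  -- The first summand guarantees that the chosen level is not below 0; the second makes M
  -- X^(-0.0002) at most 1/4.
  set X₀ : ℝ := (12 * 7 ^ 6 * (b : ℝ) ^ 3) ^ 2 + (4 * M) ^ 5000 with hX₀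
  have hb' : (1 : ℝ) ≤ b := Nat.one_le_cast.2 hb
  have hb3 : (1 : ℝ) ≤ (b : ℝ) ^ 3 := one_le_pow₀ hb'
  have hX₀1 : (12 * 7 ^ 6 * (b : ℝ) ^ 3) ^ 2 ≤ X₀ := le_add_of_nonneg_right (by positivity)
  have hX₀2 : (4 * M) ^ 5000 ≤ X₀ := le_add_of_nonneg_left (by positivity)
  have hX₀3 : 1 ≤ X₀ := le_trans (one_le_pow₀ (by nlinarith)) hX₀1
  have hX₀4 : (b : ℝ) ^ 3 ≤ X₀ := le_trans (by nlinarith) hX₀1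
  refine ⟨X₀, by linarith, ?_⟩
  intro d₁ d₂ d₃ w hd₁ hd₂ hd₃ hw hL hX h1 h2
  have hup' := pow_levels_le_of_one_le (b := b) (d₁ := d₁) (d₂ := d₂) (d₃ := d₃) one_pos hb hX
  have hlow := pow_levels_ge (b := b) (d₁ := d₁) (d₂ := d₂) (d₃ := d₃) one_pos hb hX
  have hlev := pow_levels_le (b := b) (d₁ := d₁) (d₂ := d₂) (d₃ := d₃) one_pos hb hL hX
  have hP := hpair (levels 1 b d₁ d₂ d₃) d₁ d₂ d₃ hL hX h1 h2 (by convert hlev using 2; norm_num)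
  set n := levels 1 b d₁ d₂ d₃ with hn
  have hXdef : ψ₃ d₁ d₂ d₃ = d₁ * d₂ * d₃ := rfl
  set X := ψ₃ d₁ d₂ d₃ with hXX
  set L := Real.log X
  have hX0 : 0 < X := by linarith
  have hw' : (1 : ℝ) ≤ w := Nat.one_le_cast.2 hw
  -- An entry with so many witnesses needs no trials, since the bound to be proved exceeds 1. From
  -- here on w is below X^0.08.
  by_cases htriv : 1 ≤ X₀ * (w * X ^ (-(0.08 : ℝ)))
  · exact Or.inl htriv
  right
  have hX08 : X ^ (-(0.08 : ℝ)) = (X ^ (0.08 : ℝ))⁻¹ := Real.rpow_neg hX0.le _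
  have hlt : X₀ * w < X ^ (0.08 : ℝ) := by
    rw [not_le, hX08, ← mul_assoc, ← div_eq_mul_inv, div_lt_one (by positivity)] at htriv
    exact htriv
  have hX₀X : X₀ ≤ X := by
    calc X₀ ≤ X₀ * w := le_mul_of_one_le_right (by linarith) hw'
      _ ≤ X ^ (0.08 : ℝ) := hlt.le
      _ ≤ X ^ (1 : ℝ) := Real.rpow_le_rpow_of_exponent_le hX.le (by norm_num)
      _ = X := Real.rpow_one X
  have hwX : (w : ℝ) ≤ X ^ (0.08 : ℝ) := (le_mul_of_one_le_left (by linarith) hX₀3).trans hlt.le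
  -- The base 13/7 is the ratio of the rates at which Δ and μ decrease from level to level. The
  -- power is taken above w, but within a factor 13/7 of it.
  obtain ⟨m, hm1, hm2⟩ := exists_nat_pow_near hw' (by norm_num : (1 : ℝ) < 13 / 7)
  set t' := m + 1 with ht'
  have ht1 : (w : ℝ) ≤ (13 / 7) ^ t' := hm2.le
  have ht2 : (13 / 7 : ℝ) ^ t' ≤ 13 / 7 * w := by
    rw [ht', pow_succ']
    gcongr
  -- The six extra levels make μ at most 0.0001 L, so that exp μ costs only the factor X^0.0001.
  set t := 6 + t' with ht
  -- the chosen level exists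
  have htn : t ≤ n := by
    -- Since 7 ≤ (13/7)^4, the power is of order w^4 at most, hence at most 12 X^0.32.
    have h7 : (7 : ℝ) ^ t' ≤ 12 * X ^ (0.32 : ℝ) := by
      calc (7 : ℝ) ^ t' ≤ ((13 / 7 : ℝ) ^ 4) ^ t' := by
            gcongr
            norm_num
        _ = ((13 / 7 : ℝ) ^ t') ^ 4 := by rw [← pow_mul, ← pow_mul, mul_comm]
        _ ≤ (13 / 7 * w) ^ 4 := by gcongr
        _ ≤ (13 / 7 * X ^ (0.08 : ℝ)) ^ 4 := by gcongr
        _ = (13 / 7) ^ 4 * (X ^ (0.08 : ℝ)) ^ 4 := mul_pow _ _ _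
        _ ≤ 12 * (X ^ (0.08 : ℝ)) ^ 4 := by
            gcongr
            norm_num
        _ = 12 * X ^ (0.32 : ℝ) := by
            rw [← Real.rpow_natCast (X ^ (0.08 : ℝ)), ← Real.rpow_mul hX0.le]
            norm_num
    have hsq : 12 * 7 ^ 6 * (b : ℝ) ^ 3 ≤ X ^ (0.5 : ℝ) := by
      rw [show (0.5 : ℝ) = 1 / 2 by norm_num, ← Real.sqrt_eq_rpow]
      exact Real.le_sqrt_of_sq_le (hX₀1.trans hX₀X)
    have h7t : (7 : ℝ) ^ t * (b : ℝ) ^ 3 ≤ 7 ^ n * (b : ℝ) ^ 3 := by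
      calc (7 : ℝ) ^ t * (b : ℝ) ^ 3 = 7 ^ 6 * (b : ℝ) ^ 3 * 7 ^ t' := by
            rw [ht, pow_add]
            ring
        _ ≤ 7 ^ 6 * (b : ℝ) ^ 3 * (12 * X ^ (0.32 : ℝ)) := by gcongr
        _ = 12 * 7 ^ 6 * (b : ℝ) ^ 3 * X ^ (0.32 : ℝ) := by ring
        _ ≤ X ^ (0.5 : ℝ) * X ^ (0.32 : ℝ) := by gcongr
        _ ≤ X ^ (1 : ℝ) := by
            rw [← Real.rpow_add hX0]
            exact Real.rpow_le_rpow_of_exponent_le hX.le (by norm_num)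
        _ ≤ 1 * X * L := by
            rw [Real.rpow_one, one_mul]
            exact le_mul_of_one_le_right hX0.le hL
        _ ≤ _ := hlow
    have := le_of_mul_le_mul_right h7t (by positivity)
    exact (pow_le_pow_iff_right₀ (by norm_num : (1 : ℝ) < 7)).1 this
  refine ⟨n - t, Nat.sub_le _ _, ?_⟩
  rw [Nat.sub_sub_self htn]
  set s := n - t with hs
  have hpows : ∀ g : ℝ, g ^ s * g ^ t = g ^ n := fun g => by
    rw [← pow_add, hs, Nat.sub_add_cancel htn]
  -- the expected number of hits
  set μ : ℝ := 7 ^ s * (b : ℝ) ^ 3 * (w / X) with hμ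
  have hμt : μ * 7 ^ t = 7 ^ n * (b : ℝ) ^ 3 * (w / X) := by
    rw [hμ, ← hpows 7]
    ring
  have hμlow : w * L / 7 ^ t ≤ μ := by
    rw [div_le_iff₀ (by positivity), hμt]
    calc w * L = (1 * X * L) * (w / X) := by field_simp
      _ ≤ _ := by gcongr
  have hμup : μ ≤ 7 * (w * L / 7 ^ t) := by
    rw [← mul_div_assoc, le_div_iff₀ (by positivity), hμt]
    have := hup' (by
      rw [one_mul]
      calc (b : ℝ) ^ 3 ≤ X := hX₀4.trans hX₀X
        _ ≤ X * L := le_mul_of_one_le_right hX0.le hL)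
    calc _ ≤ 7 * (1 * X * L) * (w / X) := by gcongr
      _ = _ := by field_simp
  have hμ0 : 0 ≤ μ := by positivity
  have hw7 : (w : ℝ) ≤ 7 ^ t' := ht1.trans (by gcongr; norm_num)
  have hμL : μ ≤ 0.0001 * L := by
    refine hμup.trans ?_
    have : w * L / 7 ^ t ≤ L / 7 ^ 6 := by
      rw [ht, pow_add, div_le_div_iff₀ (by positivity) (by positivity)]
      have := mul_le_mul_of_nonneg_right hw7 (by positivity : 0 ≤ L * 7 ^ 6)
      linarith
    have h7 : L / 7 ^ 6 ≤ 0.00001 * L := by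
      rw [div_le_iff₀ (by positivity)]
      nlinarith
    linarith
  -- the overlap
  set Δ : ℝ := (w : ℝ) ^ 2 * pairBound s b d₁ d₂ d₃ with hΔ
  have hΨ1 : 0 ≤ ψ₁ d₁ d₂ d₃ := by unfold ψ₁; positivity
  have hΨ2 : 0 ≤ ψ₂ d₁ d₂ d₃ := by unfold ψ₂; positivity
  have hpb : 13 ^ t * pairBound s b d₁ d₂ d₃ ≤ pairBound n b d₁ d₂ d₃ := by
    unfold pairBound
    rw [← mul_div_assoc, mul_add]
    refine div_le_div_of_nonneg_right (add_le_add ?_ ?_) (by positivity)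
    · calc 13 ^ t * (25 ^ s * (b : ℝ) ^ 5 * ψ₁ d₁ d₂ d₃)
          ≤ 25 ^ t * (25 ^ s * (b : ℝ) ^ 5 * ψ₁ d₁ d₂ d₃) := by
            have : (13 : ℝ) ^ t ≤ 25 ^ t := pow_le_pow_left₀ (by norm_num) (by norm_num) _
            gcongr
        _ = 25 ^ n * (b : ℝ) ^ 5 * ψ₁ d₁ d₂ d₃ := by
            rw [← hpows 25]
            ring
    · rw [← hpows 13]
      exact le_of_eq (by ring)
  have hwt : (w : ℝ) * 7 ^ t ≤ 13 ^ t := by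
    have : (w : ℝ) ≤ (13 / 7) ^ t :=
      ht1.trans (pow_le_pow_right₀ (by norm_num) (by omega))
    rwa [div_pow, le_div_iff₀ (by positivity)] at this
  have hpb0 : 0 ≤ pairBound s b d₁ d₂ d₃ := by
    unfold pairBound
    positivity
  -- One factor w with 7^t is absorbed by 13^t, which lifts the bound to the top level; the
  -- remaining w / 7^t is at most μ because L ≥ 1.
  have hΔ1 : Δ ≤ μ * (M * X ^ (-(0.0003 : ℝ))) := by
    have hwL : w / 7 ^ t ≤ μ := by
      refine le_trans ?_ hμlow
      gcongr
      exact le_mul_of_one_le_right (by positivity) hL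
    calc Δ = w / 7 ^ t * ((w * 7 ^ t) * pairBound s b d₁ d₂ d₃) := by
          rw [hΔ]
          field_simp
      _ ≤ w / 7 ^ t * (13 ^ t * pairBound s b d₁ d₂ d₃) := by gcongr
      _ ≤ w / 7 ^ t * (M * X ^ (-(0.0003 : ℝ))) :=
          mul_le_mul_of_nonneg_left (hpb.trans hP) (by positivity)
      _ ≤ _ := by gcongr
  have hexpμ : Real.exp μ ≤ X ^ (0.0001 : ℝ) := by
    rw [Real.rpow_def_of_pos hX0]
    exact Real.exp_le_exp.2 (by linarith)
  have hsmall : X ^ (0.0001 : ℝ) * (M * X ^ (-(0.0003 : ℝ))) ≤ 1 / 4 := by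
    have h4 : 4 * M ≤ X ^ (0.0002 : ℝ) := by
      calc 4 * M = ((4 * M) ^ 5000) ^ (0.0002 : ℝ) := by
            rw [← Real.rpow_natCast, ← Real.rpow_mul (by positivity)]
            norm_num
        _ ≤ X ^ (0.0002 : ℝ) :=
            Real.rpow_le_rpow (by positivity) (hX₀2.trans hX₀X) (by norm_num)
    calc X ^ (0.0001 : ℝ) * (M * X ^ (-(0.0003 : ℝ)))
        = M * (X ^ (0.0001 : ℝ) * X ^ (-(0.0003 : ℝ))) := by ring
      _ = M * (X ^ (0.0002 : ℝ))⁻¹ := by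
          rw [← Real.rpow_add hX0, ← Real.rpow_neg hX0.le]
          norm_num
      _ ≤ 1 / 4 := by
          rw [← div_eq_mul_inv, div_le_iff₀ (by positivity)]
          linarith
  have hexpΔ : Real.exp μ * Δ ≤ μ / 4 := by
    calc Real.exp μ * Δ ≤ X ^ (0.0001 : ℝ) * (μ * (M * X ^ (-(0.0003 : ℝ)))) := by gcongr
      _ = μ * (X ^ (0.0001 : ℝ) * (M * X ^ (-(0.0003 : ℝ)))) := by ring
      _ ≤ μ * (1 / 4) := by gcongr
      _ = μ / 4 := by ring
  have hΔ0 : 0 ≤ Δ := by positivity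
  have hΔ4 : Δ ≤ μ / 4 :=
    (le_mul_of_one_le_left hΔ0 (Real.one_le_exp hμ0)).trans hexpΔ
  have hmiss : missBound s b d₁ d₂ d₃ w ≤ Real.exp (-(μ / 2)) := by
    refine le_trans ?_ (exp_add_le hμ0 hΔ4 hexpΔ)
    unfold missBound
    refine add_le_add (Real.exp_le_exp.2 (add_le_add (le_of_eq ?_)
      (hitOverlap_le hd₁ hd₂ hd₃ hw))) (twoHits_bound_le hd₁ hd₂ hd₃ hw)
    rw [hμ, hXdef]
    have h₁ : (0 : ℝ) < d₁ := Nat.cast_pos.2 hd₁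
    have h₂ : (0 : ℝ) < d₂ := Nat.cast_pos.2 hd₂
    have h₃ : (0 : ℝ) < d₃ := Nat.cast_pos.2 hd₃
    field_simp
  -- The 20 · 4^t trials together have exponent 10 · 4^t μ. Since (7/4)^t' ≤ (13/7)^t' ≤ (13/7) w,
  -- this is at least 10 (4/7)^6 (7/13) L, which exceeds 0.18 L.
  have hfinal : 0.08 * L ≤ 10 * 4 ^ t * μ := by
    have h74 : (7 / 4 : ℝ) ^ t' ≤ 13 / 7 * w :=
      le_trans (pow_le_pow_left₀ (by norm_num) (by norm_num) _) ht2
    have h47 : 7 / 13 * (7 : ℝ) ^ t' ≤ w * 4 ^ t' := by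
      rw [div_pow, div_le_iff₀ (by positivity)] at h74
      linarith
    calc 0.08 * L ≤ 10 * (4 / 7) ^ 6 * (7 / 13) * L := by
          gcongr
          norm_num
      _ = 10 * (4 / 7) ^ 6 * (7 / 13 * (7 : ℝ) ^ t') * L / 7 ^ t' := by field_simp
      _ ≤ 10 * (4 / 7) ^ 6 * (w * 4 ^ t') * L / 7 ^ t' := by gcongr
      _ = 10 * 4 ^ t * (w * L / 7 ^ t) := by
          rw [ht, pow_add 4, pow_add 7, div_pow]
          field_simp
          rw [pow_add, pow_add, ht']
          ring
      _ ≤ _ := by gcongr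
  calc missBound s b d₁ d₂ d₃ w ^ (20 * 4 ^ t) ≤ Real.exp (-(μ / 2)) ^ (20 * 4 ^ t) :=
        pow_le_pow_left₀ (missBound_nonneg _ _ _ _ _ _) hmiss _
    _ = Real.exp (-(10 * 4 ^ t * μ)) := by
        rw [← Real.exp_nat_mul]
        push_cast
        ring_nf
    _ ≤ Real.exp (-(0.08 * L)) := Real.exp_le_exp.2 (by linarith)
    _ = 1 * (1 * X ^ (-(0.08 : ℝ))) := by
        rw [one_mul, one_mul, Real.rpow_def_of_pos hX0]
        congr 1
        ring
    _ ≤ _ := by gcongr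

end Numerics

end

end BoolMM

namespace BoolMM

noncomputable section

open Comp

/-! # The algorithm -/

section Main

variable {d₁ d₂ d₃ : ℕ}

/-- The witnesses for the entry `i, j`. -/
def witnesses (A : Matrix (Fin d₁) (Fin d₃) Bool) (B : Matrix (Fin d₃) (Fin d₂) Bool)
    (i : Fin d₁) (j : Fin d₂) : Finset (Fin d₃) :=
  Finset.univ.filter fun k => A i k = true ∧ B k j = true

theorem mem_witnesses {A : Matrix (Fin d₁) (Fin d₃) Bool} {B : Matrix (Fin d₃) (Fin d₂) Bool}
    {i : Fin d₁} {j : Fin d₂} (k : Fin d₃) :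
    k ∈ witnesses A B i j ↔ A i k = true ∧ B k j = true := by
  simp [witnesses]

/-- The last loop. -/
def finalLoop (A : Matrix (Fin d₁) (Fin d₃) Bool) (B : Matrix (Fin d₃) (Fin d₂) Bool)
    (C : Matrix (Fin d₁) (Fin d₂) Bool) (π : Equiv.Perm (Fin d₃))
    (W : Matrix (Fin d₁) (Fin d₂) (Option (Fin d₃))) :
    Comp (Matrix (Fin d₁) (Fin d₂) (Option (Fin d₃))) :=
  forEach (allPairs (Fin d₁) (Fin d₂)) W fun W p => do
    let u ← op (C p.1 p.2)
    let w ← op (W p.1 p.2)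
    if u && w.isNone then do
      let r ← search A B π p.1 p.2 (List.finRange d₃)
      op (setEntry W p.1 p.2 r)
    else pure W

theorem isDet_finalLoop (A : Matrix (Fin d₁) (Fin d₃) Bool) (B : Matrix (Fin d₃) (Fin d₂) Bool)
    (C : Matrix (Fin d₁) (Fin d₂) Bool) (π : Equiv.Perm (Fin d₃))
    (W : Matrix (Fin d₁) (Fin d₂) (Option (Fin d₃))) :
    IsDet (finalLoop A B C π W) ((allPairs (Fin d₁) (Fin d₂)).foldl (finalStep A B C π) W)
      (∑ p : Fin d₁ × Fin d₂, (3 + if (C p.1 p.2 && (W p.1 p.2).isNone) = true then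
        4 * (waiting (witnesses A B p.1 p.2) π + 1) + 1 else 0)) := by
  have h := isDet_final A B C π W (fun p => waiting (witnesses A B p.1 p.2) π)
    (fun p => length_takeWhile_le_waiting A B π p.1 p.2 _ mem_witnesses)
    (allPairs (Fin d₁) (Fin d₂)) nodup_allPairs
  rwa [allPairs, Finset.sum_map_toList] at h

variable [NeZero d₁] [NeZero d₂] [NeZero d₃]

/-- The witness trials at the levels `0, …, n`. -/
def trials (n b : ℕ) (A : Matrix (Fin d₁) (Fin d₃) Bool) (B : Matrix (Fin d₃) (Fin d₂) Bool)
    (W : Matrix (Fin d₁) (Fin d₂) (Option (Fin d₃))) :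
    Comp (Matrix (Fin d₁) (Fin d₂) (Option (Fin d₃))) :=
  forEach (List.range (n + 1)) W fun W s =>
    forEach (List.range (20 * 4 ^ (n - s))) W fun W _ => witnessTrial s b A B W

/-- The part of the algorithm that follows the estimate of the Boolean product. -/
def fillIn (n b : ℕ) (A : Matrix (Fin d₁) (Fin d₃) Bool) (B : Matrix (Fin d₃) (Fin d₂) Bool)
    (C : Matrix (Fin d₁) (Fin d₂) Bool) : Comp (Matrix (Fin d₁) (Fin d₂) (Option (Fin d₃))) := do
  let W₀ ← tabulate₂ fun (_ : Fin d₁) (_ : Fin d₂) => op (none : Option (Fin d₃))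
  let W₁ ← trials n b A B W₀
  let π ← shuffle d₃
  finalLoop A B C π W₁

theorem witnessProduct_eq (c : ℝ) (b : ℕ) (A : Matrix (Fin d₁) (Fin d₃) Bool)
    (B : Matrix (Fin d₃) (Fin d₂) Bool) :
    witnessProduct c b A B = (estimateProduct (levels (2 + 3 * c) b d₁ d₂ d₃) b A B >>=
      fillIn (levels 1 b d₁ d₂ d₃) b A B) := rfl

/-! ## Correctness -/

/-- These properties hold for every random choice, so after the estimate only the running time is
random in a relevant way, not correctness. -/
theorem always_fillIn (n b : ℕ) (A : Matrix (Fin d₁) (Fin d₃) Bool)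
    (B : Matrix (Fin d₃) (Fin d₂) Bool) (C : Matrix (Fin d₁) (Fin d₂) Bool) :
    Always (fillIn n b A B C) fun W => IsPartialWitness A B W ∧
      ∀ i j k, A i k = true ∧ B k j = true → C i j = true → W i j ≠ none := by
  have h0 : Always (tabulate₂ fun (_ : Fin d₁) (_ : Fin d₂) => op (none : Option (Fin d₃)))
      (IsPartialWitness A B) :=
    (isDet_tabulate₂ _ (Matrix.of fun _ _ => none) 1 fun _ _ => isDet_op _).always
      fun i j k h => by simp at h
  refine h0.bind fun W hW => Always.bind (S := IsPartialWitness A B) ?_ fun W' hW' =>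
    (always_true _).bind fun π _ => (isDet_finalLoop A B C π W').always
      ⟨foldl_finalStep_isPartialWitness A B C π hW' _, fun i j k hk hC =>
        foldl_finalStep_ne_none A B C π W' hk hC _ (Or.inr (mem_allPairs _))⟩
  exact always_forEach _ _ _ _ hW fun W s hW =>
    always_forEach _ _ _ _ hW fun W _ hW => always_witnessTrial A B W hW

/-- The result is correct unless the estimate misses an entry of the Boolean product. -/
theorem prob_witnessProduct_le (c : ℝ) (b : ℕ) (A : Matrix (Fin d₁) (Fin d₃) Bool)
    (B : Matrix (Fin d₃) (Fin d₂) Bool) (q : ℝ≥0∞)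
    (hq : ∀ i j k, A i k = true → B k j = true →
      expect (estimateProduct (levels (2 + 3 * c) b d₁ d₂ d₃) b A B)
        (fun C => if C i j = false then 1 else 0) ≤ q) :
    (witnessProduct c b A B).prob {W | ¬ IsWitnessMatrix A B W}
      ≤ ((d₁ * d₂ : ℕ) : ℝ≥0∞) * q := by
  classical
  rw [witnessProduct_eq, prob_eq_expect, expect_bind]
  have h1 : ∀ C, expect (fillIn (levels 1 b d₁ d₂ d₃) b A B C)
      (Set.indicator {W | ¬ IsWitnessMatrix A B W} 1)
      ≤ ∑ p : Fin d₁ × Fin d₂, if (∃ k, A p.1 k = true ∧ B k p.2 = true) then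
        (if C p.1 p.2 = false then 1 else 0) else (0 : ℝ≥0∞) := fun C => by
    refine ((always_fillIn (levels 1 b d₁ d₂ d₃) b A B C).expect_mono
      (G := fun _ => ∑ p : Fin d₁ × Fin d₂, if (∃ k, A p.1 k = true ∧ B k p.2 = true) then
        (if C p.1 p.2 = false then 1 else 0) else (0 : ℝ≥0∞)) fun W hW => ?_).trans
      (expect_const _ _).le
    by_cases h : IsWitnessMatrix A B W
    · rw [Set.indicator_of_notMem (by simpa using h)]
      exact zero_le
    · rw [Set.indicator_of_mem (show W ∈ {W | ¬ IsWitnessMatrix A B W} from h)]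
      -- Nonempty entries are always valid, so an error is an empty entry with a witness, and then C
      -- must have missed it. Summing over all entries is the union bound.
      have : ∃ i j, W i j = none ∧ ∃ k, A i k = true ∧ B k j = true := by
        by_contra! hn
        exact h fun i j => ⟨hW.1 i j, fun h0 k hk => hn i j h0 k hk.1 hk.2⟩
      obtain ⟨i, j, h0, k, hk⟩ := this
      have hC : C i j = false := by
        by_contra hC
        exact hW.2 i j k hk (by simpa using hC) h0
      refine le_trans (le_of_eq ?_) (Finset.single_le_sum (fun _ _ => zero_le)
        (Finset.mem_univ (i, j)))
      rw [if_pos ⟨k, hk⟩, if_pos hC]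
      rfl
  refine (expect_mono h1).trans ?_
  rw [expect_sum]
  refine (Finset.sum_le_card_nsmul _ _ q fun p _ => ?_).trans (le_of_eq ?_)
  · by_cases h : ∃ k, A p.1 k = true ∧ B k p.2 = true
    · obtain ⟨k, hk⟩ := id h
      simp only [if_pos h]
      exact hq p.1 p.2 k hk.1 hk.2
    · simp only [if_neg h, expect_const]
      exact zero_le
  · rw [Finset.card_univ, Fintype.card_prod, Fintype.card_fin, Fintype.card_fin, nsmul_eq_mul]

/-! ## Running time -/

theorem expect_trials_le_one (n b : ℕ) (A : Matrix (Fin d₁) (Fin d₃) Bool)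
    (B : Matrix (Fin d₃) (Fin d₂) Bool) (W : Matrix (Fin d₁) (Fin d₂) (Option (Fin d₃)))
    (i : Fin d₁) (j : Fin d₂) :
    expect (trials n b A B W) (fun W => if W i j = none then 1 else 0) ≤ 1 := by
  refine (expect_mono (G := fun _ => 1) fun W => ?_).trans (expect_const _ _).le
  split_ifs
  · exact le_rfl
  · exact zero_le

/-- Only the trials at the level s are exploited; those at the other levels can do no harm. -/
theorem expect_trials_le (n b : ℕ) (A : Matrix (Fin d₁) (Fin d₃) Bool)
    (B : Matrix (Fin d₃) (Fin d₂) Bool) (W : Matrix (Fin d₁) (Fin d₂) (Option (Fin d₃)))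
    (i : Fin d₁) (j : Fin d₂) {s : ℕ} (hs : s ≤ n) :
    expect (trials n b A B W) (fun W => if W i j = none then 1 else 0)
      ≤ ENNReal.ofReal (missBound s b d₁ d₂ d₃ (witnesses A B i j).card
        ^ (20 * 4 ^ (n - s))) := by
  refine (expect_forEach_le_of_mem _ _ _ _ (ENNReal.ofReal (missBound s b d₁ d₂ d₃
    (witnesses A B i j).card ^ (20 * 4 ^ (n - s)))) s (List.mem_range.2 (Nat.lt_succ_of_le hs))
    (fun W s => ?_) fun W => ?_).trans (mul_le_of_le_one_right' ?_)
  · refine (expect_forEach_le _ _ _ _ 1 fun W _ _ => ?_).trans (by rw [one_pow, one_mul])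
    rw [one_mul]
    exact expect_witnessTrial_le_one A B W i j
  · refine (expect_forEach_le _ _ _ _ _ fun W _ _ =>
      expect_witnessTrial_miss_le A B W i j _ mem_witnesses).trans ?_
    rw [List.length_range, ENNReal.ofReal_pow (missBound_nonneg _ _ _ _ _ _)]
  · split_ifs
    · exact le_rfl
    · exact zero_le

/-- A geometric sum with ratio 6/4, so the total cost of all levels is comparable to 6^n, a constant
number of trials at the top level. -/
theorem sum_four_pow_mul_six_pow (n : ℕ) :
    2 * ∑ s ∈ Finset.range (n + 1), 4 ^ (n - s) * 6 ^ s + 4 ^ (n + 1) = 6 ^ (n + 1) := by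
  induction n with
  | zero => norm_num
  | succ n ih =>
    rw [Finset.sum_range_succ, Nat.sub_self, Finset.sum_congr rfl fun s hs => by
      rw [Nat.succ_sub (Nat.lt_succ_iff.1 (Finset.mem_range.1 hs)), pow_succ', mul_assoc],
      ← Finset.mul_sum]
    rw [pow_succ 6 (n + 1), pow_succ 4 (n + 1)]
    omega

theorem expectedCost_trials {n b : ℕ} (hb : 0 < b) (A : Matrix (Fin d₁) (Fin d₃) Bool)
    (B : Matrix (Fin d₃) (Fin d₂) Bool) (W : Matrix (Fin d₁) (Fin d₂) (Option (Fin d₃))) :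
    (trials n b A B W).expectedCost ≤ ((6 ^ n * (3063 * b ^ 3) : ℕ) : ℝ≥0∞) := by
  refine (expectedCost_forEach_le _ _ _
    (fun s => ((20 * 4 ^ (n - s) * (6 ^ s * (50 * b ^ 3) + 1) : ℕ) : ℝ≥0∞)) fun W s => ?_).trans ?_
  · refine (expectedCost_forEach_le _ _ _ (fun _ => ((6 ^ s * (50 * b ^ 3) : ℕ) : ℝ≥0∞))
      fun W _ => expectedCost_witnessTrial hb A B W).trans (le_of_eq ?_)
    rw [List.map_const', List.sum_replicate, List.length_range, nsmul_eq_mul]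
    push_cast
    ring
  · rw [show ((List.range (n + 1)).map fun s =>
      ((20 * 4 ^ (n - s) * (6 ^ s * (50 * b ^ 3) + 1) : ℕ) : ℝ≥0∞) + 1).sum
      = ((∑ s ∈ Finset.range (n + 1), (20 * 4 ^ (n - s) * (6 ^ s * (50 * b ^ 3) + 1) + 1) : ℕ)
        : ℝ≥0∞) by
        rw [Nat.cast_sum]
        simp only [Nat.cast_add, Nat.cast_one]
        rfl]
    refine Nat.cast_le.2 ?_
    have hb3 : 1 ≤ b ^ 3 := Nat.one_le_pow _ _ hb
    calc _ ≤ ∑ s ∈ Finset.range (n + 1), 1021 * b ^ 3 * (4 ^ (n - s) * 6 ^ s) := by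
          refine Finset.sum_le_sum fun s _ => ?_
          have h4 : 1 ≤ 4 ^ (n - s) := Nat.one_le_pow _ _ (by norm_num)
          have h6 : 1 ≤ 6 ^ s := Nat.one_le_pow _ _ (by norm_num)
          have h46 : 4 ^ (n - s) ≤ 4 ^ (n - s) * (6 ^ s * b ^ 3) :=
            Nat.le_mul_of_pos_right _ (by positivity)
          calc 20 * 4 ^ (n - s) * (6 ^ s * (50 * b ^ 3) + 1) + 1
              = 1000 * (4 ^ (n - s) * (6 ^ s * b ^ 3)) + 20 * 4 ^ (n - s) + 1 := by ring
            _ ≤ 1021 * (4 ^ (n - s) * (6 ^ s * b ^ 3)) := by omega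
            _ = _ := by ring
      _ = 1021 * b ^ 3 * ∑ s ∈ Finset.range (n + 1), 4 ^ (n - s) * 6 ^ s := by
          rw [Finset.mul_sum]
      _ ≤ 1021 * b ^ 3 * (3 * 6 ^ n) := by
          have := sum_four_pow_mul_six_pow n
          rw [pow_succ 6] at this
          refine Nat.mul_le_mul_left _ ?_
          linarith [Nat.zero_le (4 ^ (n + 1))]
      _ = _ := by ring

/-- The permutation is independent of the trials, so for each entry the probability of a search
multiplies its expected length. The former is at most η times the number of witnesses and the latter
at most 9 d₃ divided by it. The assumption `hC` excludes full fruitless searches. -/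
theorem expectedCost_fillIn {n b : ℕ} (hb : 0 < b) (A : Matrix (Fin d₁) (Fin d₃) Bool)
    (B : Matrix (Fin d₃) (Fin d₂) Bool) (C : Matrix (Fin d₁) (Fin d₂) Bool)
    (hC : ∀ i j, C i j = true → ∃ k, A i k = true ∧ B k j = true) (η : ℝ≥0∞)
    (hη : ∀ i j, (witnesses A B i j).Nonempty → ∀ W,
      expect (trials n b A B W) (fun W => if W i j = none then 1 else 0)
        ≤ η * ((witnesses A B i j).card : ℕ)) :
    (fillIn n b A B C).expectedCost
      ≤ ((5 * (d₁ * d₂) + 6 ^ n * (3063 * b ^ 3) + 7 * d₃ : ℕ) : ℝ≥0∞)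
        + η * ((9 * (d₁ * d₂ * d₃) : ℕ) : ℝ≥0∞) := by
  have h0 : (tabulate₂ fun (_ : Fin d₁) (_ : Fin d₂) =>
      op (none : Option (Fin d₃))).expectedCost ≤ ((d₁ * d₂ * 2 : ℕ) : ℝ≥0∞) := by
    have := (isDet_tabulate₂ (fun (_ : Fin d₁) (_ : Fin d₂) => op (none : Option (Fin d₃)))
      (Matrix.of fun _ _ => none) 1 fun _ _ => isDet_op _).expectedCost_le
    simpa only [Fintype.card_fin] using this
  -- the last loop, for a given result of the trials
  set E : Fin d₁ × Fin d₂ → ℝ≥0∞ := fun p => expect (shuffle d₃) fun π =>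
    ((4 * (waiting (witnesses A B p.1 p.2) π + 1) + 1 : ℕ) : ℝ≥0∞) with hE
  set F : Fin d₁ × Fin d₂ → ℝ≥0∞ := fun p => if C p.1 p.2 = true then E p else 0 with hF
  have h1 : ∀ W, (shuffle d₃ >>= fun π => finalLoop A B C π W).expectedCost
      ≤ ((7 * d₃ : ℕ) : ℝ≥0∞) + ∑ p : Fin d₁ × Fin d₂,
        (3 + (if W p.1 p.2 = none then 1 else 0) * F p) := fun W => by
    rw [expectedCost_bind]
    refine add_le_add (expectedCost_shuffle d₃)
      ((expect_mono fun π => (isDet_finalLoop A B C π W).expectedCost_le).trans (le_of_eq ?_))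
    simp only [Nat.cast_sum, expect_sum, Nat.cast_add (R := ℝ≥0∞) 3, expect_add, expect_const]
    refine Finset.sum_congr rfl fun p _ => ?_
    refine congrArg₂ _ (by norm_num) ?_
    by_cases hc : C p.1 p.2 = true
    · by_cases hw : W p.1 p.2 = none
      · simp only [hF, hE, hc, hw, Option.isNone_none, Bool.and_self, if_true, one_mul]
      · have : (W p.1 p.2).isNone = false := by simpa [Option.isNone_eq_false_iff,
          Option.isSome_iff_ne_none] using hw
        simp [hw, this]
    · simp [hF, hc]
  have h2 : ∀ W₀, (trials n b A B W₀ >>= fun W => shuffle d₃ >>= fun π =>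
      finalLoop A B C π W).expectedCost ≤ ((6 ^ n * (3063 * b ^ 3) : ℕ) : ℝ≥0∞)
        + (((7 * d₃ : ℕ) : ℝ≥0∞) + (((3 * (d₁ * d₂) : ℕ) : ℝ≥0∞)
          + η * ((9 * (d₁ * d₂ * d₃) : ℕ) : ℝ≥0∞))) := fun W₀ => by
    rw [expectedCost_bind]
    refine add_le_add (expectedCost_trials hb A B W₀) ((expect_mono h1).trans ?_)
    simp only [expect_add, expect_const, expect_sum, expect_mul_const]
    refine add_le_add le_rfl ?_
    rw [Finset.sum_add_distrib]
    refine add_le_add (le_of_eq ?_) ?_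
    · simp only [Finset.sum_const, Finset.card_univ, Fintype.card_prod, Fintype.card_fin,
        nsmul_eq_mul]
      push_cast
      ring
    · refine (Finset.sum_le_card_nsmul _ _ (η * ((9 * d₃ : ℕ) : ℝ≥0∞)) fun p _ => ?_).trans
        (le_of_eq ?_)
      · by_cases hc : C p.1 p.2 = true
        · obtain ⟨k, hk⟩ := hC _ _ hc
          simp only [hF, if_pos hc]
          calc _ ≤ η * ((witnesses A B p.1 p.2).card : ℕ) * E p :=
                mul_le_mul_left (hη p.1 p.2 ⟨k, (mem_witnesses k).2 hk⟩ W₀) _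
            _ ≤ _ := by
                rw [mul_assoc]
                exact mul_le_mul_right (expect_waiting_le _) _
        · simp only [hF, if_neg hc, mul_zero]
          exact zero_le
      · simp only [Finset.card_univ, Fintype.card_prod, Fintype.card_fin, nsmul_eq_mul]
        push_cast
        ring
  refine (expectedCost_bind_le h0 h2).trans (le_of_eq ?_)
  push_cast
  ring

theorem expectedCost_witnessProduct_le (c : ℝ) {b : ℕ} (hb : 0 < b)
    (A : Matrix (Fin d₁) (Fin d₃) Bool) (B : Matrix (Fin d₃) (Fin d₂) Bool) (η : ℝ≥0∞)
    (hη : ∀ i j, (witnesses A B i j).Nonempty → ∀ W,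
      expect (trials (levels 1 b d₁ d₂ d₃) b A B W) (fun W => if W i j = none then 1 else 0)
        ≤ η * ((witnesses A B i j).card : ℕ)) :
    (witnessProduct c b A B).expectedCost
      ≤ ((6 ^ levels (2 + 3 * c) b d₁ d₂ d₃ * (50 * b ^ 3)
          + 6 ^ levels 1 b d₁ d₂ d₃ * (3063 * b ^ 3) + 7 * (d₁ * d₂) + 7 * d₃ : ℕ) : ℝ≥0∞)
        + η * ((9 * (d₁ * d₂ * d₃) : ℕ) : ℝ≥0∞) := by
  rw [witnessProduct_eq, expectedCost_bind]
  refine (add_le_add (expectedCost_estimateProduct hb A B)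
    (((always_estimateProduct A B).expect_mono fun C hC =>
      expectedCost_fillIn hb A B C hC η hη).trans (expect_const _ _).le)).trans (le_of_eq ?_)
  push_cast
  ring

end Main

end

end BoolMM

namespace BoolMM

noncomputable section

open Comp

/-! ## The main estimates -/

section Bounds

variable {b d₁ d₂ d₃ : ℕ}

/-- The dimensions are at least 1, so ψ₁ ≥ 3, and the hypothesis transfers this to ψ₃. In particular
the logarithm is at least 1. -/
theorem three_le_ψ₃ (hd₁ : 0 < d₁) (hd₂ : 0 < d₂) (hd₃ : 0 < d₃)
    (h : ψ₁ d₁ d₂ d₃ ≤ ψ₃ d₁ d₂ d₃ ^ (0.345 : ℝ)) : 3 ≤ ψ₃ d₁ d₂ d₃ := by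
  have h₁ : (1 : ℝ) ≤ d₁ := Nat.one_le_cast.2 hd₁
  have h₂ : (1 : ℝ) ≤ d₂ := Nat.one_le_cast.2 hd₂
  have h₃ : (1 : ℝ) ≤ d₃ := Nat.one_le_cast.2 hd₃
  have hX : 1 ≤ ψ₃ d₁ d₂ d₃ := one_le_mul_of_one_le_of_one_le
    (one_le_mul_of_one_le_of_one_le h₁ h₂) h₃
  calc (3 : ℝ) ≤ ψ₁ d₁ d₂ d₃ := by unfold ψ₁; linarith
    _ ≤ ψ₃ d₁ d₂ d₃ ^ (0.345 : ℝ) := h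
    _ ≤ ψ₃ d₁ d₂ d₃ ^ (1 : ℝ) := Real.rpow_le_rpow_of_exponent_le hX (by norm_num)
    _ = ψ₃ d₁ d₂ d₃ := Real.rpow_one _

theorem one_le_log_of_three_le {x : ℝ} (hx : 3 ≤ x) : 1 ≤ Real.log x := by
  rw [Real.le_log_iff_exp_le (by linarith)]
  linarith [Real.exp_one_lt_d9]

/-- Equivalent to 7^23 ≤ 6^25. The exponent 0.08 of the search estimate is chosen as 1 - 0.92. -/
theorem log_six_div_log_seven_ge : (0.92 : ℝ) ≤ Real.log 6 / Real.log 7 := by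
  have h7 : 0 < Real.log 7 := Real.log_pos (by norm_num)
  rw [le_div_iff₀ h7]
  have h : Real.log ((7 : ℝ) ^ 23) ≤ Real.log ((6 : ℝ) ^ 25) :=
    Real.log_le_log (by norm_num) (by norm_num)
  rw [Real.log_pow, Real.log_pow] at h
  push_cast at h
  linarith

theorem log_six_div_log_seven_le : Real.log 6 / Real.log 7 ≤ 1 := by
  rw [div_le_one (Real.log_pos (by norm_num))]
  exact Real.log_le_log (by norm_num) (by norm_num)

/-- As 6 = 7^θ with θ = log 6 / log 7, the bound for 7 to the number of levels is raised to the
power θ; since θ ≤ 1, the constant need not be changed. -/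
theorem six_pow_levels_le {a : ℝ} (ha : 0 < a) (hb : 0 < b)
    (hL : 1 ≤ Real.log (ψ₃ d₁ d₂ d₃)) (hX : 1 < ψ₃ d₁ d₂ d₃) :
    6 ^ levels a b d₁ d₂ d₃ ≤ (1 + 7 * a)
      * (ψ₃ d₁ d₂ d₃ * Real.log (ψ₃ d₁ d₂ d₃)) ^ (Real.log 6 / Real.log 7) := by
  have hθ : 0 ≤ Real.log 6 / Real.log 7 := by linarith [log_six_div_log_seven_ge]
  have h6 : (7 : ℝ) ^ (Real.log 6 / Real.log 7) = 6 := by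
    rw [Real.rpow_def_of_pos (by norm_num), mul_div_cancel₀ _ (Real.log_pos (by norm_num)).ne',
      Real.exp_log (by norm_num)]
  have hXL : 0 ≤ ψ₃ d₁ d₂ d₃ * Real.log (ψ₃ d₁ d₂ d₃) := by nlinarith
  calc (6 : ℝ) ^ levels a b d₁ d₂ d₃
      = (7 ^ levels a b d₁ d₂ d₃) ^ (Real.log 6 / Real.log 7) := by
        rw [← Real.rpow_natCast 7, ← Real.rpow_mul (by norm_num), mul_comm,
          Real.rpow_mul (by norm_num), h6, Real.rpow_natCast]
    _ ≤ ((1 + 7 * a) * (ψ₃ d₁ d₂ d₃ * Real.log (ψ₃ d₁ d₂ d₃))) ^ (Real.log 6 / Real.log 7) :=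
        Real.rpow_le_rpow (by positivity) (pow_levels_le ha hb hL hX) hθ
    _ = (1 + 7 * a) ^ (Real.log 6 / Real.log 7)
        * (ψ₃ d₁ d₂ d₃ * Real.log (ψ₃ d₁ d₂ d₃)) ^ (Real.log 6 / Real.log 7) :=
        Real.mul_rpow (by positivity) hXL
    _ ≤ _ := by
        refine mul_le_mul_of_nonneg_right ?_ (Real.rpow_nonneg hXL _)
        exact (Real.rpow_le_rpow_of_exponent_le (by linarith) log_six_div_log_seven_le).trans
          (Real.rpow_one _).le

theorem rpow_le_mul_log_rpow {X u : ℝ} (hX : 1 < X) (hL : 1 ≤ Real.log X) (hu : u ≤ 0.92) :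
    X ^ u ≤ (X * Real.log X) ^ (Real.log 6 / Real.log 7) := by
  calc X ^ u ≤ X ^ (Real.log 6 / Real.log 7) :=
        Real.rpow_le_rpow_of_exponent_le hX.le (hu.trans log_six_div_log_seven_ge)
    _ ≤ _ := Real.rpow_le_rpow (by linarith) (le_mul_of_one_le_right (by linarith) hL)
        (by linarith [log_six_div_log_seven_ge])

theorem exists_prob_witnessProduct_le (b : ℕ) (hb : 0 < b) (c : ℝ) (hc : 0 < c) :
    ∃ K : ℝ, 0 < K ∧
      ∀ (d₁ d₂ d₃ : ℕ) [NeZero d₁] [NeZero d₂] [NeZero d₃]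
        (A : Matrix (Fin d₁) (Fin d₃) Bool) (B : Matrix (Fin d₃) (Fin d₂) Bool),
        ψ₁ d₁ d₂ d₃ ≤ ψ₃ d₁ d₂ d₃ ^ (0.345 : ℝ) → ψ₂ d₁ d₂ d₃ ≤ ψ₃ d₁ d₂ d₃ ^ (0.681 : ℝ) →
        (witnessProduct c b A B).prob {W | ¬ IsWitnessMatrix A B W}
          ≤ ENNReal.ofReal (K / ψ₃ d₁ d₂ d₃ ^ c) := by
  obtain ⟨M, hM, hpair⟩ := exists_pairBound_le b (1 + 7 * (2 + 3 * c)) (by linarith)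
  refine ⟨Real.exp M, Real.exp_pos _, ?_⟩
  intro d₁ d₂ d₃ _ _ _ A B h1 h2
  have hd₁ := NeZero.pos d₁
  have hd₂ := NeZero.pos d₂
  have hd₃ := NeZero.pos d₃
  have hX3 := three_le_ψ₃ hd₁ hd₂ hd₃ h1
  have hL := one_le_log_of_three_le hX3
  have hX : 1 < ψ₃ d₁ d₂ d₃ := by linarith
  have ha : (0 : ℝ) < 2 + 3 * c := by linarith
  have hlow := pow_levels_ge (b := b) (d₁ := d₁) (d₂ := d₂) (d₃ := d₃) ha hb hX
  have hP := hpair _ d₁ d₂ d₃ hL hX h1 h2 (pow_levels_le ha hb hL hX)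
  have h₁ : (0 : ℝ) < d₁ := Nat.cast_pos.2 hd₁
  have h₂ : (0 : ℝ) < d₂ := Nat.cast_pos.2 hd₂
  have h₃ : (1 : ℝ) ≤ d₃ := Nat.one_le_cast.2 hd₃
  have hXdef : ψ₃ d₁ d₂ d₃ = d₁ * d₂ * d₃ := rfl
  set n := levels (2 + 3 * c) b d₁ d₂ d₃
  set X := ψ₃ d₁ d₂ d₃
  set L := Real.log X
  have hX0 : 0 < X := by linarith
  have hΔ : hitOverlap n b (1 / d₁) (1 / 2 / d₂) (1 / d₃) ≤ M := by
    calc hitOverlap n b (1 / d₁) (1 / 2 / d₂) (1 / d₃)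
        ≤ hitOverlap n b (1 / d₁) (1 / d₂) ((1 : ℕ) / d₃) := by
          rw [Nat.cast_one]
          refine hitOverlap_mono (by positivity) (by positivity) ?_ (by positivity)
          gcongr
          norm_num
      _ ≤ ((1 : ℕ) : ℝ) ^ 2 * pairBound n b d₁ d₂ d₃ := hitOverlap_le hd₁ hd₂ hd₃ le_rfl
      _ = pairBound n b d₁ d₂ d₃ := by simp
      _ ≤ M * X ^ (-(0.0003 : ℝ)) := hP
      _ ≤ M := mul_le_of_le_one_right hM.le
          (Real.rpow_le_one_of_one_le_of_nonpos hX.le (by norm_num))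
  -- The mask halves the density, which explains the factor 2 + 3c in the number of levels: its half
  -- is 1 + 1.5 c.
  have hμ : (1 + c) * L ≤ 7 ^ n * (b : ℝ) ^ 3 * (1 / d₁ * (1 / 2 / d₂) * (1 / d₃)) := by
    have e : (7 : ℝ) ^ n * (b : ℝ) ^ 3 * (1 / d₁ * (1 / 2 / d₂) * (1 / d₃))
        = 7 ^ n * (b : ℝ) ^ 3 / (2 * X) := by
      rw [hXdef]
      field_simp
    rw [e, le_div_iff₀ (by positivity)]
    nlinarith [mul_pos hc (mul_pos hX0 (by linarith : 0 < L))]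
  refine (prob_witnessProduct_le c b A B (ENNReal.ofReal (Real.exp (M - (1 + c) * L)))
    fun i j k hA hB => (expect_estimate_miss_le A B i j k hA hB).trans
      (ENNReal.ofReal_le_ofReal (Real.exp_le_exp.2 (by linarith)))).trans ?_
  rw [← ENNReal.ofReal_natCast, ← ENNReal.ofReal_mul (by positivity)]
  refine ENNReal.ofReal_le_ofReal ?_
  rw [le_div_iff₀ (by positivity), Real.rpow_def_of_pos hX0]
  -- The number of entries costs one factor exp L = X, leaving exp(-c L) = X^(-c).
  have hdX : ((d₁ * d₂ : ℕ) : ℝ) ≤ Real.exp L := by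
    rw [Real.exp_log hX0, hXdef]
    push_cast
    exact le_mul_of_one_le_right (by positivity) h₃
  calc _ ≤ Real.exp L * Real.exp (M - (1 + c) * L) * Real.exp (L * c) := by gcongr
    _ = Real.exp M := by
        rw [← Real.exp_add, ← Real.exp_add]
        ring_nf

theorem exists_expectedCost_witnessProduct_le (b : ℕ) (hb : 0 < b) (c : ℝ) (hc : 0 < c) :
    ∃ K : ℝ, 0 < K ∧
      ∀ (d₁ d₂ d₃ : ℕ) [NeZero d₁] [NeZero d₂] [NeZero d₃]
        (A : Matrix (Fin d₁) (Fin d₃) Bool) (B : Matrix (Fin d₃) (Fin d₂) Bool),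
        ψ₁ d₁ d₂ d₃ ≤ ψ₃ d₁ d₂ d₃ ^ (0.345 : ℝ) → ψ₂ d₁ d₂ d₃ ≤ ψ₃ d₁ d₂ d₃ ^ (0.681 : ℝ) →
        (witnessProduct c b A B).expectedCost ≤ ENNReal.ofReal
          (K * (ψ₃ d₁ d₂ d₃ * Real.log (ψ₃ d₁ d₂ d₃)) ^ (Real.log 6 / Real.log 7)) := by
  obtain ⟨M, hM, hmiss⟩ := exists_missBound_pow_le b hb
  -- The summands belong to the estimate, the trials (8 = 1 + 7 · 1), the terms 7 d₁ d₂ and 7 d₃,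
  -- and the searches.
  refine ⟨(1 + 7 * (2 + 3 * c)) * (50 * (b : ℝ) ^ 3) + 8 * (3063 * (b : ℝ) ^ 3) + 14 + 9 * M,
    by positivity, ?_⟩
  intro d₁ d₂ d₃ _ _ _ A B h1 h2
  have hd₁ := NeZero.pos d₁
  have hd₂ := NeZero.pos d₂
  have hd₃ := NeZero.pos d₃
  have hX3 := three_le_ψ₃ hd₁ hd₂ hd₃ h1
  have hL := one_le_log_of_three_le hX3
  have hX : 1 < ψ₃ d₁ d₂ d₃ := by linarith
  have hX0 : 0 < ψ₃ d₁ d₂ d₃ := by linarith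
  have hη := expectedCost_witnessProduct_le c hb A B
    (ENNReal.ofReal (M * ψ₃ d₁ d₂ d₃ ^ (-(0.08 : ℝ)))) fun i j hij W => by
      rw [← ENNReal.ofReal_natCast, ← ENNReal.ofReal_mul (by positivity),
        show M * ψ₃ d₁ d₂ d₃ ^ (-(0.08 : ℝ)) * ((witnesses A B i j).card : ℝ)
          = M * ((witnesses A B i j).card * ψ₃ d₁ d₂ d₃ ^ (-(0.08 : ℝ))) by ring]
      rcases hmiss d₁ d₂ d₃ (witnesses A B i j).card hd₁ hd₂ hd₃ (Finset.card_pos.2 hij) hL hX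
        h1 h2 with h | ⟨s, hs, h⟩
      · exact (expect_trials_le_one _ b A B W i j).trans (ENNReal.one_le_ofReal.2 h)
      · exact (expect_trials_le _ b A B W i j hs).trans (ENNReal.ofReal_le_ofReal h)
  refine hη.trans ?_
  rw [← ENNReal.ofReal_natCast, ← ENNReal.ofReal_natCast, ← ENNReal.ofReal_mul (by positivity),
    ← ENNReal.ofReal_add (by positivity) (by positivity)]
  refine ENNReal.ofReal_le_ofReal ?_
  have e₁ := six_pow_levels_le (b := b) (d₁ := d₁) (d₂ := d₂) (d₃ := d₃)
    (by linarith : (0 : ℝ) < 2 + 3 * c) hb hL hX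
  have e₂ := six_pow_levels_le (b := b) (d₁ := d₁) (d₂ := d₂) (d₃ := d₃) one_pos hb hL hX
  have e₃ : (d₁ : ℝ) * d₂ ≤ (ψ₃ d₁ d₂ d₃ * Real.log (ψ₃ d₁ d₂ d₃))
      ^ (Real.log 6 / Real.log 7) := by
    refine le_trans ?_ (h2.trans (rpow_le_mul_log_rpow hX hL (by norm_num)))
    unfold ψ₂
    have : (0 : ℝ) ≤ d₁ * d₃ + d₂ * d₃ := by positivity
    linarith
  have e₄ : (d₃ : ℝ) ≤ (ψ₃ d₁ d₂ d₃ * Real.log (ψ₃ d₁ d₂ d₃))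
      ^ (Real.log 6 / Real.log 7) := by
    refine le_trans ?_ (h1.trans (rpow_le_mul_log_rpow hX hL (by norm_num)))
    unfold ψ₁
    have : (0 : ℝ) ≤ d₁ + d₂ := by positivity
    linarith
  have e₅ : M * ψ₃ d₁ d₂ d₃ ^ (-(0.08 : ℝ)) * ((9 * (d₁ * d₂ * d₃) : ℕ) : ℝ)
      ≤ 9 * M * (ψ₃ d₁ d₂ d₃ * Real.log (ψ₃ d₁ d₂ d₃)) ^ (Real.log 6 / Real.log 7) := by
    have e : ((9 * (d₁ * d₂ * d₃) : ℕ) : ℝ) = 9 * ψ₃ d₁ d₂ d₃ ^ (1 : ℝ) := by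
      rw [Real.rpow_one]
      unfold ψ₃
      push_cast
      ring
    calc _ = 9 * M * (ψ₃ d₁ d₂ d₃ ^ (-(0.08 : ℝ)) * ψ₃ d₁ d₂ d₃ ^ (1 : ℝ)) := by
          rw [e]
          ring
      _ ≤ _ := by
          rw [← Real.rpow_add hX0]
          exact mul_le_mul_of_nonneg_left (rpow_le_mul_log_rpow hX hL (by norm_num))
            (by positivity)
  have e₁' := mul_le_mul_of_nonneg_right e₁ (by positivity : 0 ≤ 50 * (b : ℝ) ^ 3)
  have e₂' := mul_le_mul_of_nonneg_right e₂ (by positivity : 0 ≤ 3063 * (b : ℝ) ^ 3)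
  push_cast at e₅ ⊢
  linarith

end Bounds

end

end BoolMM

/-! ### The theorem -/

theorem mainTheorem3 (b : ℕ) (hb : 0 < b) (c : ℝ) (hc : 0 < c) :
    ∃ K : ℝ, 0 < K ∧
      ∀ (d₁ d₂ d₃ : ℕ) [NeZero d₁] [NeZero d₂] [NeZero d₃]
        (A : Matrix (Fin d₁) (Fin d₃) Bool) (B : Matrix (Fin d₃) (Fin d₂) Bool),
        BoolMM.ψ₁ d₁ d₂ d₃ ≤ BoolMM.ψ₃ d₁ d₂ d₃ ^ (0.345 : ℝ) →
        BoolMM.ψ₂ d₁ d₂ d₃ ≤ BoolMM.ψ₃ d₁ d₂ d₃ ^ (0.681 : ℝ) →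
        (BoolMM.witnessProduct c b A B).prob {W | ¬ BoolMM.IsWitnessMatrix A B W} ≤
            ENNReal.ofReal (K / BoolMM.ψ₃ d₁ d₂ d₃ ^ c) ∧
        (BoolMM.witnessProduct c b A B).expectedCost ≤
            ENNReal.ofReal
              (K * (BoolMM.ψ₃ d₁ d₂ d₃ * Real.log (BoolMM.ψ₃ d₁ d₂ d₃)) ^
                (Real.log 6 / Real.log 7)) := by
  obtain ⟨K₁, hK₁, h₁⟩ := BoolMM.exists_prob_witnessProduct_le b hb c hc
  obtain ⟨K₂, hK₂, h₂⟩ := BoolMM.exists_expectedCost_witnessProduct_le b hb c hc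
  refine ⟨K₁ + K₂, by linarith, fun d₁ d₂ d₃ _ _ _ A B hψ₁ hψ₂ =>
    ⟨(h₁ d₁ d₂ d₃ A B hψ₁ hψ₂).trans (ENNReal.ofReal_le_ofReal ?_),
      (h₂ d₁ d₂ d₃ A B hψ₁ hψ₂).trans (ENNReal.ofReal_le_ofReal ?_)⟩⟩
  all_goals
    have hX := BoolMM.three_le_ψ₃ (NeZero.pos d₁) (NeZero.pos d₂) (NeZero.pos d₃) hψ₁
  · refine div_le_div_of_nonneg_right (by linarith) (Real.rpow_nonneg (by linarith) _)
  · refine mul_le_mul_of_nonneg_right (by linarith) (Real.rpow_nonneg ?_ _)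
    have hL := BoolMM.one_le_log_of_three_le hX
    nlinarith
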